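/- Let $(M,g)$ be a smooth $n$-dimensional Riemannian manifold without boundary, $n\ge 2$. Let $$\mathcal R(M,g)=\{(x,V,R)\in TM\oplus TM:\ \langle R,V\rangle_g=0,\ |R|_g=|V|_g>0\},$$ which is a smooth embedded submanifold of $TM\oplus TM$ of dimension $3n-2$. For a smooth regular curve $\gamma:[0,1]\to M$ let $D_t$ be the Levi-Civita covariant derivative along $\gamma$, let $\pi_{\dot\gamma^\perp}$ be the orthogonal projection onto $\dot\gamma^\perp$, let $\kappa_g(\gamma)=|\pi_{\dot\gamma^\perp}D_t\dot\gamma|/|\dot\gamma|^2$ and, when $\kappa_g(\gamma)$ never vanishes, let $$R_g(\gamma)=\frac1{\kappa_g(\gamma)}\,\frac{\pi_{\dot\gamma^\perp}D_t\dot\gamma}{|\pi_{\dot\gamma^\perp}D_t\dot\gamma|},\qquad c_\pm(\gamma)=\Big(\gamma,\ \pm|R_g(\gamma)|\frac{\dot\gamma}{|\dot\gamma|},\ R_g(\gamma)\Big).$$ The lifts $c_\pm(\gamma)$ are smooth curves in $\mathcal R(M,g)$. For $q\in\mathcal R(M,g)$ let $\mathcal D_q=\mathcal D(M,g)_q$ be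 the linear span of the velocities at $t=0$ of all lifts $c_\pm(\gamma)$, with $\gamma:[0,1]\to M$ as above, such that $c_\pm(\gamma)(0)=q$. Put $\mathcal D^{k+1}=\mathcal D^k+[\mathcal D,\mathcal D^k]$ and, for vector fields, $f_{i_1i_2\dots i_k}=[f_{i_1},[f_{i_2},[\dots f_{i_k}]]\dots]$. Then: 1. $\mathcal D$ is a smooth distribution of rank $n$ on $\mathcal R(M,g)$. 2. A smooth curve $(\gamma,V,R):[0,1]\to\mathcal R(M,g)$ equals $c_+(\gamma)$ or $c_-(\gamma)$ for a smooth regular curve $\gamma$ with never vanishing geodesic curvature if and only if it is tangent to $\mathcal D$ and $\gamma$ is regular. 3. Around every point of $\mathcal R(M,g)$ there are smooth local $b_3(x,V,R),\dots,b_n(x,V,R)$ that form an orthogonal basis of $\{R,V\}^\perp\subset T_xM$ consisting of vectors of norm $|R|$. For each such choice there are smooth local vector fields $f_1,\dots,f_n$ characterised by the ODEs of their integral curves $$f_1:\begin{cases}\dot x=V\\ D_tR=-V\\ D_tV=R\end{cases}\qquad f_2:\begin{cases}\dot x=0\\ \dot R=R\\ \dot V=V\end{cases}\qquad f_j:\begin{cases}\dot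 x=0\\ \dot R=b_j(x,V,R)\\ \dot V=0\end{cases}\quad(j=3,\dots,n),$$ and $f_1,\dots,f_n$ is a local basis of $\mathcal D$. 4. $\mathcal D$ is bracket generating of step $3$ with growth $(n,2n-1,3n-2)$, and for every frame as in 3, $$\mathcal D=\langle f_1,\dots,f_n\rangle,\quad \mathcal D^2=\mathcal D\oplus\langle\{f_{1k}\}_{k=2}^n\rangle,\quad \mathcal D^3=\mathcal D^2\oplus\langle\{f_{1k1}\}_{k=2}^n\rangle=T\mathcal R(M,g).$$ 5. For every frame as in 3 and all $j,k=2,\dots,n$: $f_{jk}\in\mathcal D$ and $f_{j1k}\in\mathcal D^2$. -/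

import Mathlib

open Bundle Set
open scoped Manifold ContDiff Topology

noncomputable section

namespace CurvatureRadii

/-! ### Embedded submanifolds, tangent spaces and distributions

Generic notions for a subset `S` of a boundaryless manifold `N`.  A smooth vector field on an
embedded submanifold `S` is handled through a smooth extension to an open subset of `N`; Lie
brackets of fields that are tangent to `S` do not depend, along `S`, on the extensions. -/

section Generic

variable {F : Type*} [NormedAddCommGroup F] [NormedSpace ℝ F]
  {H : Type*} [TopologicalSpace H] (J : ModelWithCorners ℝ F H)
  {N : Type*} [TopologicalSpace N] [ChartedSpace H N]

/-- `S` is a smooth embedded submanifold of dimension `d`: around each of its points there is a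
chart of the maximal smooth atlas in which `S` is a `d`-dimensional linear subspace. -/
def IsEmbeddedSubmanifold (S : Set N) (d : ℕ) : Prop :=
  ∀ q ∈ S, ∃ e ∈ IsManifold.maximalAtlas J ∞ N, q ∈ e.source ∧
    ∃ L : Submodule ℝ F, Module.finrank ℝ L = d ∧
      ∀ p ∈ e.source, p ∈ S ↔ e.extend J p ∈ L

/-- The velocity of the curve `c`, defined on `s`, at time `t`. -/
def velocity (c : ℝ → N) (s : Set ℝ) (t : ℝ) : TangentSpace J (c t) :=
  mfderivWithin 𝓘(ℝ, ℝ) J c s t (1 : ℝ)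

/-- The curve `c` restricted to `s` is smooth. -/
def IsSmoothCurve (c : ℝ → N) (s : Set ℝ) : Prop :=
  ContMDiffOn 𝓘(ℝ, ℝ) J ∞ c s

/-- The tangent space at `q` of a submanifold `S`, as a subset of the ambient tangent space:
the velocities at `q` of the smooth curves contained in `S`. -/
def tangentSet (S : Set N) (q : N) : Set (TangentSpace J q) :=
  {v | ∃ (ε : ℝ) (c : ℝ → N), 0 < ε ∧ IsSmoothCurve J c (Ioo (-ε) ε) ∧
    (∀ t ∈ Ioo (-ε) ε, c t ∈ S) ∧
    (⟨c 0, velocity J c (Ioo (-ε) ε) 0⟩ : TangentBundle J N) = ⟨q, v⟩}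

/-- The vector field `X` is smooth on the set `W`. -/
def IsSmoothFieldOn (X : ∀ p : N, TangentSpace J p) (W : Set N)
    [IsManifold J 1 N] : Prop :=
  ContMDiffOn J J.tangent ∞ (fun p => (⟨p, X p⟩ : TangentBundle J N)) W

/-- `X` is a smooth local section, near `q`, of the family `Δ` of subspaces along `S`. -/
def IsLocalSectionAt [IsManifold J 1 N] (S : Set N) (Δ : ∀ p : N, Submodule ℝ (TangentSpace J p))
    (q : N) (X : ∀ p : N, TangentSpace J p) : Prop :=
  ∃ W : Set N, IsOpen W ∧ q ∈ W ∧ IsSmoothFieldOn J X W ∧ ∀ p ∈ W ∩ S, X p ∈ Δ p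

/-- `Δ` is a smooth distribution of rank `r` on the submanifold `S`. -/
def IsSmoothDistribution [IsManifold J 1 N] (S : Set N)
    (Δ : ∀ p : N, Submodule ℝ (TangentSpace J p)) (r : ℕ) : Prop :=
  ∀ q ∈ S, (Δ q : Set (TangentSpace J q)) ⊆ tangentSet J S q ∧ Module.finrank ℝ (Δ q) = r ∧
    ∃ (W : Set N) (X : Fin r → ∀ p : N, TangentSpace J p), IsOpen W ∧ q ∈ W ∧
      (∀ i, IsSmoothFieldOn J (X i) W) ∧
      ∀ p ∈ W ∩ S, Δ p = Submodule.span ℝ (range fun i => X i p)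

/-- The flag of `Δ`: `Δ¹ = Δ` and `Δᵏ⁺¹ = Δᵏ + [Δ, Δᵏ]` (the value at `0` is the zero
distribution). -/
def bracketFlag [IsManifold J 1 N] (S : Set N) (Δ : ∀ p : N, Submodule ℝ (TangentSpace J p)) :
    ℕ → ∀ p : N, Submodule ℝ (TangentSpace J p)
  | 0 => fun _ => ⊥
  | 1 => Δ
  | k + 2 => fun q => bracketFlag S Δ (k + 1) q ⊔ Submodule.span ℝ
      {v | ∃ X Y : ∀ p : N, TangentSpace J p, IsLocalSectionAt J S Δ q X ∧
        IsLocalSectionAt J S (bracketFlag S Δ (k + 1)) q Y ∧ v = VectorField.mlieBracket J X Y q}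

end Generic

/-! ### Riemannian geometry: Levi-Civita derivative along curves, radius of curvature -/

/-- The model space `ℝⁿ`. -/
abbrev En (n : ℕ) : Type := EuclideanSpace ℝ (Fin n)

/-- The model with corners of an `n`-manifold without boundary. -/
abbrev IM (n : ℕ) : ModelWithCorners ℝ (En n) (En n) := 𝓘(ℝ, En n)

/-- The total space of `TM ⊕ TM`; its points are `⟨x, (V, R)⟩`. -/
abbrev TT (n : ℕ) (M : Type*) [TopologicalSpace M] [ChartedSpace (En n) M] : Type _ :=
  TotalSpace (En n × En n) (fun x : M => TangentSpace (IM n) x × TangentSpace (IM n) x)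

/-- The model with corners of `TM ⊕ TM`. -/
abbrev ITT (n : ℕ) : ModelWithCorners ℝ (En n × (En n × En n)) (ModelProd (En n) (En n × En n)) :=
  (IM n).prod 𝓘(ℝ, En n × En n)

section Riemannian

variable {n : ℕ} {M : Type*} [TopologicalSpace M] [ChartedSpace (En n) M]
  [IsManifold (IM n) ∞ M]
  (g : ContMDiffRiemannianMetric (IM n) ∞ (En n) (fun x : M => TangentSpace (IM n) x))

/-- The norm of a tangent vector. -/
def gnorm {x : M} (v : TangentSpace (IM n) x) : ℝ := Real.sqrt (g.inner x v v)

/-- The coefficient `g_{ij}` of the metric in the preferred chart at `x₀`, at the point of `M` with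
coordinates `y`. -/
def metricCoeff (x₀ : M) (y : En n) : Matrix (Fin n) (Fin n) ℝ := fun i j =>
  g.inner ((extChartAt (IM n) x₀).symm y)
    (mfderiv 𝓘(ℝ, En n) (IM n) (extChartAt (IM n) x₀).symm y (EuclideanSpace.single i (1 : ℝ)))
    (mfderiv 𝓘(ℝ, En n) (IM n) (extChartAt (IM n) x₀).symm y (EuclideanSpace.single j (1 : ℝ)))

/-- The partial derivative `∂_k g_{ij}` in the preferred chart at `x₀`. -/
def metricCoeffDeriv (x₀ : M) (y : En n) (k i j : Fin n) : ℝ :=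
  fderiv ℝ (fun z => metricCoeff g x₀ z i j) y (EuclideanSpace.single k (1 : ℝ))

/-- The Christoffel symbol `Γ^k_{ij}` of the Levi-Civita connection in the preferred chart at
`x₀`. -/
def christoffel (x₀ : M) (y : En n) (k i j : Fin n) : ℝ :=
  (1 / 2) * ∑ l, (metricCoeff g x₀ y)⁻¹ k l *
    (metricCoeffDeriv g x₀ y i j l + metricCoeffDeriv g x₀ y j i l - metricCoeffDeriv g x₀ y l i j)

/-- The components of a tangent vector at `x` in the preferred chart at `x`. -/
def comps {x : M} (v : TangentSpace (IM n) x) : En n := v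

/-- The vector `Γ(v, w)` with components `∑ Γ^k_{ij} vⁱ wʲ`, computed at the centre `x` of the
preferred chart at `x`, whose coordinates on `T_x M` are those of the model space `ℝⁿ`. -/
def christoffelVec (x : M) (v w : TangentSpace (IM n) x) : TangentSpace (IM n) x :=
  (WithLp.toLp 2 fun k : Fin n => ∑ i, ∑ j,
    christoffel g x (extChartAt (IM n) x x) k i j * comps v i * comps w j : En n)

/-- The derivative at `t` of the components of a vector field `X` along `c`, in the preferred chart
at `c t`.  Where the velocity of `c` vanishes this is the derivative of `X` in the fibre. -/
def coordDeriv (c : ℝ → M) (X : ∀ t, TangentSpace (IM n) (c t)) (s : Set ℝ) (t : ℝ) :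
    TangentSpace (IM n) (c t) :=
  (derivWithin (fun τ => (trivializationAt (En n) (fun x : M => TangentSpace (IM n) x) (c t)
    ⟨c τ, X τ⟩).2) s t : En n)

/-- The Levi-Civita covariant derivative `D_t X` of a vector field `X` along the curve `c`, whose
parameter ranges over `s`. -/
def covDeriv (c : ℝ → M) (X : ∀ t, TangentSpace (IM n) (c t)) (s : Set ℝ) (t : ℝ) :
    TangentSpace (IM n) (c t) :=
  coordDeriv c X s t + christoffelVec g (c t) (velocity (IM n) c s t) (X t)

/-- The curve `c` is regular on `s`: its velocity never vanishes. -/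
def IsRegularCurve (n : ℕ) {M : Type*} [TopologicalSpace M] [ChartedSpace (En n) M] (c : ℝ → M) (s : Set ℝ) : Prop := ∀ t ∈ s, velocity (IM n) c s t ≠ 0

/-- The component of `D_t ċ` orthogonal to `ċ`. -/
def normalAcc (c : ℝ → M) (s : Set ℝ) (t : ℝ) : TangentSpace (IM n) (c t) :=
  covDeriv g c (velocity (IM n) c s) s t -
    (g.inner (c t) (covDeriv g c (velocity (IM n) c s) s t) (velocity (IM n) c s t) /
      g.inner (c t) (velocity (IM n) c s t) (velocity (IM n) c s t)) • velocity (IM n) c s t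

/-- The geodesic curvature of `c`. -/
def geodCurvature (c : ℝ → M) (s : Set ℝ) (t : ℝ) : ℝ :=
  gnorm g (normalAcc g c s t) / gnorm g (velocity (IM n) c s t) ^ 2

/-- The (vectorial) radius of curvature `R_g(c)`. -/
def curvatureRadius (c : ℝ → M) (s : Set ℝ) (t : ℝ) : TangentSpace (IM n) (c t) :=
  (1 / geodCurvature g c s t) • (1 / gnorm g (normalAcc g c s t)) • normalAcc g c s t

/-- The lift `t ↦ (c, ε |R_g(c)| ċ / |ċ|, R_g(c))`, used with `ε = 1` and `ε = -1`. -/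
def curvatureLift (ε : ℝ) (c : ℝ → M) (s : Set ℝ) (t : ℝ) : TT n M :=
  ⟨c t, ((ε * gnorm g (curvatureRadius g c s t) / gnorm g (velocity (IM n) c s t)) •
    velocity (IM n) c s t, curvatureRadius g c s t)⟩

/-- The manifold of curvature radii, as a subset of `TM ⊕ TM`. -/
def curvatureRadiiSet : Set (TT n M) :=
  {q | g.inner q.proj q.2.2 q.2.1 = 0 ∧ gnorm g q.2.2 = gnorm g q.2.1 ∧ 0 < gnorm g q.2.1}

/-- `σ : [0,1] → TM ⊕ TM` is one of the two lifts of a smooth regular curve `c : [0,1] → M` with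
never vanishing geodesic curvature. -/
def IsLift (σ : ℝ → TT n M) : Prop :=
  ∃ (c : ℝ → M) (ε : ℝ), IsSmoothCurve (IM n) c (Icc 0 1) ∧ IsRegularCurve n c (Icc 0 1) ∧
    (∀ t ∈ Icc (0 : ℝ) 1, geodCurvature g c (Icc 0 1) t ≠ 0) ∧ (ε = 1 ∨ ε = -1) ∧
    ∀ t ∈ Icc (0 : ℝ) 1, σ t = curvatureLift g ε c (Icc 0 1) t

/-- The space `D(M,g)_q`: the span of the initial velocities of the lifts that start at `q`. -/
def distr (q : TT n M) : Submodule ℝ (TangentSpace (ITT n) q) :=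
  Submodule.span ℝ {v | ∃ σ : ℝ → TT n M, IsLift g σ ∧
    (⟨σ 0, velocity (ITT n) σ (Icc 0 1) 0⟩ : TangentBundle (ITT n) (TT n M)) = ⟨q, v⟩}

/-- `b_3, …, b_n` is a smooth frame of `{R, V}^⊥`, over the part in the open set `W` of the manifold
of curvature radii, consisting of orthogonal vectors of norm `|R|`. -/
structure IsOrthFrame (W : Set (TT n M)) (b : ℕ → ∀ q : TT n M, TangentSpace (IM n) q.proj) :
    Prop where
  isOpen : IsOpen W
  smooth : ∀ j ∈ Icc 3 n, ContMDiffOn (ITT n) (IM n).tangent ∞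
    (fun q : TT n M => (⟨q.proj, b j q⟩ : TangentBundle (IM n) M)) W
  orth_R : ∀ j ∈ Icc 3 n, ∀ q ∈ W ∩ curvatureRadiiSet g, g.inner q.proj (b j q) q.2.2 = 0
  orth_V : ∀ j ∈ Icc 3 n, ∀ q ∈ W ∩ curvatureRadiiSet g, g.inner q.proj (b j q) q.2.1 = 0
  orth : ∀ i ∈ Icc 3 n, ∀ j ∈ Icc 3 n, i ≠ j → ∀ q ∈ W ∩ curvatureRadiiSet g,
    g.inner q.proj (b i q) (b j q) = 0
  norm_eq : ∀ j ∈ Icc 3 n, ∀ q ∈ W ∩ curvatureRadiiSet g, gnorm g (b j q) = gnorm g q.2.2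

/-- The field `X` is characterised on `W ∩ S` by the ODE `ode` of its integral curves: a smooth
curve in `W ∩ S` defined on an open interval `s` is an integral curve of `X` iff `ode σ s t` holds
for all `t ∈ s`. -/
def HasODE (S W : Set (TT n M)) (X : ∀ q : TT n M, TangentSpace (ITT n) q)
    (ode : (ℝ → TT n M) → Set ℝ → ℝ → Prop) : Prop :=
  ∀ (a c : ℝ) (σ : ℝ → TT n M), IsSmoothCurve (ITT n) σ (Ioo a c) →
    (∀ t ∈ Ioo a c, σ t ∈ W ∩ S) →
    (IsMIntegralCurveOn σ X (Ioo a c) ↔ ∀ t ∈ Ioo a c, ode σ (Ioo a c) t)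

/-- The fields `f_1, …, f_n` (smooth on the open set `W` of `TM ⊕ TM`) are characterised, along the
manifold of curvature radii, by the ODEs
`f_1 : ẋ = V, D_t R = -V, D_t V = R`, `f_2 : ẋ = 0, Ṙ = R, V̇ = V`,
`f_j : ẋ = 0, Ṙ = b_j(x,V,R), V̇ = 0` for `j = 3, …, n`. -/
structure IsAdaptedFrame (W : Set (TT n M)) (b : ℕ → ∀ q : TT n M, TangentSpace (IM n) q.proj)
    (f : ℕ → ∀ q : TT n M, TangentSpace (ITT n) q) : Prop where
  smooth : ∀ k ∈ Icc 1 n, IsSmoothFieldOn (ITT n) (f k) W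
  ode_one : HasODE (curvatureRadiiSet g) W (f 1) fun σ s t =>
    velocity (IM n) (fun τ => (σ τ).proj) s t = (σ t).2.1 ∧
    covDeriv g (fun τ => (σ τ).proj) (fun τ => (σ τ).2.2) s t = -(σ t).2.1 ∧
    covDeriv g (fun τ => (σ τ).proj) (fun τ => (σ τ).2.1) s t = (σ t).2.2
  ode_two : HasODE (curvatureRadiiSet g) W (f 2) fun σ s t =>
    velocity (IM n) (fun τ => (σ τ).proj) s t = 0 ∧
    coordDeriv (fun τ => (σ τ).proj) (fun τ => (σ τ).2.2) s t = (σ t).2.2 ∧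
    coordDeriv (fun τ => (σ τ).proj) (fun τ => (σ τ).2.1) s t = (σ t).2.1
  ode_ge_three : ∀ j ∈ Icc 3 n, HasODE (curvatureRadiiSet g) W (f j) fun σ s t =>
    velocity (IM n) (fun τ => (σ τ).proj) s t = 0 ∧
    coordDeriv (fun τ => (σ τ).proj) (fun τ => (σ τ).2.2) s t = b j (σ t) ∧
    coordDeriv (fun τ => (σ τ).proj) (fun τ => (σ τ).2.1) s t = 0

end Riemannian

/-- The bracket `[X, Y]` of vector fields on `TM ⊕ TM`. -/
abbrev br {n : ℕ} {M : Type*} [TopologicalSpace M] [ChartedSpace (En n) M]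
    [IsManifold (IM n) ∞ M] (X Y : ∀ q : TT n M, TangentSpace (ITT n) q) :
    ∀ q : TT n M, TangentSpace (ITT n) q :=
  VectorField.mlieBracket (ITT n) X Y

end CurvatureRadii

end

open CurvatureRadii

/-!
The Levi-Civita connection splits a tangent vector `w` of `TM ⊕ TM` at `(x, V, R)` into three vectors
of `T_x M`: its base component `baseMap`, and the connector components `connV`, `connR`. For the
velocity of a curve `(c, V, R)` these are `ċ`, `D_t V` and `D_t R` (`baseMap_velocity`,
`connV_velocity`, `connR_velocity`), which rests on the transformation law of Christoffel symbols.
Since the connection is metric, the equations `⟨R, V⟩ = 0`, `|R|² = |V|²` have an explicit and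
surjective derivative wherever `V ≠ 0` (`mfderiv_levelMap`, `mfderiv_levelMap_surjective`), so the
manifold of curvature radii is a regular level set.

*The distribution.* Let `firstFlag` be the space of the tangent vectors of the level set with base
component `l V` and `D_t V`-component `l R + m V`. For a curve `(c, V, R)` in the level set with
`ċ = l V` and `l ≠ 0`, the normal part of `D_t ċ` is `l` times the normal part of `D_t V`
(`normalAcc_eq_of_velocity_eq_smul`). Hence lifts are tangent to `firstFlag` (`IsLift.spec`), and
conversely, if `D_t V = l R + m V`, the normal acceleration is `l² R`, whose radius of curvature is
`R`; as `l` has constant sign on `[0, 1]`, the curve is one of the two lifts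
(`isLift_of_velocity_mem`). Applied to integral curves of `f_1` and `f_1 + f_k`, this shows that the
velocities of lifts span `firstFlag` (`distr_eq_firstFlag`). Integral curves inside the level set
also show that the ODEs determine the fields `f_k` along it (`IsAdaptedFrame.eq_frameField`), and
the frames `b` come from Gram–Schmidt (`exists_isOrthFrame`).

*The brackets.* For fields `X`, `Y` tangent to the level set whose components are `l V` and
`l R + m V`, the Christoffel terms cancel in the components of `[X, Y]` (`baseMap_br`, `connV_br`).
The base component of a bracket of two sections of the distribution is therefore still a multiple of
`V`, and `secondFlag`, the space of all tangent vectors with base component along `V`, contains the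
second step of the flag. For the frame, the brackets `[f_1, f_k]` have components along
`R, b_3, …, b_n` in the `D_t V` direction, and `[f_1, [f_k, f_1]]` have these vectors as base
components, up to sign. Comparing with the orthogonal basis `V, R, b_3, …, b_n` of `T_x M`
(`complement_of_symbol`) gives the direct sums, and with them the growth vector
(`secondFlag_complement`, `tangentSubmodule_complement`, `bracketFlag_two`, `bracketFlag_three`).
-/

noncomputable section

namespace CurvatureRadii

/-! ### Level sets of submersions between normed spaces -/

section LevelSets

variable {P K : Type*} [NormedAddCommGroup P] [NormedSpace ℝ P]
  [NormedAddCommGroup K] [NormedSpace ℝ K]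

/-- An integral curve of a smooth field is smooth. -/
lemma contDiffOn_of_hasDerivAt_comp {Y : P → P} {O : Set P} (hY : ContDiffOn ℝ ∞ Y O)
    {c : ℝ → P} {s : Set ℝ} (hs : IsOpen s) (hc : ∀ t ∈ s, c t ∈ O)
    (hd : ∀ t ∈ s, HasDerivAt c (Y (c t)) t) : ContDiffOn ℝ ∞ c s := by
  have hcd : ∀ t ∈ s, deriv c t = Y (c t) := fun t ht => (hd t ht).deriv
  rw [contDiffOn_infty]
  intro k
  induction k with
  | zero =>
    rw [Nat.cast_zero, contDiffOn_zero]
    exact fun t ht => (hd t ht).continuousAt.continuousWithinAt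
  | succ k ih =>
    rw [Nat.cast_succ, contDiffOn_succ_iff_deriv_of_isOpen hs]
    refine ⟨fun t ht => (hd t ht).differentiableAt.differentiableWithinAt, fun h => ?_, ?_⟩
    · exact absurd h (by simp)
    · refine ContDiffOn.congr ?_ hcd
      exact ContDiffOn.comp (hY.of_le (by exact_mod_cast le_top)) ih hc

variable [FiniteDimensional ℝ P] [FiniteDimensional ℝ K]

/-- Through a regular point of a level set of `F` there passes, inside the level set, an integral
curve of any smooth field that is tangent to the level set.  The field is first corrected so that
`F` is conserved off the level set as well. -/
lemma exists_integralCurve_in_levelSet {F : P → K} {O : Set P} (hO : IsOpen O)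
    (hF : ContDiffOn ℝ ∞ F O) {p₀ : P} (hp₀ : p₀ ∈ O)
    (hsurj : Function.Surjective (fderiv ℝ F p₀)) {Y : P → P} (hY : ContDiffOn ℝ ∞ Y O)
    (hY₀ : fderiv ℝ F p₀ (Y p₀) = 0) :
    ∃ ε > (0 : ℝ), ∃ c : ℝ → P, c 0 = p₀ ∧ ContDiffOn ℝ ∞ c (Ioo (-ε) ε) ∧
      (∀ t ∈ Ioo (-ε) ε, c t ∈ O ∧ F (c t) = F p₀) ∧ HasDerivAt c (Y p₀) 0 ∧
      ∀ t ∈ Ioo (-ε) ε, fderiv ℝ F (c t) (Y (c t)) = 0 → HasDerivAt c (Y (c t)) t := by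
  obtain ⟨s₀, hs₀⟩ := (fderiv ℝ F p₀).exists_rightInverse_of_surjective
    (LinearMap.range_eq_top.2 hsurj)
  have hdF : ContDiffOn ℝ ∞ (fderiv ℝ F) O :=
    hF.fderiv_of_isOpen hO (by simp)
  -- `A p` is invertible near `p₀`, and `s₀ ∘ (A p)⁻¹` is a right inverse of the derivative at `p`
  set A : P → K →L[ℝ] K := fun p => (fderiv ℝ F p).comp s₀ with hA
  have hA₀ : A p₀ = ContinuousLinearMap.id ℝ K := hs₀
  have hAc : ContDiffOn ℝ ∞ A O := hdF.clm_comp contDiffOn_const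
  set O' : Set P := O ∩ A ⁻¹' {B | B.IsInvertible} with hO'
  have hO'o : IsOpen O' :=
    hAc.continuousOn.isOpen_inter_preimage hO ContinuousLinearEquiv.isOpen
  have hp₀' : p₀ ∈ O' := ⟨hp₀, by
    change (A p₀).IsInvertible
    rw [hA₀]; exact ContinuousLinearMap.isInvertible_equiv (f := .refl ℝ K)⟩
  set Z : P → P := fun p => Y p - s₀ ((A p).inverse (fderiv ℝ F p (Y p))) with hZ
  have hinv : ContDiffOn ℝ ∞ (fun p => (A p).inverse) O' := fun p hp =>
    (ContinuousLinearMap.IsInvertible.contDiffAt_map_inverse hp.2).comp_contDiffWithinAt p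
      ((hAc p hp.1).mono inter_subset_left)
  have hZc : ContDiffOn ℝ ∞ Z O' := by
    have hY' := hY.mono (inter_subset_left : O' ⊆ O)
    have hdF' := hdF.mono (inter_subset_left : O' ⊆ O)
    exact hY'.sub (s₀.contDiff.comp_contDiffOn (hinv.clm_apply (hdF'.clm_apply hY')))
  have hFZ : ∀ p ∈ O', fderiv ℝ F p (Z p) = 0 := by
    rintro p ⟨-, B, hB⟩
    have : ∀ k, fderiv ℝ F p (s₀ k) = B k := fun k => by
      rw [show (B k) = A p k by rw [← hB]; rfl]; rfl
    simp only [hZ, map_sub, this, ← hB, ContinuousLinearMap.inverse_equiv]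
    simp
  have hZ₀ : Z p₀ = Y p₀ := by simp [hZ, hY₀]
  obtain ⟨c, hc0, ε, hε, hc⟩ :=
    ContDiffAt.exists_forall_mem_closedBall_exists_eq_forall_mem_Ioo_hasDerivAt₀
      (((hZc.contDiffAt (hO'o.mem_nhds hp₀')).of_le (by simp))) 0
  have hcc : ContinuousOn c (Ioo (0 - ε) (0 + ε)) :=
    fun t ht => (hc t ht).continuousAt.continuousWithinAt
  have hnb : ∀ᶠ t in 𝓝 (0 : ℝ), c t ∈ O' := by
    refine (hcc.continuousAt (Ioo_mem_nhds (by linarith) (by linarith))).eventually ?_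
    rw [hc0]; exact hO'o.mem_nhds hp₀'
  obtain ⟨δ, hδ, hball⟩ := Metric.eventually_nhds_iff_ball.1 hnb
  set η := min ε δ with hη
  have hη0 : 0 < η := lt_min hε hδ
  have hsub : ∀ t ∈ Ioo (-η) η, HasDerivAt c (Z (c t)) t ∧ c t ∈ O' := by
    intro t ht
    have h1 : η ≤ ε := min_le_left _ _
    have h2 : η ≤ δ := min_le_right _ _
    refine ⟨hc t ⟨by linarith [ht.1], by linarith [ht.2]⟩, hball t ?_⟩
    rw [Metric.mem_ball, Real.dist_eq, sub_zero, abs_lt]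
    exact ⟨by linarith [ht.1], by linarith [ht.2]⟩
  have hconst : ∀ t ∈ Ioo (-η) η, F (c t) = F p₀ := by
    intro t ht
    rw [← hc0]
    refine isOpen_Ioo.is_const_of_deriv_eq_zero (f := fun t => F (c t))
      isPreconnected_Ioo ?_ ?_ ht ⟨by linarith, hη0⟩
    · intro u hu
      exact ((((hF.differentiableOn (by simp)).differentiableAt
        (hO.mem_nhds (hsub u hu).2.1)).hasFDerivAt.comp_hasDerivAt u
          (hsub u hu).1)).differentiableAt.differentiableWithinAt
    · intro u hu
      have := (((hF.differentiableOn (by simp)).differentiableAt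
        (hO.mem_nhds (hsub u hu).2.1)).hasFDerivAt.comp_hasDerivAt u (hsub u hu).1).deriv
      rw [hFZ _ (hsub u hu).2] at this
      exact this
  refine ⟨η, hη0, c, hc0, contDiffOn_of_hasDerivAt_comp hZc isOpen_Ioo
    (fun t ht => (hsub t ht).2) fun t ht => (hsub t ht).1,
    fun t ht => ⟨(hsub t ht).2.1, hconst t ht⟩, ?_, fun t ht h0 => ?_⟩
  · have := (hsub 0 ⟨by linarith, hη0⟩).1
    rwa [hc0, hZ₀] at this
  · have := (hsub t ht).1
    rwa [show Z (c t) = Y (c t) by simp [hZ, h0]] at this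

/-- Two functions that agree on a level set have the same derivatives in directions tangent to
it. -/
lemma fderiv_eq_of_eqOn_levelSet {Q : Type*} [NormedAddCommGroup Q] [NormedSpace ℝ Q]
    {F : P → K} {O : Set P} (hO : IsOpen O) (hF : ContDiffOn ℝ ∞ F O) {p₀ : P} (hp₀ : p₀ ∈ O)
    (hsurj : Function.Surjective (fderiv ℝ F p₀)) {v : P} (hv : fderiv ℝ F p₀ v = 0)
    {a b : P → Q} (ha : DifferentiableAt ℝ a p₀) (hb : DifferentiableAt ℝ b p₀)
    (hab : ∀ p ∈ O, F p = F p₀ → a p = b p) : fderiv ℝ a p₀ v = fderiv ℝ b p₀ v := by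
  obtain ⟨ε, hε, c, hc0, -, hcO, hc', -⟩ := exists_integralCurve_in_levelSet hO hF hp₀ hsurj
    (Y := fun _ => v) contDiffOn_const hv
  have h1 : HasDerivAt (a ∘ c) (fderiv ℝ a p₀ v) 0 :=
    HasFDerivAt.comp_hasDerivAt 0 (by rw [hc0]; exact ha.hasFDerivAt) hc'
  have h2 : HasDerivAt (b ∘ c) (fderiv ℝ b p₀ v) 0 :=
    HasFDerivAt.comp_hasDerivAt 0 (by rw [hc0]; exact hb.hasFDerivAt) hc'
  refine h1.unique (h2.congr_of_eventuallyEq ?_)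
  filter_upwards [Ioo_mem_nhds (neg_lt_zero.2 hε) hε] with t ht
  exact hab _ (hcO t ht).1 (hcO t ht).2

/-- A submersion can be straightened: `Ψ p = p - p₀ + s₀ (F p - F p₀ - F' (p - p₀))`, with `s₀` a
right inverse of `F'`, is a local diffeomorphism with `F' (Ψ p) = F p - F p₀`. -/
lemma exists_straightening {F : P → K} {O : Set P} (hO : IsOpen O)
    (hF : ContDiffOn ℝ ∞ F O) {p₀ : P} (hp₀ : p₀ ∈ O)
    (hsurj : Function.Surjective (fderiv ℝ F p₀)) :
    ∃ Ψ : OpenPartialHomeomorph P P, p₀ ∈ Ψ.source ∧ Ψ.source ⊆ O ∧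
      ContDiffOn ℝ ∞ Ψ Ψ.source ∧ ContDiffOn ℝ ∞ Ψ.symm Ψ.target ∧
      ∀ p ∈ Ψ.source, fderiv ℝ F p₀ (Ψ p) = F p - F p₀ := by
  obtain ⟨s₀, hs₀⟩ := (fderiv ℝ F p₀).exists_rightInverse_of_surjective
    (LinearMap.range_eq_top.2 hsurj)
  have hs₀' : ∀ k, fderiv ℝ F p₀ (s₀ k) = k := fun k => DFunLike.congr_fun hs₀ k
  set L := fderiv ℝ F p₀ with hL
  set ψ : P → P := fun p => p - p₀ + s₀ (F p - F p₀ - L (p - p₀)) with hψ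
  have hψc : ContDiffOn ℝ ∞ ψ O := by
    refine ((contDiff_id.sub contDiff_const).contDiffOn).add
      (s₀.contDiff.comp_contDiffOn ((hF.sub contDiffOn_const).sub ?_))
    exact (L.contDiff.comp (contDiff_id.sub contDiff_const)).contDiffOn
  have hψd : ∀ p ∈ O, HasFDerivAt ψ (ContinuousLinearMap.id ℝ P +
      s₀.comp (fderiv ℝ F p - L)) p := by
    intro p hp
    have h1 := ((hF.differentiableOn (by simp)).differentiableAt (hO.mem_nhds hp)).hasFDerivAt
    have h2 : HasFDerivAt (fun p => p - p₀) (ContinuousLinearMap.id ℝ P) p :=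
      (hasFDerivAt_id p).sub_const p₀
    have h3 := s₀.hasFDerivAt.comp p ((h1.sub_const (F p₀)).sub (L.hasFDerivAt.comp p h2))
    exact h2.add h3
  have hψ₀ : HasFDerivAt ψ ((ContinuousLinearEquiv.refl ℝ P : P ≃L[ℝ] P) : P →L[ℝ] P) p₀ := by
    have := hψd p₀ hp₀
    rw [← hL, sub_self, ContinuousLinearMap.comp_zero, add_zero] at this
    exact this
  have hψat : ContDiffAt ℝ ∞ ψ p₀ := hψc.contDiffAt (hO.mem_nhds hp₀)
  set Ψ₀ := hψat.toOpenPartialHomeomorph ψ hψ₀ (by simp) with hΨ₀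
  set V : Set P := O ∩ {p | (fderiv ℝ ψ p).IsInvertible} with hV
  have hVo : IsOpen V := (hψc.fderiv_of_isOpen hO (by simp : (0 : WithTop ℕ∞) + 1 ≤ ∞)).continuousOn
    |>.isOpen_inter_preimage hO ContinuousLinearEquiv.isOpen
  have hp₀V : p₀ ∈ V := ⟨hp₀, by
    change (fderiv ℝ ψ p₀).IsInvertible
    rw [hψ₀.fderiv]; exact ContinuousLinearMap.isInvertible_equiv⟩
  refine ⟨Ψ₀.restr V, ?_, ?_, ?_, ?_, ?_⟩
  · rw [Ψ₀.restr_source, hVo.interior_eq]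
    exact ⟨hψat.mem_toOpenPartialHomeomorph_source hψ₀ (by simp), hp₀V⟩
  · rw [Ψ₀.restr_source, hVo.interior_eq]; exact fun p hp => hp.2.1
  · rw [Ψ₀.restr_source, hVo.interior_eq]; exact hψc.mono fun p hp => hp.2.1
  · intro y hy
    have hys : (Ψ₀.restr V).symm y ∈ (Ψ₀.restr V).source := (Ψ₀.restr V).map_target hy
    rw [Ψ₀.restr_source, hVo.interior_eq] at hys
    obtain ⟨B, hB⟩ := hys.2.2
    refine ContDiffAt.contDiffWithinAt ?_
    refine (Ψ₀.restr V).contDiffAt_symm hy (f₀' := B) ?_ ?_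
    · rw [hB]
      exact ((hψc.differentiableOn (by simp)).differentiableAt (hO.mem_nhds hys.2.1)).hasFDerivAt
    · exact hψc.contDiffAt (hO.mem_nhds hys.2.1)
  · intro p hp
    change L (p - p₀ + s₀ (F p - F p₀ - L (p - p₀))) = _
    rw [map_add, hs₀']; abel

end LevelSets

/-! ### Christoffel maps of metrics on open subsets of a vector space -/

section Koszul

variable {E : Type*} [NormedAddCommGroup E] [NormedSpace ℝ E]

/-! Shortcuts for the search of instances on spaces of multilinear forms. -/

local instance : NormedAddCommGroup (E →L[ℝ] ℝ) := ContinuousLinearMap.toNormedAddCommGroup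
local instance : NormedSpace ℝ (E →L[ℝ] ℝ) := ContinuousLinearMap.toNormedSpace
local instance : NormedAddCommGroup (E →L[ℝ] E →L[ℝ] ℝ) :=
  ContinuousLinearMap.toNormedAddCommGroup
local instance : NormedSpace ℝ (E →L[ℝ] E →L[ℝ] ℝ) := ContinuousLinearMap.toNormedSpace
local instance : NormedAddCommGroup (E →L[ℝ] E →L[ℝ] E →L[ℝ] ℝ) :=
  ContinuousLinearMap.toNormedAddCommGroup
local instance : NormedSpace ℝ (E →L[ℝ] E →L[ℝ] E →L[ℝ] ℝ) := ContinuousLinearMap.toNormedSpace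

/-- The bilinear form `B` is symmetric and positive definite. -/
structure IsInnerForm (B : E →L[ℝ] E →L[ℝ] ℝ) : Prop where
  symm : ∀ v w, B v w = B w v
  pos : ∀ v, v ≠ 0 → 0 < B v v

/-- The map `T ↦ ((v, w, u) ↦ ½ (T v w u + T w v u - T u v w))`, which turns the derivative of a
metric into the right-hand side of the Koszul formula. -/
def koszulMap : (E →L[ℝ] E →L[ℝ] E →L[ℝ] ℝ) →L[ℝ] (E →L[ℝ] E →L[ℝ] E →L[ℝ] ℝ) :=
  let fl : (E →L[ℝ] E →L[ℝ] E →L[ℝ] ℝ) →L[ℝ] (E →L[ℝ] E →L[ℝ] E →L[ℝ] ℝ) :=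
    (ContinuousLinearMap.flipₗᵢ ℝ E E (E →L[ℝ] ℝ)).toContinuousLinearEquiv.toContinuousLinearMap
  let fl' : (E →L[ℝ] E →L[ℝ] ℝ) →L[ℝ] (E →L[ℝ] E →L[ℝ] ℝ) :=
    (ContinuousLinearMap.flipₗᵢ ℝ E E ℝ).toContinuousLinearEquiv.toContinuousLinearMap
  (1 / 2 : ℝ) • (ContinuousLinearMap.id ℝ _ + fl -
    (ContinuousLinearMap.compL ℝ E (E →L[ℝ] E →L[ℝ] ℝ) (E →L[ℝ] E →L[ℝ] ℝ) fl').comp fl)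

lemma koszulMap_apply (T : E →L[ℝ] E →L[ℝ] E →L[ℝ] ℝ) (v w u : E) :
    koszulMap T v w u = (1 / 2 : ℝ) * (T v w u + T w v u - T u v w) := rfl

/-- The Christoffel map `(v, w) ↦ Γ(v, w)` of the metric `G`, obtained by solving the Koszul
formula `G(Γ(v, w), u) = ½ (∂ᵥG(w, u) + ∂_wG(v, u) - ∂ᵤG(v, w))`. -/
def christoffelMap (G : E → E →L[ℝ] E →L[ℝ] ℝ) (y : E) : E →L[ℝ] E →L[ℝ] E :=
  (ContinuousLinearMap.compL ℝ E (E →L[ℝ] ℝ) E (G y).inverse).comp (koszulMap (fderiv ℝ G y))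

lemma IsInnerForm.eq_of_forall {B : E →L[ℝ] E →L[ℝ] ℝ} (hB : IsInnerForm B) {v w : E}
    (h : ∀ u, B v u = B w u) : v = w := by
  by_contra hne
  have := hB.pos (v - w) (sub_ne_zero.2 hne)
  rw [B.map_sub, sub_apply, h, sub_self] at this
  exact this.false

variable {G : E → E →L[ℝ] E →L[ℝ] ℝ} {y : E}

lemma fderiv_metric_symm (hG : DifferentiableAt ℝ G y) (hs : ∀ᶠ z in 𝓝 y, IsInnerForm (G z))
    (u v w : E) : fderiv ℝ G y u v w = fderiv ℝ G y u w v := by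
  have h1 : ∀ v w : E, HasFDerivAt (fun z => G z v w)
      (((fderiv ℝ G y).flip v).flip w) y := by
    intro v w
    have := (hG.hasFDerivAt.clm_apply (hasFDerivAt_const v y)).clm_apply (hasFDerivAt_const w y)
    refine this.congr_fderiv ?_
    ext x; simp
  have h2 := (h1 v w).unique ((h1 w v).congr_of_eventuallyEq
    (hs.mono fun z hz => hz.symm v w))
  exact DFunLike.congr_fun h2 u

variable [FiniteDimensional ℝ E]

lemma IsInnerForm.isInvertible {B : E →L[ℝ] E →L[ℝ] ℝ} (hB : IsInnerForm B) :
    B.IsInvertible := by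
  have hinj : Function.Injective B := by
    rw [injective_iff_map_eq_zero]
    intro v hv
    by_contra h
    have := hB.pos v h
    rw [hv] at this
    simp at this
  have hdim : Module.finrank ℝ E = Module.finrank ℝ (E →L[ℝ] ℝ) := by
    rw [← (LinearMap.toContinuousLinearMap (𝕜 := ℝ) (E := E) (F' := ℝ)).finrank_eq,
      Module.finrank_linearMap, Module.finrank_self, mul_one]
  refine ⟨(LinearEquiv.ofInjectiveOfFinrankEq (B : E →ₗ[ℝ] E →L[ℝ] ℝ) hinj
    hdim).toContinuousLinearEquiv, ?_⟩
  ext v w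
  rfl

lemma inner_christoffelMap (hG : IsInnerForm (G y)) (v w u : E) :
    G y (christoffelMap G y v w) u = (1 / 2 : ℝ) *
      (fderiv ℝ G y v w u + fderiv ℝ G y w v u - fderiv ℝ G y u v w) := by
  obtain ⟨B, hB⟩ := hG.isInvertible
  rw [← koszulMap_apply]
  change G y ((G y).inverse (koszulMap (fderiv ℝ G y) v w)) u = _
  rw [← hB, ContinuousLinearMap.inverse_equiv]
  exact DFunLike.congr_fun (B.apply_symm_apply _) u

/-- The Christoffel map is compatible with the metric. -/
lemma christoffelMap_metric (hG : DifferentiableAt ℝ G y) (hs : ∀ᶠ z in 𝓝 y, IsInnerForm (G z))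
    (u v w : E) : fderiv ℝ G y u v w =
      G y (christoffelMap G y u v) w + G y v (christoffelMap G y u w) := by
  rw [hs.self_of_nhds.symm v, inner_christoffelMap hs.self_of_nhds,
    inner_christoffelMap hs.self_of_nhds, fderiv_metric_symm hG hs w u v,
    fderiv_metric_symm hG hs v u w, fderiv_metric_symm hG hs u w v]
  have h1 := fderiv_metric_symm hG hs w v u
  have h2 := fderiv_metric_symm hG hs v w u
  linarith

lemma contDiffOn_christoffelMap {U : Set E} (hU : IsOpen U) (hG : ContDiffOn ℝ ∞ G U)
    (hpos : ∀ y ∈ U, IsInnerForm (G y)) : ContDiffOn ℝ ∞ (christoffelMap G) U := by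
  have hinv : ContDiffOn ℝ ∞ (fun y => (G y).inverse) U := fun y hy =>
    (ContinuousLinearMap.IsInvertible.contDiffAt_map_inverse
      (hpos y hy).isInvertible).comp_contDiffWithinAt y (hG y hy)
  have hk : ContDiffOn ℝ ∞ (fun y => koszulMap (fderiv ℝ G y)) U :=
    koszulMap.contDiff.comp_contDiffOn (hG.fderiv_of_isOpen hU (by simp))
  exact ((ContinuousLinearMap.compL ℝ E (E →L[ℝ] ℝ) E).contDiff.comp_contDiffOn hinv).clm_comp hk

/-- The transformation law of Christoffel maps under a change of coordinates `θ`. -/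
lemma christoffelMap_pullback {G' : E → E →L[ℝ] E →L[ℝ] ℝ} {θ : E → E}
    (hθ : ContDiffAt ℝ 2 θ y) (hG' : DifferentiableAt ℝ G' (θ y))
    (hs : ∀ᶠ z in 𝓝 (θ y), IsInnerForm (G' z)) (hsG : IsInnerForm (G y))
    (hsurj : Function.Surjective (fderiv ℝ θ y))
    (hpull : ∀ᶠ z in 𝓝 y, ∀ v w, G z v w = G' (θ z) (fderiv ℝ θ z v) (fderiv ℝ θ z w))
    (v w : E) :
    fderiv ℝ θ y (christoffelMap G y v w) =
      christoffelMap G' (θ y) (fderiv ℝ θ y v) (fderiv ℝ θ y w) +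
        fderiv ℝ (fderiv ℝ θ) y v w := by
  have hθ1 : HasFDerivAt θ (fderiv ℝ θ y) y := (hθ.differentiableAt (by simp)).hasFDerivAt
  have hθ2 : HasFDerivAt (fderiv ℝ θ) (fderiv ℝ (fderiv ℝ θ) y) y :=
    ((hθ.fderiv_right (m := 1) (by norm_num)).differentiableAt (by simp)).hasFDerivAt
  have hsymm : ∀ a b, fderiv ℝ (fderiv ℝ θ) y a b = fderiv ℝ (fderiv ℝ θ) y b a :=
    hθ.isSymmSndFDerivAt (by simp)
  have hGe : G =ᶠ[𝓝 y] fun z => ((ContinuousLinearMap.compL ℝ E E ℝ).flip (fderiv ℝ θ z)).comp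
      ((G' (θ z)).comp (fderiv ℝ θ z)) := by
    filter_upwards [hpull] with z hz
    ext v w
    exact hz v w
  have hGd : ∀ u v w, fderiv ℝ G y u v w =
      fderiv ℝ G' (θ y) (fderiv ℝ θ y u) (fderiv ℝ θ y v) (fderiv ℝ θ y w) +
      G' (θ y) (fderiv ℝ (fderiv ℝ θ) y u v) (fderiv ℝ θ y w) +
      G' (θ y) (fderiv ℝ θ y v) (fderiv ℝ (fderiv ℝ θ) y u w) := by
    intro u v w
    have h1 := hG'.hasFDerivAt.comp y hθ1
    have h2 := h1.clm_comp hθ2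
    have h3 := ((ContinuousLinearMap.compL ℝ E E ℝ).flip.hasFDerivAt.comp y hθ2).clm_comp h2
    rw [(h3.congr_of_eventuallyEq hGe).fderiv]
    simp
    ring
  have hs₀ := hs.self_of_nhds
  refine hs₀.eq_of_forall fun u' => ?_
  obtain ⟨u, rfl⟩ := hsurj u'
  rw [map_add, add_apply, inner_christoffelMap hs₀,
    ← hpull.self_of_nhds, inner_christoffelMap hsG, hGd, hGd, hGd, hsymm w v, hsymm u v, hsymm u w]
  have h1 := hs₀.symm (fderiv ℝ (fderiv ℝ θ) y v u) (fderiv ℝ θ y w)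
  have h2 := hs₀.symm (fderiv ℝ (fderiv ℝ θ) y w u) (fderiv ℝ θ y v)
  linarith

end Koszul

/-! ### Linear algebra of orthogonal families and graded complements -/

section LinearAlgebra

variable {E : Type*} [NormedAddCommGroup E] [NormedSpace ℝ E]

lemma IsInnerForm.linearIndepOn {B : E →L[ℝ] E →L[ℝ] ℝ} (hB : IsInnerForm B) {e : ℕ → E}
    {s : Set ℕ} (hne : ∀ i ∈ s, e i ≠ 0)
    (horth : ∀ i ∈ s, ∀ j ∈ s, i ≠ j → B (e i) (e j) = 0) : LinearIndepOn ℝ e s := by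
  rw [linearIndepOn_iff']
  intro t c hts hsum i hi
  have h := congrArg (fun v => B v (e i)) hsum
  simp only [map_sum, map_smul, map_zero, zero_apply, sum_apply, smul_apply, smul_eq_mul] at h
  rw [Finset.sum_eq_single i (fun j hj hji => by rw [horth j (hts hj) i (hts hi) hji, mul_zero])
    (fun h => absurd hi h)] at h
  exact (mul_eq_zero.1 h).resolve_right (hB.pos _ (hne i (hts hi))).ne'

lemma span_image_Icc_eq_top [FiniteDimensional ℝ E] {n : ℕ} (hn : Module.finrank ℝ E = n)
    {e : ℕ → E} (he : LinearIndepOn ℝ e (Icc 1 n)) : Submodule.span ℝ (e '' Icc 1 n) = ⊤ := by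
  rw [image_eq_range]
  refine LinearIndependent.span_eq_top_of_card_eq_finrank' he ?_
  simp [hn]

lemma finrank_span_image_Icc {T : Type*} [AddCommGroup T] [Module ℝ T] {u : ℕ → T} {m n : ℕ}
    (hu : LinearIndepOn ℝ u (Icc m n)) :
    Module.finrank ℝ (Submodule.span ℝ (u '' Icc m n)) = n + 1 - m := by
  rw [image_eq_range, finrank_span_eq_card hu]
  simp

lemma IsInnerForm.eq_sum [FiniteDimensional ℝ E] {B : E →L[ℝ] E →L[ℝ] ℝ} (hB : IsInnerForm B)
    {n : ℕ} (hn : Module.finrank ℝ E = n) {e : ℕ → E} (hne : ∀ i ∈ Icc 1 n, e i ≠ 0)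
    (horth : ∀ i ∈ Icc 1 n, ∀ j ∈ Icc 1 n, i ≠ j → B (e i) (e j) = 0) (v : E) :
    v = ∑ i ∈ Finset.Icc 1 n, (B v (e i) / B (e i) (e i)) • e i := by
  set w := ∑ i ∈ Finset.Icc 1 n, (B v (e i) / B (e i) (e i)) • e i
  have hw : ∀ j ∈ Icc 1 n, B w (e j) = B v (e j) := by
    intro j hj
    simp only [w, map_sum, map_smul, sum_apply, smul_apply, smul_eq_mul]
    rw [Finset.sum_eq_single j (fun i hi hij => by
      rw [horth i (by simpa using hi) j hj hij, mul_zero])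
      (fun h => absurd (by simpa using hj) h), div_mul_cancel₀ _ (hB.pos _ (hne j hj)).ne']
  refine hB.eq_of_forall fun u => ?_
  have hu : u ∈ Submodule.span ℝ (e '' Icc 1 n) := by
    rw [span_image_Icc_eq_top hn (hB.linearIndepOn hne horth)]; trivial
  induction hu using Submodule.span_induction with
  | mem x hx => obtain ⟨j, hj, rfl⟩ := hx; exact (hw j hj).symm
  | zero => simp
  | add x y _ _ hx hy => rw [map_add, map_add, hx, hy]
  | smul a x _ hx => rw [map_smul, map_smul, hx]

lemma exists_sum_of_mem_span_image_Icc {T : Type*} [AddCommGroup T] [Module ℝ T] {u : ℕ → T}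
    {m n : ℕ} {w : T} (hw : w ∈ Submodule.span ℝ (u '' Icc m n)) :
    ∃ c : ℕ → ℝ, w = ∑ k ∈ Finset.Icc m n, c k • u k := by
  rw [← Finset.coe_Icc, Submodule.mem_span_image_finset_iff_exists_fun] at hw
  obtain ⟨c, hc⟩ := hw
  refine ⟨fun k => if h : k ∈ Finset.Icc m n then c ⟨k, h⟩ else 0, ?_⟩
  rw [← hc, ← Finset.sum_coe_sort (Finset.Icc m n)]
  exact Finset.sum_congr rfl fun k _ => by simp

lemma Icc_one_eq_insert {n : ℕ} (hn : 1 ≤ n) : Finset.Icc 1 n = insert 1 (Finset.Icc 2 n) := by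
  ext; simp; omega

/-- If `A'` consists of the elements of `A` whose image under `χ` is a multiple of `e₁`, and the
images of `u₂, …, uₙ ∈ A` are nonzero multiples of the remaining vectors `e₂, …, eₙ` of a basis,
then `u₂, …, uₙ` span a complement of `A'` in `A`. -/
lemma complement_of_symbol {E : Type*} [AddCommGroup E] [Module ℝ E] {T : Type*} [AddCommGroup T]
    [Module ℝ T] [FiniteDimensional ℝ T]
    {n : ℕ} (hn : 1 ≤ n)
    {A A' : Submodule ℝ T} (χ : T →ₗ[ℝ] E) {e : ℕ → E} {u : ℕ → T} {s : ℕ → ℝ}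
    (he : LinearIndepOn ℝ e (Icc 1 n)) (htop : Submodule.span ℝ (e '' Icc 1 n) = ⊤)
    (hA' : ∀ w, w ∈ A' ↔ w ∈ A ∧ ∃ a : ℝ, χ w = a • e 1) (hu : ∀ k ∈ Icc 2 n, u k ∈ A)
    (hs : ∀ k ∈ Icc 2 n, s k ≠ 0) (hχ : ∀ k ∈ Icc 2 n, χ (u k) = s k • e k) :
    A = A' ⊔ Submodule.span ℝ (u '' Icc 2 n) ∧ Disjoint A' (Submodule.span ℝ (u '' Icc 2 n)) ∧
      Module.finrank ℝ A = Module.finrank ℝ A' + (n - 1) := by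
  have key : ∀ (c : ℕ → ℝ) (a : ℝ), ∑ k ∈ Finset.Icc 2 n, c k • χ (u k) = a • e 1 →
      ∀ k ∈ Finset.Icc 2 n, c k = 0 := by
    intro c a h k hk
    rw [linearIndepOn_iff'] at he
    have h1 := he (Finset.Icc 1 n) (fun k => if k = 1 then -a else c k * s k) (by simp) (by
      rw [Icc_one_eq_insert hn, Finset.sum_insert (by simp), if_pos rfl, neg_smul, ← h,
        neg_add_eq_zero]
      refine Finset.sum_congr rfl fun k hk => ?_
      have hk' := Finset.mem_Icc.1 hk
      rw [if_neg (by omega), hχ k hk', smul_smul]) k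
      (by rw [Icc_one_eq_insert hn]; exact Finset.mem_insert_of_mem hk)
    have hk' := Finset.mem_Icc.1 hk
    rw [if_neg (by omega)] at h1
    exact (mul_eq_zero.1 h1).resolve_right (hs k hk')
  have hdisj : Disjoint A' (Submodule.span ℝ (u '' Icc 2 n)) := by
    rw [Submodule.disjoint_def]
    intro w hw hw'
    obtain ⟨c, rfl⟩ := exists_sum_of_mem_span_image_Icc hw'
    obtain ⟨a, ha⟩ := ((hA' _).1 hw).2
    simp only [map_sum, map_smul] at ha
    exact Finset.sum_eq_zero fun k hk => by rw [key c a ha k hk, zero_smul]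
  have hsup : A = A' ⊔ Submodule.span ℝ (u '' Icc 2 n) := by
    apply le_antisymm
    · intro w hw
      have h1 : χ w ∈ Submodule.span ℝ (e '' Icc 1 n) := by rw [htop]; trivial
      obtain ⟨d, hd⟩ := exists_sum_of_mem_span_image_Icc h1
      have h2 : ∑ k ∈ Finset.Icc 2 n, (d k / s k) • u k ∈ Submodule.span ℝ (u '' Icc 2 n) :=
        Submodule.sum_mem _ fun k hk => Submodule.smul_mem _ _
          (Submodule.subset_span ⟨k, Finset.mem_Icc.1 hk, rfl⟩)
      refine Submodule.mem_sup.2 ⟨w - ∑ k ∈ Finset.Icc 2 n, (d k / s k) • u k, ?_, _, h2, by abel⟩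
      refine (hA' _).2 ⟨A.sub_mem hw (Submodule.sum_mem _ fun k hk => Submodule.smul_mem _ _
        (hu k (Finset.mem_Icc.1 hk))), d 1, ?_⟩
      rw [map_sub, hd, map_sum, Icc_one_eq_insert hn, Finset.sum_insert (by simp),
        add_sub_assoc, add_eq_left, sub_eq_zero]
      refine Finset.sum_congr rfl fun k hk => ?_
      rw [map_smul, hχ k (Finset.mem_Icc.1 hk), smul_smul,
        div_mul_cancel₀ _ (hs k (Finset.mem_Icc.1 hk))]
    · refine sup_le (fun w hw => ((hA' w).1 hw).1) (Submodule.span_le.2 ?_)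
      rintro _ ⟨k, hk, rfl⟩
      exact hu k hk
  refine ⟨hsup, hdisj, ?_⟩
  have hlin : LinearIndepOn ℝ u (Icc 2 n) := by
    rw [linearIndepOn_iff']
    intro t c ht hsum i hi
    have hti : t ⊆ Finset.Icc 2 n := fun k hk => Finset.mem_Icc.2 (ht hk)
    have h := key (fun k => if k ∈ t then c k else 0) 0 (by
      rw [zero_smul, ← map_zero χ, ← hsum, map_sum, ← Finset.sum_subset hti
        (fun k _ hk => by rw [if_neg hk, zero_smul])]
      exact Finset.sum_congr rfl fun k hk => by rw [if_pos hk, map_smul]) i (hti hi)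
    rwa [if_pos hi] at h
  have h := Submodule.finrank_sup_add_finrank_inf_eq A' (Submodule.span ℝ (u '' Icc 2 n))
  rw [hdisj.eq_bot, finrank_bot, add_zero, ← hsup, finrank_span_image_Icc hlin] at h
  omega

end LinearAlgebra

/-! ### Coordinate expressions of curves and vector fields on a manifold -/

section Charts

variable {F : Type*} [NormedAddCommGroup F] [NormedSpace ℝ F]
  {H : Type*} [TopologicalSpace H] {J : ModelWithCorners ℝ F H}
  {N : Type*} [TopologicalSpace N] [ChartedSpace H N]

variable (J) in
/-- The derivative at `p` of the preferred chart at `q`. -/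
def chartDeriv (q p : N) : TangentSpace J p →L[ℝ] F :=
  mfderiv J 𝓘(ℝ, F) (extChartAt J q) p

variable (J) in
/-- The expression of the vector field `X` in the preferred chart at `q`. -/
def coordField (q : N) (X : ∀ p : N, TangentSpace J p) (y : F) : F :=
  chartDeriv J q ((extChartAt J q).symm y) (X ((extChartAt J q).symm y))

lemma coordField_extChartAt {q p : N} (hp : p ∈ (chartAt H q).source)
    (X : ∀ p : N, TangentSpace J p) :
    coordField J q X (extChartAt J q p) = chartDeriv J q p (X p) := by
  rw [coordField, (extChartAt J q).left_inv (by rwa [extChartAt_source])]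

variable [IsManifold J ∞ N]

lemma chartDeriv_self (q : N) (v : TangentSpace J q) : chartDeriv J q q v = v := by
  rw [chartDeriv, mfderiv_extChartAt_self]
  rfl

lemma chartDeriv_injective {q p : N} (hp : p ∈ (chartAt H q).source) :
    Function.Injective (chartDeriv J q p) :=
  (isInvertible_mfderiv_extChartAt (by rwa [extChartAt_source])).bijective.injective

lemma chartDeriv_eq_trivializationAt {q p : N} (hp : p ∈ (chartAt H q).source)
    (v : TangentSpace J p) :
    chartDeriv J q p v = (trivializationAt F (TangentSpace J) q ⟨p, v⟩).2 := by
  rw [chartDeriv, ← TangentBundle.continuousLinearMapAt_trivializationAt hp,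
    Trivialization.continuousLinearMapAt_apply, Trivialization.coe_linearMapAt_of_mem]
  simpa using hp

lemma hasDerivWithinAt_extChartAt_comp {q : N} {c : ℝ → N} {s : Set ℝ} {t : ℝ}
    (hc : MDifferentiableWithinAt 𝓘(ℝ, ℝ) J c s t) (ht : c t ∈ (chartAt H q).source) :
    HasDerivWithinAt (fun τ => extChartAt J q (c τ)) (chartDeriv J q (c t) (velocity J c s t))
      s t := by
  have h := (mdifferentiableAt_extChartAt (I := J) ht).hasMFDerivAt.comp_hasMFDerivWithinAt t
    hc.hasMFDerivWithinAt
  have h' : HasFDerivWithinAt (fun τ => extChartAt J q (c τ))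
      ((chartDeriv J q (c t)).comp (mfderivWithin 𝓘(ℝ, ℝ) J c s t)) s t := h.hasFDerivWithinAt
  exact h'.hasDerivWithinAt

lemma velocity_eq_of_hasDerivWithinAt {q : N} {c : ℝ → N} {s : Set ℝ} {t : ℝ}
    (hs : UniqueDiffWithinAt ℝ s t)
    (hc : MDifferentiableWithinAt 𝓘(ℝ, ℝ) J c s t) (ht : c t ∈ (chartAt H q).source)
    {w : TangentSpace J (c t)}
    (h : HasDerivWithinAt (fun τ => extChartAt J q (c τ)) (chartDeriv J q (c t) w) s t) :
    velocity J c s t = w :=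
  chartDeriv_injective ht (hs.eq_deriv _ (hasDerivWithinAt_extChartAt_comp hc ht) h)

lemma contDiffOn_coordField [J.Boundaryless] (q : N) {X : ∀ p : N, TangentSpace J p} {W : Set N}
    (hW : IsOpen W) (hX : IsSmoothFieldOn J X W) :
    ContDiffOn ℝ ∞ (coordField J q X)
      ((extChartAt J q).target ∩ (extChartAt J q).symm ⁻¹' W) := by
  have h1 : ContMDiffOn J 𝓘(ℝ, F) ∞ (fun p => chartDeriv J q p (X p))
      ((chartAt H q).source ∩ W) := by
    have h2 := (Trivialization.contMDiffOn_section_iff (IB := J) (n := ∞) (s := X)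
      (trivializationAt F (TangentSpace J) q) ((chartAt H q).open_source.inter hW)
      (by intro p hp; simpa using hp.1)).1 (hX.mono inter_subset_right)
    exact h2.congr fun p hp => chartDeriv_eq_trivializationAt hp.1 _
  have h3 := h1.comp ((contMDiffOn_extChartAt_symm (I := J) (n := ∞) q).mono inter_subset_left)
    (fun y hy => ⟨by simpa using (extChartAt J q).map_target hy.1, hy.2⟩)
  exact h3.contDiffOn

lemma contMDiffAt_of_coordField [J.Boundaryless] {q : N} {X : ∀ p : N, TangentSpace J p}
    (hX : ContDiffAt ℝ ∞ (coordField J q X) (extChartAt J q q)) :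
    ContMDiffAt J J.tangent ∞ (fun p => (⟨p, X p⟩ : TangentBundle J N)) q := by
  rw [contMDiffAt_section]
  have h1 : ContMDiffAt J 𝓘(ℝ, F) ∞ (fun p => coordField J q X (extChartAt J q p)) q :=
    hX.contMDiffAt.comp q contMDiffAt_extChartAt
  refine h1.congr_of_eventuallyEq ?_
  filter_upwards [chart_source_mem_nhds H q] with p hp
  rw [coordField_extChartAt hp, chartDeriv_eq_trivializationAt hp]

/-- The field with constant coordinates `v` in the preferred chart at `q`. -/
lemma exists_extension_of_tangentVector (q : N) (v : TangentSpace J q) :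
    ∃ X : ∀ p : N, TangentSpace J p, IsSmoothFieldOn J X (chartAt H q).source ∧ X q = v := by
  let e := trivializationAt F (TangentSpace J) q
  have hq : q ∈ e.baseSet := by simp [e]
  refine ⟨fun p => e.symm p (e ⟨q, v⟩).2, ?_, e.symm_apply_apply_mk hq v⟩
  have h := (Trivialization.contMDiffOn_section_baseSet_iff (IB := J) (n := ∞)
    (s := fun p => e.symm p (e ⟨q, v⟩).2) e).2 (by
      refine (contMDiffOn_const (c := (e ⟨q, v⟩).2)).congr fun p hp => ?_
      rw [e.apply_mk_symm hp])
  have hb : e.baseSet = (chartAt H q).source := by simp [e]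
  rw [hb] at h
  exact h

lemma mlieBracket_eq_coordField [J.Boundaryless] (X Y : ∀ p : N, TangentSpace J p) (q : N) :
    (VectorField.mlieBracket J X Y q : F) =
      fderiv ℝ (coordField J q Y) (extChartAt J q q) (X q) -
        fderiv ℝ (coordField J q X) (extChartAt J q q) (Y q) := by
  have hpull : ∀ Z : ∀ p : N, TangentSpace J p,
      (VectorField.mpullbackWithin 𝓘(ℝ, F) J (extChartAt J q).symm Z (range J) : F → F)
        =ᶠ[𝓝 (extChartAt J q q)] coordField J q Z := by
    intro Z
    filter_upwards [extChartAt_target_mem_nhds (I := J) q] with y hy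
    rw [VectorField.mpullbackWithin_apply]
    have h1 := mfderivWithin_extChartAt_symm_comp_mfderiv_extChartAt (I := J) hy
    have h2 := mfderiv_extChartAt_comp_mfderivWithin_extChartAt_symm (I := J) hy
    rw [ContinuousLinearMap.inverse_eq h1 h2]
    rfl
  have e1 : coordField J q X (extChartAt J q q) = X q := by
    rw [coordField_extChartAt (mem_chart_source H q), chartDeriv_self]
  have e2 : coordField J q Y (extChartAt J q q) = Y q := by
    rw [coordField_extChartAt (mem_chart_source H q), chartDeriv_self]
  have hset : (extChartAt J q).symm ⁻¹' (univ : Set N) ∩ range J = univ := by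
    rw [preimage_univ, univ_inter, J.range_eq_univ]
  have h1 : ∀ X' Y' : F → F, X' =ᶠ[𝓝 (extChartAt J q q)] coordField J q X →
      Y' =ᶠ[𝓝 (extChartAt J q q)] coordField J q Y → VectorField.lieBracketWithin ℝ X' Y'
        ((extChartAt J q).symm ⁻¹' (univ : Set N) ∩ range J) (extChartAt J q q) =
      fderiv ℝ (coordField J q Y) (extChartAt J q q) (X q) -
        fderiv ℝ (coordField J q X) (extChartAt J q q) (Y q) := by
    intro X' Y' hX' hY'
    rw [hset, VectorField.lieBracketWithin_univ, hX'.lieBracket_vectorField_eq hY',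
      VectorField.lieBracket, e1, e2]
  refine Eq.trans ?_ (h1 _ _ (hpull X) (hpull Y))
  have h2 : mfderiv J 𝓘(ℝ, F) (extChartAt J q) q = ContinuousLinearMap.id ℝ F :=
    mfderiv_extChartAt_self
  have h3 := VectorField.mlieBracketWithin_apply (I := J) (V := X) (W := Y) (s := univ) (x₀ := q)
  refine h3.trans ?_
  have h4 : ∀ L : F →L[ℝ] F, L = ContinuousLinearMap.id ℝ F → ∀ w, L.inverse w = w := by
    rintro _ rfl w
    rw [ContinuousLinearMap.inverse_id]
    rfl
  exact h4 _ h2 _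

end Charts

/-! ### Level sets of submersions on a manifold -/

section ManifoldLevelSets

variable {F : Type*} [NormedAddCommGroup F] [NormedSpace ℝ F]
  {H : Type*} [TopologicalSpace H] {J : ModelWithCorners ℝ F H}
  {N : Type*} [TopologicalSpace N] [ChartedSpace H N]
  {K : Type*} [NormedAddCommGroup K] [NormedSpace ℝ K]

lemma extChartAt_mem_target_inter {q : N} {O : Set N} (hq : q ∈ O) :
    extChartAt J q q ∈ (extChartAt J q).target ∩ (extChartAt J q).symm ⁻¹' O :=
  ⟨mem_extChartAt_target q, by simpa using hq⟩

lemma isOpen_extChartAt_symm_preimage [J.Boundaryless] (q : N) {O : Set N} (hO : IsOpen O) :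
    IsOpen ((extChartAt J q).target ∩ (extChartAt J q).symm ⁻¹' O) :=
  (continuousOn_extChartAt_symm q).isOpen_inter_preimage (isOpen_extChartAt_target q) hO

lemma velocity_mem_ker {Φ : N → K} {c : ℝ → N} {s : Set ℝ} {t : ℝ}
    (hs : UniqueDiffWithinAt ℝ s t)
    (hc : MDifferentiableWithinAt 𝓘(ℝ, ℝ) J c s t)
    (hΦ : MDifferentiableAt J 𝓘(ℝ, K) Φ (c t)) (hconst : ∀ τ ∈ s, Φ (c τ) = Φ (c t)) :
    mfderiv J 𝓘(ℝ, K) Φ (c t) (velocity J c s t) = 0 := by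
  let L : ℝ →L[ℝ] K := (mfderiv J 𝓘(ℝ, K) Φ (c t)).comp (mfderivWithin 𝓘(ℝ, ℝ) J c s t)
  have h1 : HasFDerivWithinAt (fun τ => Φ (c τ)) L s t :=
    (hΦ.hasMFDerivAt.comp_hasMFDerivWithinAt t hc.hasMFDerivWithinAt).hasFDerivWithinAt
  have h2 : HasFDerivWithinAt (fun τ => Φ (c τ)) (0 : ℝ →L[ℝ] K) s t :=
    (hasFDerivWithinAt_const (Φ (c t)) t s).congr hconst rfl
  have h3 : L 1 = 0 := by rw [hs.eq h1 h2]; rfl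
  exact h3

variable [IsManifold J ∞ N]

lemma contDiffOn_comp_extChartAt_symm {Φ : N → K} {O : Set N} (hΦ : ContMDiffOn J 𝓘(ℝ, K) ∞ Φ O)
    (q : N) : ContDiffOn ℝ ∞ (fun y => Φ ((extChartAt J q).symm y))
      ((extChartAt J q).target ∩ (extChartAt J q).symm ⁻¹' O) :=
  (hΦ.comp ((contMDiffOn_extChartAt_symm (I := J) (n := ∞) q).mono inter_subset_left)
    fun _ hy => hy.2).contDiffOn

variable [J.Boundaryless]

lemma fderiv_comp_extChartAt_symm {Φ : N → K} {q p : N} (hp : p ∈ (chartAt H q).source)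
    (hΦ : MDifferentiableAt J 𝓘(ℝ, K) Φ p) (v : TangentSpace J p) :
    fderiv ℝ (fun y => Φ ((extChartAt J q).symm y)) (extChartAt J q p) (chartDeriv J q p v) =
      mfderiv J 𝓘(ℝ, K) Φ p v := by
  have hps : p ∈ (extChartAt J q).source := by rwa [extChartAt_source]
  have hback : (extChartAt J q).symm (extChartAt J q p) = p := (extChartAt J q).left_inv hps
  have hsymm : MDifferentiableAt 𝓘(ℝ, F) J (extChartAt J q).symm (extChartAt J q p) :=
    ((contMDiffOn_extChartAt_symm (I := J) (n := ∞) q).contMDiffAt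
      ((isOpen_extChartAt_target q).mem_nhds ((extChartAt J q).map_source hps))).mdifferentiableAt
      (by simp)
  have hcomp : MDifferentiableAt 𝓘(ℝ, F) 𝓘(ℝ, K) (fun y => Φ ((extChartAt J q).symm y))
      (extChartAt J q p) :=
    MDifferentiableAt.comp (extChartAt J q p) (g := Φ) (by rwa [hback]) hsymm
  have h1 := hcomp.hasMFDerivAt.comp p (mdifferentiableAt_extChartAt (I := J) hp).hasMFDerivAt
  have h2 : HasMFDerivAt J 𝓘(ℝ, K) Φ p _ := h1.congr_of_eventuallyEq (by
    filter_upwards [(chartAt H q).open_source.mem_nhds hp] with z hz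
    exact congrArg Φ ((extChartAt J q).left_inv (by rwa [extChartAt_source])).symm)
  rw [h2.mfderiv]
  rw [← mfderiv_eq_fderiv]
  rfl

lemma fderiv_comp_extChartAt_symm_self {Φ : N → K} {O : Set N} (hO : IsOpen O)
    (hΦ : ContMDiffOn J 𝓘(ℝ, K) ∞ Φ O) {q : N} (hq : q ∈ O) (v : TangentSpace J q) :
    fderiv ℝ (fun y => Φ ((extChartAt J q).symm y)) (extChartAt J q q) v =
      mfderiv J 𝓘(ℝ, K) Φ q v := by
  have h := fderiv_comp_extChartAt_symm (mem_chart_source H q)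
    ((hΦ.contMDiffAt (hO.mem_nhds hq)).mdifferentiableAt (by simp)) v
  rwa [chartDeriv_self] at h

variable [FiniteDimensional ℝ F] [FiniteDimensional ℝ K]

/-- Through a regular point of a level set of `Φ` there passes, inside the level set, an integral
curve of any smooth field that is tangent to the level set. -/
lemma exists_curve_in_levelSet {Φ : N → K} {O : Set N} (hO : IsOpen O)
    (hΦ : ContMDiffOn J 𝓘(ℝ, K) ∞ Φ O) {q : N} (hq : q ∈ O)
    (hsurj : Function.Surjective (mfderiv J 𝓘(ℝ, K) Φ q)) {X : ∀ p : N, TangentSpace J p}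
    (hX : IsSmoothFieldOn J X O) (hXq : mfderiv J 𝓘(ℝ, K) Φ q (X q) = 0) :
    ∃ ε > (0 : ℝ), ∃ c : ℝ → N, c 0 = q ∧ IsSmoothCurve J c (Ioo (-ε) ε) ∧
      (∀ t ∈ Ioo (-ε) ε, c t ∈ O ∧ Φ (c t) = Φ q) ∧
      ∀ t ∈ Ioo (-ε) ε, mfderiv J 𝓘(ℝ, K) Φ (c t) (X (c t)) = 0 →
        velocity J c (Ioo (-ε) ε) t = X (c t) := by
  have hback : (extChartAt J q).symm (extChartAt J q q) = q :=
    (extChartAt J q).left_inv (mem_extChartAt_source q)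
  have hY0 : coordField J q X (extChartAt J q q) = X q := by
    rw [coordField_extChartAt (mem_chart_source H q), chartDeriv_self]
  obtain ⟨ε, hε, c, hc0, hcs, hcO, -, hcd⟩ := exists_integralCurve_in_levelSet
    (isOpen_extChartAt_symm_preimage (J := J) q hO) (contDiffOn_comp_extChartAt_symm hΦ q)
    (extChartAt_mem_target_inter hq)
    (fun k => by
      obtain ⟨v, hv⟩ := hsurj k
      exact ⟨v, (fderiv_comp_extChartAt_symm_self hO hΦ hq v).trans hv⟩)
    (contDiffOn_coordField q hO hX)
    (by rw [hY0]; exact (fderiv_comp_extChartAt_symm_self hO hΦ hq _).trans hXq)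
  have hsmooth : IsSmoothCurve J (fun t => (extChartAt J q).symm (c t)) (Ioo (-ε) ε) :=
    (contMDiffOn_extChartAt_symm (I := J) (n := ∞) q).comp hcs.contMDiffOn
      fun t ht => (hcO t ht).1.1
  refine ⟨ε, hε, fun t => (extChartAt J q).symm (c t), (congrArg (extChartAt J q).symm hc0).trans hback, hsmooth,
    fun t ht => ⟨(hcO t ht).1.2, by have := (hcO t ht).2; rwa [hback] at this⟩, fun t ht h0 => ?_⟩
  have htar := (hcO t ht).1.1
  have hsrc : (extChartAt J q).symm (c t) ∈ (chartAt H q).source := by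
    rw [← extChartAt_source J]; exact (extChartAt J q).map_target htar
  have hright : extChartAt J q ((extChartAt J q).symm (c t)) = c t :=
    (extChartAt J q).right_inv htar
  refine velocity_eq_of_hasDerivWithinAt (q := q) (uniqueDiffOn_Ioo _ _ t ht)
    ((hsmooth t ht).mdifferentiableWithinAt (by simp)) hsrc ?_
  have h1 := hcd t ht (by
    have h2 := fderiv_comp_extChartAt_symm hsrc ((hΦ.contMDiffAt (hO.mem_nhds
      (hcO t ht).1.2)).mdifferentiableAt (by simp)) (X ((extChartAt J q).symm (c t)))
    rw [hright] at h2
    exact h2.trans h0)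
  exact h1.hasDerivWithinAt.congr (fun τ hτ => (extChartAt J q).right_inv (hcO τ hτ).1.1) hright

/-- The tangent space of a regular level set is the kernel of the derivative. -/
lemma mem_tangentSet_iff {Φ : N → K} {O S : Set N} (hO : IsOpen O)
    (hΦ : ContMDiffOn J 𝓘(ℝ, K) ∞ Φ O) {q : N} (hq : q ∈ O) (hqS : q ∈ S)
    (hsurj : Function.Surjective (mfderiv J 𝓘(ℝ, K) Φ q))
    (hS : ∀ p ∈ O, p ∈ S ↔ Φ p = Φ q) (v : TangentSpace J q) :
    v ∈ tangentSet J S q ↔ mfderiv J 𝓘(ℝ, K) Φ q v = 0 := by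
  constructor
  · rintro ⟨ε, c, hε, hc, hcS, hcv⟩
    have h0 : (0 : ℝ) ∈ Ioo (-ε) ε := ⟨by linarith, hε⟩
    obtain rfl : c 0 = q := congrArg TotalSpace.proj hcv
    obtain rfl : velocity J c (Ioo (-ε) ε) 0 = v := eq_of_heq (TotalSpace.mk.inj hcv).2
    have hcat : ContinuousAt c 0 := (hc.continuousOn).continuousAt (Ioo_mem_nhds h0.1 h0.2)
    obtain ⟨δ, hδ, hball⟩ := Metric.eventually_nhds_iff_ball.1 (hcat (hO.mem_nhds hq))
    set η := min ε δ
    have hη : 0 < η := lt_min hε hδ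
    have hsub : Ioo (-η) η ⊆ Ioo (-ε) ε :=
      Ioo_subset_Ioo (neg_le_neg (min_le_left _ _)) (min_le_left _ _)
    have h0' : (0 : ℝ) ∈ Ioo (-η) η := ⟨by linarith, hη⟩
    have hmd := (hc 0 h0).mdifferentiableWithinAt (by simp)
    have hvel : velocity J c (Ioo (-ε) ε) 0 = velocity J c (Ioo (-η) η) 0 := by
      rw [velocity, velocity, mfderivWithin_of_isOpen isOpen_Ioo h0,
        mfderivWithin_of_isOpen isOpen_Ioo h0']
    rw [hvel]
    refine velocity_mem_ker (uniqueDiffOn_Ioo _ _ 0 h0') (hmd.mono hsub)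
      ((hΦ.contMDiffAt (hO.mem_nhds hq)).mdifferentiableAt (by simp)) fun τ hτ => ?_
    have hτO : c τ ∈ O := hball τ (by
      rw [Metric.mem_ball, Real.dist_eq, sub_zero, abs_lt]
      exact ⟨(neg_le_neg (min_le_right ε δ)).trans_lt hτ.1, hτ.2.trans_le (min_le_right _ _)⟩)
    exact (hS _ hτO).1 (hcS τ (hsub hτ))
  · intro hv
    obtain ⟨X, hX, rfl⟩ := exists_extension_of_tangentVector q v
    obtain ⟨ε, hε, c, hc0, hcs, hcO, hcv⟩ := exists_curve_in_levelSet
      (hO.inter (chartAt H q).open_source) (hΦ.mono inter_subset_left)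
      ⟨hq, mem_chart_source H q⟩ hsurj (hX.mono inter_subset_right) hv
    refine ⟨ε, c, hε, hcs, fun t ht => (hS _ (hcO t ht).1.1).2 (hcO t ht).2, ?_⟩
    rw [hcv 0 ⟨by linarith, hε⟩ (by rw [hc0]; exact hv), hc0]

/-- A set that is locally a regular level set of a map into `K` is an embedded submanifold of
codimension `dim K`. -/
lemma isEmbeddedSubmanifold_of_levelSet {S : Set N} {d : ℕ}
    (hd : d + Module.finrank ℝ K = Module.finrank ℝ F)
    (hS : ∀ q ∈ S, ∃ (O : Set N) (Φ : N → K), IsOpen O ∧ q ∈ O ∧ ContMDiffOn J 𝓘(ℝ, K) ∞ Φ O ∧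
      Function.Surjective (mfderiv J 𝓘(ℝ, K) Φ q) ∧ ∀ p ∈ O, p ∈ S ↔ Φ p = Φ q) :
    IsEmbeddedSubmanifold J S d := by
  intro q hqS
  obtain ⟨O, Φ, hO, hq, hΦ, hsurj, hSO⟩ := hS q hqS
  have hback : (extChartAt J q).symm (extChartAt J q q) = q :=
    (extChartAt J q).left_inv (mem_extChartAt_source q)
  set f : F → K := fun y => Φ ((extChartAt J q).symm y) with hf
  have hfsurj : Function.Surjective (fderiv ℝ f (extChartAt J q q)) := fun k => by
    obtain ⟨v, hv⟩ := hsurj k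
    exact ⟨v, (fderiv_comp_extChartAt_symm_self hO hΦ hq v).trans hv⟩
  obtain ⟨Ψ, hΨq, hΨO, hΨ, hΨs, hΨf⟩ := exists_straightening
    (isOpen_extChartAt_symm_preimage (J := J) q hO) (contDiffOn_comp_extChartAt_symm hΦ q)
    (extChartAt_mem_target_inter hq) hfsurj
  -- the straightening, read in the model space `H`
  let h : H ≃ₜ F := J.toHomeomorph
  let Ψ' : OpenPartialHomeomorph H H :=
    (h.toOpenPartialHomeomorph.trans Ψ).trans h.symm.toOpenPartialHomeomorph
  have hJ : ∀ y : F, J (J.symm y) = y := fun y => J.right_inv (by rw [J.range_eq_univ]; trivial)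
  have hΨ' : Ψ' ∈ contDiffGroupoid ∞ J := by
    rw [contDiffGroupoid, mem_groupoid_of_pregroupoid]
    constructor
    · change ContDiffOn ℝ ∞ (J ∘ Ψ' ∘ J.symm) (J.symm ⁻¹' Ψ'.source ∩ range J)
      refine (hΨ.mono ?_).congr ?_
      · rintro y ⟨hy, -⟩
        have : Ψ'.source = J ⁻¹' Ψ.source := by ext; simp [Ψ', h]
        rw [this] at hy
        simpa [hJ] using hy
      · intro y _
        change J (J.symm (Ψ (J (J.symm y)))) = _
        rw [hJ, hJ]
    · change ContDiffOn ℝ ∞ (J ∘ Ψ'.symm ∘ J.symm) (J.symm ⁻¹' Ψ'.target ∩ range J)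
      refine (hΨs.mono ?_).congr ?_
      · rintro y ⟨hy, -⟩
        have : Ψ'.target = J ⁻¹' Ψ.target := by ext; simp [Ψ', h]
        rw [this] at hy
        simpa [hJ] using hy
      · intro y _
        change J (J.symm (Ψ.symm (J (J.symm y)))) = _
        rw [hJ, hJ]
  have hsource : ((chartAt H q).trans Ψ').source =
      (chartAt H q).source ∩ extChartAt J q ⁻¹' Ψ.source := by
    ext p; simp [Ψ', h]
  refine ⟨(chartAt H q).trans Ψ', ?_, ?_, LinearMap.ker (fderiv ℝ f (extChartAt J q q)).toLinearMap,
    ?_, ?_⟩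
  · intro e' he'
    have h1 := (contDiffGroupoid ∞ J).compatible (chart_mem_atlas H q) he'
    have h2 := (contDiffGroupoid ∞ J).compatible he' (chart_mem_atlas H q)
    refine ⟨?_, ?_⟩
    · rw [OpenPartialHomeomorph.trans_symm_eq_symm_trans_symm, OpenPartialHomeomorph.trans_assoc]
      exact (contDiffGroupoid ∞ J).trans ((contDiffGroupoid ∞ J).symm hΨ') h1
    · rw [← OpenPartialHomeomorph.trans_assoc]
      exact (contDiffGroupoid ∞ J).trans h2 hΨ'
  · rw [hsource]
    exact ⟨mem_chart_source H q, hΨq⟩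
  · have := LinearMap.finrank_range_add_finrank_ker (fderiv ℝ f (extChartAt J q q)).toLinearMap
    rw [LinearMap.range_eq_top.2 hfsurj, finrank_top] at this
    omega
  · intro p hp
    rw [hsource] at hp
    have hpsrc : p ∈ (extChartAt J q).source := by rw [extChartAt_source]; exact hp.1
    have hpO : p ∈ O := by
      have := (hΨO hp.2).2
      rwa [mem_preimage, (extChartAt J q).left_inv hpsrc] at this
    have hext : ((chartAt H q).trans Ψ').extend J p = Ψ (extChartAt J q p) := by
      change J (J.symm (Ψ (J (chartAt H q p)))) = _
      rw [hJ]; rfl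
    rw [hext, LinearMap.mem_ker, hSO p hpO]
    change _ ↔ fderiv ℝ f (extChartAt J q q) (Ψ (extChartAt J q p)) = 0
    rw [hΨf _ hp.2, sub_eq_zero, (extChartAt J q).left_inv hpsrc, hback]

/-- Along a regular level set, derivatives in tangent directions of functions read in a chart
depend only on the values on the level set. -/
lemma fderiv_eq_of_eqOn_level {Q : Type*} [NormedAddCommGroup Q] [NormedSpace ℝ Q]
    {Φ : N → K} {O : Set N} (hO : IsOpen O)
    (hΦ : ContMDiffOn J 𝓘(ℝ, K) ∞ Φ O) {q : N} (hq : q ∈ O)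
    (hsurj : Function.Surjective (mfderiv J 𝓘(ℝ, K) Φ q)) {v : TangentSpace J q}
    (hv : mfderiv J 𝓘(ℝ, K) Φ q v = 0) {a b : F → Q}
    (ha : DifferentiableAt ℝ a (extChartAt J q q)) (hb : DifferentiableAt ℝ b (extChartAt J q q))
    (hab : ∀ p ∈ O, p ∈ (chartAt H q).source → Φ p = Φ q →
      a (extChartAt J q p) = b (extChartAt J q p)) :
    fderiv ℝ a (extChartAt J q q) v = fderiv ℝ b (extChartAt J q q) v := by
  refine fderiv_eq_of_eqOn_levelSet
    (isOpen_extChartAt_symm_preimage (J := J) q hO) (contDiffOn_comp_extChartAt_symm hΦ q)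
    (extChartAt_mem_target_inter hq)
    (fun k => by
      obtain ⟨v, hv⟩ := hsurj k
      exact ⟨v, (fderiv_comp_extChartAt_symm_self hO hΦ hq v).trans hv⟩)
    ((fderiv_comp_extChartAt_symm_self hO hΦ hq _).trans hv) ha hb ?_
  intro y hy hyq
  have := hab _ hy.2 (by rw [← extChartAt_source J]; exact (extChartAt J q).map_target hy.1)
    (by rw [hyq]; simp)
  rwa [(extChartAt J q).right_inv hy.1] at this

end ManifoldLevelSets

/-! ### The metric and the Levi-Civita connection in a chart -/

lemma extChartAt_symm_mem_source {n : ℕ} {M : Type*} [TopologicalSpace M] [ChartedSpace (En n) M]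
    {x₀ : M} {y : En n} (hy : y ∈ (extChartAt (IM n) x₀).target) :
    (extChartAt (IM n) x₀).symm y ∈ (chartAt (En n) x₀).source := by
  rw [← extChartAt_source (IM n)]; exact (extChartAt (IM n) x₀).map_target hy

section Riemannian

variable {n : ℕ} {M : Type*} [TopologicalSpace M] [ChartedSpace (En n) M]
  [IsManifold (IM n) ∞ M]
  (g : ContMDiffRiemannianMetric (IM n) ∞ (En n) (fun x : M => TangentSpace (IM n) x))

/-- The metric in the preferred chart at `x₀`. -/
def chartMetric (x₀ : M) (y : En n) : En n →L[ℝ] En n →L[ℝ] ℝ :=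
  let L : En n →L[ℝ] En n := mfderiv 𝓘(ℝ, En n) (IM n) (extChartAt (IM n) x₀).symm y
  let B : En n →L[ℝ] En n →L[ℝ] ℝ := g.inner ((extChartAt (IM n) x₀).symm y)
  B.bilinearComp L L

lemma chartMetric_apply (x₀ : M) (y v w : En n) :
    chartMetric g x₀ y v w = g.inner ((extChartAt (IM n) x₀).symm y)
      (mfderiv 𝓘(ℝ, En n) (IM n) (extChartAt (IM n) x₀).symm y v)
      (mfderiv 𝓘(ℝ, En n) (IM n) (extChartAt (IM n) x₀).symm y w) := rfl

lemma chartMetric_chartDeriv {x₀ x : M} (hx : x ∈ (chartAt (En n) x₀).source)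
    (v w : TangentSpace (IM n) x) :
    chartMetric g x₀ (extChartAt (IM n) x₀ x) (chartDeriv (IM n) x₀ x v)
      (chartDeriv (IM n) x₀ x w) = g.inner x v w := by
  have hxs : x ∈ (extChartAt (IM n) x₀).source := by rwa [extChartAt_source]
  have key : ∀ (z : M) (hz : z = x) (a b : TangentSpace (IM n) z)
      (ha : (a : En n) = v) (hb : (b : En n) = w), g.inner z a b = g.inner x v w := by
    rintro z rfl a b rfl rfl; rfl
  have h1 := mfderivWithin_extChartAt_symm_comp_mfderiv_extChartAt' (I := IM n) hxs
  rw [ModelWithCorners.range_eq_univ, mfderivWithin_univ] at h1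
  rw [chartMetric_apply]
  exact key _ ((extChartAt (IM n) x₀).left_inv hxs) _ _ (DFunLike.congr_fun h1 v)
    (DFunLike.congr_fun h1 w)

lemma isInnerForm_inner (x : M) :
    IsInnerForm (E := En n) (g.inner x : En n →L[ℝ] En n →L[ℝ] ℝ) :=
  ⟨fun v w => g.symm x v w, fun v hv => g.pos x v hv⟩

lemma chartDeriv_surjective {x₀ x : M} (hx : x ∈ (chartAt (En n) x₀).source) :
    Function.Surjective (chartDeriv (IM n) x₀ x) :=
  (isInvertible_mfderiv_extChartAt (by rwa [extChartAt_source])).bijective.surjective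

lemma isInnerForm_chartMetric {x₀ : M} {y : En n} (hy : y ∈ (extChartAt (IM n) x₀).target) :
    IsInnerForm (chartMetric g x₀ y) := by
  refine ⟨fun v w => ?_, fun v hv => ?_⟩
  · rw [chartMetric_apply, g.symm, chartMetric_apply]
  rw [chartMetric_apply]
  refine g.pos _ _ fun h => hv ?_
  have h1 := mfderiv_extChartAt_comp_mfderivWithin_extChartAt_symm (I := IM n) hy
  rw [ModelWithCorners.range_eq_univ, mfderivWithin_univ] at h1
  have h2 := DFunLike.congr_fun h1 v
  refine Eq.trans h2.symm ?_
  refine (congrArg (mfderiv (IM n) 𝓘(ℝ, En n) (extChartAt (IM n) x₀)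
    ((extChartAt (IM n) x₀).symm y)) h).trans (map_zero _)

lemma contDiffOn_chartMetric (x₀ : M) :
    ContDiffOn ℝ ∞ (chartMetric g x₀) (extChartAt (IM n) x₀).target := by
  rw [contDiffOn_clm_apply]
  intro v
  rw [contDiffOn_clm_apply]
  intro w
  let e := trivializationAt (En n) (TangentSpace (IM n) : M → Type _) x₀
  have hb : e.baseSet = (chartAt (En n) x₀).source := by simp [e]
  have hsec : ∀ v : En n, ContMDiffOn (IM n) (IM n).tangent ∞
      (fun p => (⟨p, e.symmL ℝ p v⟩ : TangentBundle (IM n) M)) (chartAt (En n) x₀).source := by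
    intro v
    have h := (Trivialization.contMDiffOn_section_baseSet_iff (IB := IM n) (n := ∞)
      (s := fun p => e.symmL ℝ p v) e).2 (by
        refine (contMDiffOn_const (c := v)).congr fun p hp => ?_
        rw [Trivialization.symmL_apply _ hp, e.apply_mk_symm hp])
    rwa [hb] at h
  have hsm : ContMDiffOn (IM n) 𝓘(ℝ, ℝ) ∞ (fun p => g.inner p (e.symmL ℝ p v) (e.symmL ℝ p w))
      (chartAt (En n) x₀).source := by
    intro p hp
    have : ContMDiffWithinAt (IM n) ((IM n).prod 𝓘(ℝ, ℝ)) ∞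
        (fun m ↦ TotalSpace.mk' ℝ (E := Bundle.Trivial M ℝ) m
          (g.inner m (e.symmL ℝ m v) (e.symmL ℝ m w))) (chartAt (En n) x₀).source p := by
      apply ContMDiffWithinAt.clm_bundle_apply₂ (F₁ := En n) (F₂ := En n)
      · exact g.contMDiff.contMDiffAt.contMDiffWithinAt
      · exact hsec v p hp
      · exact hsec w p hp
    simp only [contMDiffWithinAt_totalSpace] at this
    exact this.2
  have h2 := hsm.comp (contMDiffOn_extChartAt_symm (I := IM n) (n := ∞) x₀)
    (fun y hy => extChartAt_symm_mem_source hy)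
  refine h2.contDiffOn.congr fun y hy => ?_
  have h3 := TangentBundle.symmL_trivializationAt (I := IM n) (extChartAt_symm_mem_source hy)
  rw [ModelWithCorners.range_eq_univ, mfderivWithin_univ, (extChartAt (IM n) x₀).right_inv hy] at h3
  rw [chartMetric_apply]
  change _ = g.inner _ (e.symmL ℝ _ v) (e.symmL ℝ _ w)
  rw [h3]
  rfl

lemma contDiffOn_christoffel_chartMetric (x₀ : M) :
    ContDiffOn ℝ ∞ (christoffelMap (chartMetric g x₀)) (extChartAt (IM n) x₀).target :=
  contDiffOn_christoffelMap (isOpen_extChartAt_target x₀) (contDiffOn_chartMetric g x₀)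
    fun _ hy => isInnerForm_chartMetric g hy

end Riemannian

section Connection

variable {n : ℕ} {M : Type*} [TopologicalSpace M] [ChartedSpace (En n) M]
  [IsManifold (IM n) ∞ M]
  (g : ContMDiffRiemannianMetric (IM n) ∞ (En n) (fun x : M => TangentSpace (IM n) x))

lemma sum_smul_single (v : En n) :
    ∑ i, v i • (EuclideanSpace.single i (1 : ℝ) : En n) = v := by
  ext j
  simp [Pi.single_apply]

lemma metricCoeffDeriv_eq {x₀ : M} {y : En n} (hy : y ∈ (extChartAt (IM n) x₀).target)
    (k i j : Fin n) : metricCoeffDeriv g x₀ y k i j =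
      fderiv ℝ (chartMetric g x₀) y (EuclideanSpace.single k 1) (EuclideanSpace.single i 1)
        (EuclideanSpace.single j 1) := by
  have hd : DifferentiableAt ℝ (chartMetric g x₀) y :=
    ((contDiffOn_chartMetric g x₀).contDiffAt
      ((isOpen_extChartAt_target x₀).mem_nhds hy)).differentiableAt (by simp)
  have h := ((hd.hasFDerivAt.clm_apply (hasFDerivAt_const (EuclideanSpace.single i (1 : ℝ)) y)
    ).clm_apply (hasFDerivAt_const (EuclideanSpace.single j (1 : ℝ)) y)).fderiv
  have h' := DFunLike.congr_fun h (EuclideanSpace.single k (1 : ℝ))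
  change fderiv ℝ (fun z => chartMetric g x₀ z (EuclideanSpace.single i 1)
    (EuclideanSpace.single j 1)) y (EuclideanSpace.single k 1) = _
  rw [h']
  simp

/-- The Christoffel symbols, defined through the inverse matrix of the metric, are the components
of the Christoffel map. -/
lemma christoffel_eq {x₀ : M} {y : En n} (hy : y ∈ (extChartAt (IM n) x₀).target)
    (k i j : Fin n) : christoffel g x₀ y k i j =
      christoffelMap (chartMetric g x₀) y (EuclideanSpace.single i 1)
        (EuclideanSpace.single j 1) k := by
  set a : En n := christoffelMap (chartMetric g x₀) y (EuclideanSpace.single i 1)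
        (EuclideanSpace.single j 1) with ha
  set A := metricCoeff g x₀ y with hA
  have hpos := isInnerForm_chartMetric g hy
  have hmul : ∀ b : En n, ∀ l, A.mulVec b l = chartMetric g x₀ y (EuclideanSpace.single l 1) b := by
    intro b l
    conv_rhs => rw [← sum_smul_single b]
    simp only [Matrix.mulVec, dotProduct, map_sum, map_smul, smul_eq_mul]
    exact Finset.sum_congr rfl fun m _ => mul_comm _ _
  have hinj : Function.Injective A.mulVec := by
    intro b c hbc
    have : (WithLp.toLp 2 b : En n) = WithLp.toLp 2 c := by
      refine hpos.eq_of_forall fun u => ?_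
      rw [hpos.symm, hpos.symm _ u]
      conv_lhs => rw [← sum_smul_single u]
      conv_rhs => rw [← sum_smul_single u]
      simp only [map_sum, map_smul, sum_apply, smul_apply]
      refine Finset.sum_congr rfl fun l _ => ?_
      rw [← hmul, ← hmul]
      exact congrArg (fun f : Fin n → ℝ => u l • f l) hbc
    simpa using this
  have hu : IsUnit A.det := (Matrix.isUnit_iff_isUnit_det A).1
    (Matrix.mulVec_injective_iff_isUnit.1 hinj)
  have hK : A.mulVec a = fun l => (1 / 2 : ℝ) * (metricCoeffDeriv g x₀ y i j l +
      metricCoeffDeriv g x₀ y j i l - metricCoeffDeriv g x₀ y l i j) := by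
    funext l
    rw [hmul, hpos.symm, ha, inner_christoffelMap hpos, metricCoeffDeriv_eq g hy,
      metricCoeffDeriv_eq g hy, metricCoeffDeriv_eq g hy]
  have hsol : (a : Fin n → ℝ) = A⁻¹.mulVec (A.mulVec a) := by
    rw [Matrix.mulVec_mulVec, Matrix.nonsing_inv_mul _ hu, Matrix.one_mulVec]
  rw [hsol, hK, christoffel, Matrix.mulVec, dotProduct, Finset.mul_sum]
  exact Finset.sum_congr rfl fun l _ => by ring

lemma christoffelVec_eq (x : M) (v w : TangentSpace (IM n) x) :
    christoffelVec g x v w =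
      christoffelMap (chartMetric g x) (extChartAt (IM n) x x) (v : En n) (w : En n) := by
  set B := christoffelMap (chartMetric g x) (extChartAt (IM n) x x)
  have h : ∀ v w : En n, B v w = ∑ i, ∑ j, (v i * w j) •
      B (EuclideanSpace.single i 1) (EuclideanSpace.single j 1) := by
    intro v w
    conv_lhs => rw [← sum_smul_single v, ← sum_smul_single w]
    simp only [map_sum, map_smul, sum_apply, smul_apply, Finset.smul_sum, smul_smul]
    rw [Finset.sum_comm]
    exact Finset.sum_congr rfl fun i _ => Finset.sum_congr rfl fun j _ => by rw [mul_comm]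
  refine Eq.trans ?_ (h (comps v) (comps w)).symm
  change (WithLp.toLp 2 _ : En n) = _
  ext k
  simp only [WithLp.ofLp_sum, Finset.sum_apply, WithLp.ofLp_smul, Pi.smul_apply, smul_eq_mul]
  refine Finset.sum_congr rfl fun i _ => Finset.sum_congr rfl fun j _ => ?_
  rw [christoffel_eq g (mem_extChartAt_target x)]
  ring

/-- The coordinate change between the charts at `x` and at `x₀` has the expected derivative. -/
lemma fderiv_coordChange {x₀ x z : M} (hz : z ∈ (chartAt (En n) x).source)
    (hz₀ : z ∈ (chartAt (En n) x₀).source) (v : TangentSpace (IM n) z) :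
    fderiv ℝ (fun y => extChartAt (IM n) x₀ ((extChartAt (IM n) x).symm y))
      (extChartAt (IM n) x z) (chartDeriv (IM n) x z v) = chartDeriv (IM n) x₀ z v :=
  fderiv_comp_extChartAt_symm hz (mdifferentiableAt_extChartAt hz₀) v

lemma contDiffAt_coordChange {x₀ x : M} (hx : x ∈ (chartAt (En n) x₀).source) :
    ContDiffAt ℝ ∞ (fun y => extChartAt (IM n) x₀ ((extChartAt (IM n) x).symm y))
      (extChartAt (IM n) x x) :=
  (contDiffOn_comp_extChartAt_symm (contMDiffOn_extChartAt (x := x₀)) x).contDiffAt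
    ((isOpen_extChartAt_symm_preimage x (chartAt (En n) x₀).open_source).mem_nhds
      (extChartAt_mem_target_inter hx))

/-- The transformation law of the Christoffel map between the chart at `x`, used at its centre, and
the chart at `x₀`. -/
lemma christoffelVec_coordChange {x₀ x : M} (hx : x ∈ (chartAt (En n) x₀).source)
    (v w : TangentSpace (IM n) x) :
    chartDeriv (IM n) x₀ x (christoffelVec g x v w) =
      christoffelMap (chartMetric g x₀) (extChartAt (IM n) x₀ x) (chartDeriv (IM n) x₀ x v)
        (chartDeriv (IM n) x₀ x w) +
      fderiv ℝ (fderiv ℝ fun y => extChartAt (IM n) x₀ ((extChartAt (IM n) x).symm y))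
        (extChartAt (IM n) x x) (v : En n) (w : En n) := by
  set θ := fun y => extChartAt (IM n) x₀ ((extChartAt (IM n) x).symm y) with hθ
  have hback : (extChartAt (IM n) x).symm (extChartAt (IM n) x x) = x := extChartAt_to_inv x
  have hθx : θ (extChartAt (IM n) x x) = extChartAt (IM n) x₀ x := by rw [hθ]; simp
  have hD : ∀ u : TangentSpace (IM n) x, fderiv ℝ θ (extChartAt (IM n) x x) (u : En n) =
      chartDeriv (IM n) x₀ x u := fun u => by
    have := fderiv_coordChange (mem_chart_source (En n) x) hx u
    rwa [chartDeriv_self] at this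
  have htar : extChartAt (IM n) x₀ x ∈ (extChartAt (IM n) x₀).target :=
    (extChartAt (IM n) x₀).map_source (by rwa [extChartAt_source])
  have hnb := (isOpen_extChartAt_target (I := IM n) x₀).mem_nhds htar
  have key := christoffelMap_pullback (G := chartMetric g x) (G' := chartMetric g x₀)
    (y := extChartAt (IM n) x x) (θ := θ)
    ((contDiffAt_coordChange hx).of_le ENat.LEInfty.out)
    (by rw [hθx]; exact ((contDiffOn_chartMetric g x₀).contDiffAt hnb).differentiableAt (by simp))
    (by
      rw [hθx]
      filter_upwards [hnb] with z hz using isInnerForm_chartMetric g hz)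
    (isInnerForm_chartMetric g (mem_extChartAt_target x))
    (fun u => by
      obtain ⟨v, hv⟩ := chartDeriv_surjective hx u
      exact ⟨v, (hD v).trans hv⟩)
    (by
      filter_upwards [(isOpen_extChartAt_symm_preimage (J := IM n) x
        (chartAt (En n) x₀).open_source).mem_nhds (extChartAt_mem_target_inter hx)]
        with y hy v w
      have hy1 := extChartAt_symm_mem_source hy.1
      obtain ⟨v, rfl⟩ := chartDeriv_surjective hy1 v
      obtain ⟨w, rfl⟩ := chartDeriv_surjective hy1 w
      have hr : extChartAt (IM n) x ((extChartAt (IM n) x).symm y) = y :=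
        (extChartAt (IM n) x).right_inv hy.1
      have h1 := chartMetric_chartDeriv g hy1 v w
      have h2 := chartMetric_chartDeriv g hy.2 v w
      have h3 := fderiv_coordChange hy1 hy.2 v
      have h4 := fderiv_coordChange hy1 hy.2 w
      rw [hr] at h1 h3 h4
      rw [h1, hθ, h3, h4, h2])
    (v : En n) (w : En n)
  rw [hθx, hD, hD] at key
  rw [← key, christoffelVec_eq]
  exact (hD _).symm

end Connection

/-! ### Charts of `TM ⊕ TM` and the connection -/

section TotalSpaceCharts

variable {n : ℕ} {M : Type*} [TopologicalSpace M] [ChartedSpace (En n) M]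
  [IsManifold (IM n) ∞ M]

lemma mem_chart_source_TT {q₀ p : TT n M} :
    p ∈ (chartAt (ModelProd (En n) (En n × En n)) q₀).source ↔
      p.proj ∈ (chartAt (En n) q₀.proj).source := by
  have hb : (trivializationAt (En n × En n)
      (fun x : M => TangentSpace (IM n) x × TangentSpace (IM n) x) q₀.proj).baseSet =
      (chartAt (En n) q₀.proj).source := by
    change (trivializationAt (En n) (TangentSpace (IM n) : M → Type _) q₀.proj).baseSet ∩
      (trivializationAt (En n) (TangentSpace (IM n) : M → Type _) q₀.proj).baseSet = _
    simp
  rw [FiberBundle.chartedSpace_chartAt]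
  simp only [mfld_simps]
  have h1 := (trivializationAt (En n × En n)
    (fun x : M => TangentSpace (IM n) x × TangentSpace (IM n) x) q₀.proj).mem_source (x := p)
  rw [hb] at h1
  exact ⟨fun h => h1.1 h.1, fun h => ⟨h1.2 h, h⟩⟩

lemma extChartAt_TT {q₀ p : TT n M} (hp : p.proj ∈ (chartAt (En n) q₀.proj).source) :
    extChartAt (ITT n) q₀ p = (extChartAt (IM n) q₀.proj p.proj,
      (chartDeriv (IM n) q₀.proj p.proj p.2.1, chartDeriv (IM n) q₀.proj p.proj p.2.2)) := by
  rw [chartDeriv_eq_trivializationAt hp, chartDeriv_eq_trivializationAt hp]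
  rw [FiberBundle.extChartAt]
  rfl

lemma extChartAt_TT_self (q : TT n M) :
    extChartAt (ITT n) q q = (extChartAt (IM n) q.proj q.proj, ((q.2.1 : En n), (q.2.2 : En n))) := by
  rw [extChartAt_TT (mem_chart_source _ _), chartDeriv_self, chartDeriv_self]
  rfl

variable (n) in
/-- The derivative of the projection `TM ⊕ TM → M`. -/
def baseMap (q : TT n M) : TangentSpace (ITT n) q →L[ℝ] TangentSpace (IM n) q.proj :=
  ContinuousLinearMap.fst ℝ (En n) (En n × En n)

variable (g : ContMDiffRiemannianMetric (IM n) ∞ (En n) (fun x : M => TangentSpace (IM n) x))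

/-- The first connector of `TM ⊕ TM`: it maps the velocity of a curve `(x, V, R)` to `D_t V`. -/
def connV (q : TT n M) : TangentSpace (ITT n) q →L[ℝ] TangentSpace (IM n) q.proj :=
  let pr : En n × En n × En n →L[ℝ] En n :=
    (ContinuousLinearMap.fst ℝ (En n) (En n)).comp (ContinuousLinearMap.snd ℝ (En n) (En n × En n))
  let Γ : En n →L[ℝ] En n →L[ℝ] En n :=
    christoffelMap (chartMetric g q.proj) (extChartAt (IM n) q.proj q.proj)
  pr + (Γ.flip q.2.1).comp (ContinuousLinearMap.fst ℝ (En n) (En n × En n))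

/-- The second connector of `TM ⊕ TM`: it maps the velocity of a curve `(x, V, R)` to `D_t R`. -/
def connR (q : TT n M) : TangentSpace (ITT n) q →L[ℝ] TangentSpace (IM n) q.proj :=
  let pr : En n × En n × En n →L[ℝ] En n :=
    (ContinuousLinearMap.snd ℝ (En n) (En n)).comp (ContinuousLinearMap.snd ℝ (En n) (En n × En n))
  let Γ : En n →L[ℝ] En n →L[ℝ] En n :=
    christoffelMap (chartMetric g q.proj) (extChartAt (IM n) q.proj q.proj)
  pr + (Γ.flip q.2.2).comp (ContinuousLinearMap.fst ℝ (En n) (En n × En n))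

/-- The tangent vector of `TM ⊕ TM` with base component `u` and connector components `v`, `r`. -/
def liftVec (q : TT n M) (u v r : TangentSpace (IM n) q.proj) : TangentSpace (ITT n) q :=
  ((u, (v - christoffelVec g q.proj u q.2.1, r - christoffelVec g q.proj u q.2.2)) :
    En n × En n × En n)

lemma connV_apply (q : TT n M) (u v r : TangentSpace (IM n) q.proj) :
    connV g q (((u : En n), ((v : En n), (r : En n))) : En n × En n × En n) = v + christoffelVec g q.proj u q.2.1 := by
  rw [christoffelVec_eq]; rfl

lemma connR_apply (q : TT n M) (u v r : TangentSpace (IM n) q.proj) :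
    connR g q (((u : En n), ((v : En n), (r : En n))) : En n × En n × En n) = r + christoffelVec g q.proj u q.2.2 := by
  rw [christoffelVec_eq]; rfl

lemma baseMap_liftVec (q : TT n M) (u v r : TangentSpace (IM n) q.proj) :
    baseMap n q (liftVec g q u v r) = u := rfl

lemma connV_liftVec (q : TT n M) (u v r : TangentSpace (IM n) q.proj) :
    connV g q (liftVec g q u v r) = v :=
  (connV_apply g q _ _ _).trans (sub_add_cancel v _)

lemma connR_liftVec (q : TT n M) (u v r : TangentSpace (IM n) q.proj) :
    connR g q (liftVec g q u v r) = r :=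
  (connR_apply g q _ _ _).trans (sub_add_cancel r _)

lemma liftVec_eq (q : TT n M) (w : TangentSpace (ITT n) q) :
    liftVec g q (baseMap n q w) (connV g q w) (connR g q w) = w := by
  obtain ⟨u, v, r⟩ := w
  have h1 := connV_apply g q u v r
  have h2 := connR_apply g q u v r
  have : ∀ a b c d : En n, a = v + c → b = r + d →
      ((u, (a - c, b - d)) : En n × En n × En n) = (u, (v, r)) := by
    rintro a b c d rfl rfl; simp
  exact this _ _ _ _ h1 h2

lemma tangent_ext {q : TT n M} {w w' : TangentSpace (ITT n) q}
    (h1 : baseMap n q w = baseMap n q w') (h2 : connV g q w = connV g q w')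
    (h3 : connR g q w = connR g q w') : w = w' := by
  rw [← liftVec_eq g q w, h1, h2, h3, liftVec_eq]

/-- The coordinate change between the charts of `TM ⊕ TM` at `p` and at `q₀`. -/
lemma coordChange_TT_eventuallyEq {q₀ p : TT n M} (hp : p.proj ∈ (chartAt (En n) q₀.proj).source)
    {θ : En n → En n}
    (hθ : θ = fun y => extChartAt (IM n) q₀.proj ((extChartAt (IM n) p.proj).symm y)) :
    (fun y => extChartAt (ITT n) q₀ ((extChartAt (ITT n) p).symm y)) =ᶠ[𝓝 (extChartAt (ITT n) p p)]
      fun y => (θ y.1, (fderiv ℝ θ y.1 y.2.1, fderiv ℝ θ y.1 y.2.2)) := by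
  filter_upwards [(isOpen_extChartAt_symm_preimage (J := ITT n) p
    (chartAt (ModelProd (En n) (En n × En n)) q₀).open_source).mem_nhds
    (extChartAt_mem_target_inter (mem_chart_source_TT.2 hp))] with y hy
  set z := (extChartAt (ITT n) p).symm y
  have hz₀ : z.proj ∈ (chartAt (En n) q₀.proj).source := mem_chart_source_TT.1 hy.2
  have hz : z.proj ∈ (chartAt (En n) p.proj).source := by
    rw [← mem_chart_source_TT, ← extChartAt_source (ITT n)]
    exact (extChartAt (ITT n) p).map_target hy.1
  have hy' : extChartAt (ITT n) p z = y := (extChartAt (ITT n) p).right_inv hy.1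
  rw [extChartAt_TT hz] at hy'
  rw [extChartAt_TT hz₀, ← hy', hθ]
  have h1 := fderiv_coordChange hz hz₀ z.2.1
  have h2 := fderiv_coordChange hz hz₀ z.2.2
  have hback : (extChartAt (IM n) p.proj).symm (extChartAt (IM n) p.proj z.proj) = z.proj :=
    (extChartAt (IM n) p.proj).left_inv (by rwa [extChartAt_source])
  simp only [h1, h2, hback]

/-- The derivative of a chart of `TM ⊕ TM` in terms of the connectors. -/
lemma chartDeriv_TT {q₀ p : TT n M} (hp : p.proj ∈ (chartAt (En n) q₀.proj).source)
    (w : TangentSpace (ITT n) p) :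
    chartDeriv (ITT n) q₀ p w =
      (chartDeriv (IM n) q₀.proj p.proj (baseMap n p w),
      (chartDeriv (IM n) q₀.proj p.proj (connV g p w) -
        christoffelMap (chartMetric g q₀.proj) (extChartAt (IM n) q₀.proj p.proj)
          (chartDeriv (IM n) q₀.proj p.proj (baseMap n p w))
          (chartDeriv (IM n) q₀.proj p.proj p.2.1),
      chartDeriv (IM n) q₀.proj p.proj (connR g p w) -
        christoffelMap (chartMetric g q₀.proj) (extChartAt (IM n) q₀.proj p.proj)
          (chartDeriv (IM n) q₀.proj p.proj (baseMap n p w))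
          (chartDeriv (IM n) q₀.proj p.proj p.2.2))) := by
  obtain ⟨θ, hθ⟩ : ∃ θ : En n → En n,
    θ = fun y => extChartAt (IM n) q₀.proj ((extChartAt (IM n) p.proj).symm y) := ⟨_, rfl⟩
  have h1 := fderiv_comp_extChartAt_symm (mem_chart_source (ModelProd (En n) (En n × En n)) p)
    (mdifferentiableAt_extChartAt (mem_chart_source_TT.2 hp)) w
  rw [chartDeriv_self] at h1
  refine h1.symm.trans ?_
  rw [(coordChange_TT_eventuallyEq hp hθ).fderiv_eq, extChartAt_TT_self]
  obtain ⟨u, v, r⟩ := w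
  have hsm : ContDiffAt ℝ ∞ θ (extChartAt (IM n) p.proj p.proj) := by
    rw [hθ]; exact contDiffAt_coordChange hp
  have hd1 : HasFDerivAt θ (fderiv ℝ θ (extChartAt (IM n) p.proj p.proj))
      (extChartAt (IM n) p.proj p.proj) := (hsm.differentiableAt (by simp)).hasFDerivAt
  have hd2 : HasFDerivAt (fderiv ℝ θ) (fderiv ℝ (fderiv ℝ θ) (extChartAt (IM n) p.proj p.proj))
      (extChartAt (IM n) p.proj p.proj) :=
    ((hsm.fderiv_right (m := ∞) (by simp)).differentiableAt (by simp)).hasFDerivAt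
  have hD : ∀ v : TangentSpace (IM n) p.proj, fderiv ℝ θ (extChartAt (IM n) p.proj p.proj)
      (v : En n) = chartDeriv (IM n) q₀.proj p.proj v := fun v => by
    have := fderiv_coordChange (mem_chart_source (En n) p.proj) hp v
    rw [chartDeriv_self, ← hθ] at this
    exact this
  have hΓ : ∀ a b : TangentSpace (IM n) p.proj,
      fderiv ℝ (fderiv ℝ θ) (extChartAt (IM n) p.proj p.proj) (a : En n) (b : En n) =
      chartDeriv (IM n) q₀.proj p.proj (christoffelVec g p.proj a b) -
      christoffelMap (chartMetric g q₀.proj) (extChartAt (IM n) q₀.proj p.proj)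
        (chartDeriv (IM n) q₀.proj p.proj a) (chartDeriv (IM n) q₀.proj p.proj b) := fun a b => by
    have := christoffelVec_coordChange g hp a b
    rw [← hθ] at this
    rw [this]; abel
  have gen : ∀ (x V R u v r : En n) (A : En n →L[ℝ] En n) (B : En n →L[ℝ] En n →L[ℝ] En n),
      HasFDerivAt θ A x → HasFDerivAt (fderiv ℝ θ) B x → fderiv ℝ θ x = A →
      fderiv ℝ (fun y : En n × En n × En n =>
        (θ y.1, (fderiv ℝ θ y.1 y.2.1, fderiv ℝ θ y.1 y.2.2))) (x, (V, R)) (u, (v, r)) =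
      (A u, (A v + B u V, A r + B u R)) := by
    intro x V R u v r A B hA hB hAB
    have e1 : HasFDerivAt (fun y : En n × En n × En n => y.1) (ContinuousLinearMap.fst ℝ _ _)
      (x, (V, R)) := hasFDerivAt_fst
    have e2 : HasFDerivAt (fun y : En n × En n × En n => y.2.1)
      ((ContinuousLinearMap.fst ℝ _ _).comp (ContinuousLinearMap.snd ℝ _ _))
      (x, (V, R)) := hasFDerivAt_fst.comp _ hasFDerivAt_snd
    have e3 : HasFDerivAt (fun y : En n × En n × En n => y.2.2)
      ((ContinuousLinearMap.snd ℝ _ _).comp (ContinuousLinearMap.snd ℝ _ _))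
      (x, (V, R)) := hasFDerivAt_snd.comp _ hasFDerivAt_snd
    have hA' : HasFDerivAt (fun y : En n × En n × En n => θ y.1) _ (x, (V, R)) :=
      HasFDerivAt.comp (x, (V, R)) (g := θ) hA e1
    have hB' : HasFDerivAt (fun y : En n × En n × En n => fderiv ℝ θ y.1) _ (x, (V, R)) :=
      HasFDerivAt.comp (x, (V, R)) (g := fderiv ℝ θ) hB e1
    rw [(hA'.prodMk ((hB'.clm_apply e2).prodMk (hB'.clm_apply e3))).fderiv]
    simp [hAB]
  refine (gen _ _ _ u v r _ _ hd1 hd2 rfl).trans ?_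
  have h2 := connV_apply g p u v r
  have h3 := connR_apply g p u v r
  have h2' := (congrArg (chartDeriv (IM n) q₀.proj p.proj) h2).trans (map_add _ _ _)
  have h3' := (congrArg (chartDeriv (IM n) q₀.proj p.proj) h3).trans (map_add _ _ _)
  refine Prod.ext (hD u) (Prod.ext ?_ ?_)
  · change _ = chartDeriv (IM n) q₀.proj p.proj (connV g p _) - _
    refine (congrArg₂ (· + ·) (hD v) (hΓ u p.2.1)).trans ?_
    refine Eq.trans ?_ (congrArg (· - _) h2'.symm)
    rw [add_sub_assoc]; rfl
  · change _ = chartDeriv (IM n) q₀.proj p.proj (connR g p _) - _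
    refine (congrArg₂ (· + ·) (hD r) (hΓ u p.2.2)).trans ?_
    refine Eq.trans ?_ (congrArg (· - _) h3'.symm)
    rw [add_sub_assoc]; rfl

end TotalSpaceCharts

/-! ### Velocities of curves in `TM ⊕ TM` -/

section Velocity

variable {n : ℕ} {M : Type*} [TopologicalSpace M] [ChartedSpace (En n) M]
  [IsManifold (IM n) ∞ M]

lemma IsSmoothCurve.proj {σ : ℝ → TT n M} {s : Set ℝ} (hσ : IsSmoothCurve (ITT n) σ s) :
    IsSmoothCurve (IM n) (fun τ => (σ τ).proj) s :=
  (Bundle.contMDiff_proj _).comp_contMDiffOn hσ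

/-- The components of the velocity of a curve in `TM ⊕ TM`, in the chart at its position. -/
lemma velocity_TT {σ : ℝ → TT n M} {s : Set ℝ} {t : ℝ} (hs : UniqueDiffWithinAt ℝ s t)
    (hσ : MDifferentiableWithinAt 𝓘(ℝ, ℝ) (ITT n) σ s t) :
    velocity (ITT n) σ s t = (((velocity (IM n) (fun τ => (σ τ).proj) s t : En n),
      ((coordDeriv (fun τ => (σ τ).proj) (fun τ => (σ τ).2.1) s t : En n),
      (coordDeriv (fun τ => (σ τ).proj) (fun τ => (σ τ).2.2) s t : En n))) :
        En n × En n × En n) := by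
  have h := hasDerivWithinAt_extChartAt_comp hσ
    (mem_chart_source (ModelProd (En n) (En n × En n)) (σ t))
  rw [chartDeriv_self] at h
  have hnear : ∀ᶠ τ in 𝓝[insert t s] t, (σ τ).proj ∈ (chartAt (En n) (σ t).proj).source := by
    have h1 : ContinuousWithinAt σ (insert t s) t :=
      hσ.continuousWithinAt.insert
    filter_upwards [h1.eventually (chart_source_mem_nhds (ModelProd (En n) (En n × En n)) (σ t))] with τ hτ
    exact mem_chart_source_TT.1 hτ
  have h2 : HasDerivWithinAt (fun τ => ((extChartAt (IM n) (σ t).proj (σ τ).proj,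
      ((trivializationAt (En n) (fun x : M => TangentSpace (IM n) x) (σ t).proj
        ⟨(σ τ).proj, (σ τ).2.1⟩).2,
      (trivializationAt (En n) (fun x : M => TangentSpace (IM n) x) (σ t).proj
        ⟨(σ τ).proj, (σ τ).2.2⟩).2)) : En n × En n × En n))
      (velocity (ITT n) σ s t : En n × En n × En n) s t := by
    refine h.congr_of_eventuallyEq ?_ ?_
    · filter_upwards [nhdsWithin_mono t (subset_insert t s) hnear] with τ hτ
      rw [extChartAt_TT hτ, ← chartDeriv_eq_trivializationAt hτ,
        ← chartDeriv_eq_trivializationAt hτ]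
    · rw [extChartAt_TT (mem_chart_source _ _), ← chartDeriv_eq_trivializationAt
        (mem_chart_source _ _), ← chartDeriv_eq_trivializationAt (mem_chart_source _ _)]
  have hp : MDifferentiableWithinAt 𝓘(ℝ, ℝ) (IM n) (fun τ => (σ τ).proj) s t :=
    ((Bundle.contMDiff_proj _ (n := 1)).mdifferentiable (by simp) (σ t)).comp_mdifferentiableWithinAt t hσ
  have h3 := hasDerivWithinAt_extChartAt_comp hp (mem_chart_source _ (σ t).proj)
  rw [chartDeriv_self] at h3
  have gen : ∀ (f : ℝ → En n × En n × En n) (w : En n × En n × En n), HasDerivWithinAt f w s t →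
      HasDerivWithinAt (fun τ => (f τ).1) w.1 s t ∧ HasDerivWithinAt (fun τ => (f τ).2.1) w.2.1 s t ∧
        HasDerivWithinAt (fun τ => (f τ).2.2) w.2.2 s t := by
    intro f w hf
    have e1 := hf.hasFDerivWithinAt.fst.hasDerivWithinAt
    have e2 := hf.hasFDerivWithinAt.snd.fst.hasDerivWithinAt
    have e3 := hf.hasFDerivWithinAt.snd.snd.hasDerivWithinAt
    simp only [ContinuousLinearMap.comp_apply, ContinuousLinearMap.toSpanSingleton_apply_one,
      ContinuousLinearMap.coe_fst', ContinuousLinearMap.coe_snd'] at e1 e2 e3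
    exact ⟨e1, e2, e3⟩
  obtain ⟨hd1, hd2, hd3⟩ := gen _ _ h2
  exact Prod.ext (hs.eq_deriv _ hd1 h3)
    (Prod.ext (hd2.derivWithin hs).symm (hd3.derivWithin hs).symm)

variable (g : ContMDiffRiemannianMetric (IM n) ∞ (En n) (fun x : M => TangentSpace (IM n) x))

lemma baseMap_velocity {σ : ℝ → TT n M} {s : Set ℝ} {t : ℝ} (hs : UniqueDiffWithinAt ℝ s t)
    (hσ : MDifferentiableWithinAt 𝓘(ℝ, ℝ) (ITT n) σ s t) :
    baseMap n (σ t) (velocity (ITT n) σ s t) =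
    velocity (IM n) (fun τ => (σ τ).proj) s t := by
  rw [velocity_TT hs hσ]; rfl

lemma connV_velocity {σ : ℝ → TT n M} {s : Set ℝ} {t : ℝ} (hs : UniqueDiffWithinAt ℝ s t)
    (hσ : MDifferentiableWithinAt 𝓘(ℝ, ℝ) (ITT n) σ s t) :
    connV g (σ t) (velocity (ITT n) σ s t) =
    covDeriv g (fun τ => (σ τ).proj) (fun τ => (σ τ).2.1) s t := by
  rw [velocity_TT hs hσ]
  exact connV_apply g (σ t) _ _ _

lemma connR_velocity {σ : ℝ → TT n M} {s : Set ℝ} {t : ℝ} (hs : UniqueDiffWithinAt ℝ s t)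
    (hσ : MDifferentiableWithinAt 𝓘(ℝ, ℝ) (ITT n) σ s t) :
    connR g (σ t) (velocity (ITT n) σ s t) =
    covDeriv g (fun τ => (σ τ).proj) (fun τ => (σ τ).2.2) s t := by
  rw [velocity_TT hs hσ]
  exact connR_apply g (σ t) _ _ _

lemma christoffelVec_zero_left (x : M) (w : TangentSpace (IM n) x) :
    christoffelVec g x 0 w = 0 := by
  rw [christoffelVec_eq]
  exact congrArg (fun L : En n →L[ℝ] En n => L w) (map_zero (christoffelMap (chartMetric g x)
    (extChartAt (IM n) x x)))

/-- Where the base point is stationary, the covariant derivative is the derivative in the fibre. -/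
lemma covDeriv_eq_coordDeriv {c : ℝ → M} {s : Set ℝ} {t : ℝ} (h : velocity (IM n) c s t = 0)
    (X : ∀ t, TangentSpace (IM n) (c t)) : covDeriv g c X s t = coordDeriv c X s t := by
  rw [covDeriv, h, christoffelVec_zero_left, add_zero]

end Velocity

/-! ### The equations of the manifold of curvature radii -/

section LevelMap

variable {n : ℕ} {M : Type*} [TopologicalSpace M] [ChartedSpace (En n) M]
  [IsManifold (IM n) ∞ M]
  (g : ContMDiffRiemannianMetric (IM n) ∞ (En n) (fun x : M => TangentSpace (IM n) x))

lemma chartMetric_self (x : M) (v w : TangentSpace (IM n) x) :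
    chartMetric g x (extChartAt (IM n) x x) (v : En n) (w : En n) = g.inner x v w := by
  have h := chartMetric_chartDeriv g (mem_chart_source (En n) x) v w
  rwa [chartDeriv_self, chartDeriv_self] at h

lemma contDiffAt_chartMetric_pairing {x₀ : M} {y : En n × En n × En n}
    (hy : y.1 ∈ (extChartAt (IM n) x₀).target) (A B : En n × En n × En n →L[ℝ] En n) :
    ContDiffAt ℝ ∞ (fun z => chartMetric g x₀ z.1 (A z) (B z)) y := by
  have h1 : ContDiffAt ℝ ∞ (chartMetric g x₀) y.1 := (contDiffOn_chartMetric g x₀).contDiffAt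
    ((isOpen_extChartAt_target x₀).mem_nhds hy)
  have h2 : ContDiffAt ℝ ∞ (fun z : En n × En n × En n => chartMetric g x₀ z.1) y :=
    h1.comp y contDiffAt_fst
  exact (h2.clm_apply A.contDiff.contDiffAt).clm_apply B.contDiff.contDiffAt

/-- The Levi-Civita connection is metric: the derivative of a scalar product in terms of covariant
derivatives. -/
lemma fderiv_chartMetric_pairing {x₀ : M} {y : En n × En n × En n}
    (hy : y.1 ∈ (extChartAt (IM n) x₀).target) (A B : En n × En n × En n →L[ℝ] En n)
    (w : En n × En n × En n) :
    fderiv ℝ (fun z => chartMetric g x₀ z.1 (A z) (B z)) y w =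
      chartMetric g x₀ y.1 (A w + christoffelMap (chartMetric g x₀) y.1 w.1 (A y)) (B y) +
      chartMetric g x₀ y.1 (A y) (B w + christoffelMap (chartMetric g x₀) y.1 w.1 (B y)) := by
  have hnb := (isOpen_extChartAt_target (I := IM n) x₀).mem_nhds hy
  have hd : DifferentiableAt ℝ (chartMetric g x₀) y.1 :=
    ((contDiffOn_chartMetric g x₀).contDiffAt hnb).differentiableAt (by simp)
  have h2 : HasFDerivAt (fun z : En n × En n × En n => chartMetric g x₀ z.1) _ y :=
    HasFDerivAt.comp y (g := chartMetric g x₀) hd.hasFDerivAt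
      (hasFDerivAt_fst (𝕜 := ℝ) (E := En n) (F := En n × En n) (p := y))
  rw [((h2.clm_apply A.hasFDerivAt).clm_apply B.hasFDerivAt).fderiv]
  have h3 := christoffelMap_metric hd
    (by filter_upwards [hnb] with z hz using isInnerForm_chartMetric g hz) w.1 (A y) (B y)
  simp only [add_apply, ContinuousLinearMap.comp_apply, ContinuousLinearMap.flip_apply, map_add,
    ContinuousLinearMap.coe_fst', h3]
  ring

/-- A function on `TM ⊕ TM` that is, in all charts, the scalar product of two linear functions of
the fibre. -/
lemma pairing_contMDiff_and_mfderiv {f : TT n M → ℝ} (A B : En n × En n × En n →L[ℝ] En n)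
    (hf : ∀ q p : TT n M, p.proj ∈ (chartAt (En n) q.proj).source →
      f p = chartMetric g q.proj (extChartAt (ITT n) q p).1 (A (extChartAt (ITT n) q p))
        (B (extChartAt (ITT n) q p))) :
    ContMDiff (ITT n) 𝓘(ℝ, ℝ) ∞ f ∧ ∀ (q : TT n M) (w : TangentSpace (ITT n) q),
      mfderiv (ITT n) 𝓘(ℝ, ℝ) f q w =
        fderiv ℝ (fun z : En n × En n × En n => chartMetric g q.proj z.1 (A z) (B z))
          (extChartAt (ITT n) q q) (w : En n × En n × En n) := by
  have hsm : ContMDiff (ITT n) 𝓘(ℝ, ℝ) ∞ f := by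
    intro q
    have hy : (extChartAt (ITT n) q q).1 ∈ (extChartAt (IM n) q.proj).target := by
      rw [extChartAt_TT_self]; exact mem_extChartAt_target _
    have h1 : ContMDiffAt (ITT n) 𝓘(ℝ, ℝ) ∞ ((fun z : En n × En n × En n =>
        chartMetric g q.proj z.1 (A z) (B z)) ∘ extChartAt (ITT n) q) q :=
      (contDiffAt_chartMetric_pairing g hy A B).contMDiffAt.comp q contMDiffAt_extChartAt
    refine h1.congr_of_eventuallyEq ?_
    filter_upwards [chart_source_mem_nhds (ModelProd (En n) (En n × En n)) q] with p hp
    exact hf q p (mem_chart_source_TT.1 hp)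
  refine ⟨hsm, fun q w => ?_⟩
  rw [← fderiv_comp_extChartAt_symm_self isOpen_univ hsm.contMDiffOn (mem_univ q) w]
  refine congrArg (fun L : En n × En n × En n →L[ℝ] ℝ => L w) (Filter.EventuallyEq.fderiv_eq ?_)
  filter_upwards [extChartAt_target_mem_nhds (I := ITT n) q] with y hy
  have hs : (extChartAt (ITT n) q).symm y ∈ (chartAt (ModelProd (En n) (En n × En n)) q).source := by
    rw [← extChartAt_source (ITT n)]; exact (extChartAt (ITT n) q).map_target hy
  rw [hf q _ (mem_chart_source_TT.1 hs), (extChartAt (ITT n) q).right_inv hy]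

/-- The coordinates of the two fibre components of `TM ⊕ TM` in a chart. -/
def modelV (n : ℕ) : En n × En n × En n →L[ℝ] En n :=
  (ContinuousLinearMap.fst ℝ (En n) (En n)).comp (ContinuousLinearMap.snd ℝ (En n) (En n × En n))

/-- See `modelV`. -/
def modelR (n : ℕ) : En n × En n × En n →L[ℝ] En n :=
  (ContinuousLinearMap.snd ℝ (En n) (En n)).comp (ContinuousLinearMap.snd ℝ (En n) (En n × En n))

lemma inner_VV_contMDiff_and_mfderiv :
    ContMDiff (ITT n) 𝓘(ℝ, ℝ) ∞ (fun q : TT n M => g.inner q.proj q.2.1 q.2.1) ∧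
    ∀ (q : TT n M) (w : TangentSpace (ITT n) q),
      mfderiv (ITT n) 𝓘(ℝ, ℝ) (fun q : TT n M => g.inner q.proj q.2.1 q.2.1) q w =
        2 * g.inner q.proj (connV g q w) q.2.1 := by
  have h := pairing_contMDiff_and_mfderiv g (f := fun q : TT n M => g.inner q.proj q.2.1 q.2.1)
    (modelV n) (modelV n) (fun q p hp => by
      rw [extChartAt_TT hp]
      exact (chartMetric_chartDeriv g hp _ _).symm)
  refine ⟨h.1, fun q w => (h.2 q w).trans ?_⟩
  rw [extChartAt_TT_self]
  refine (fderiv_chartMetric_pairing g (mem_extChartAt_target q.proj) _ _ _).trans ?_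
  have e1 := chartMetric_self g q.proj (connV g q w) q.2.1
  have e2 := chartMetric_self g q.proj q.2.1 (connV g q w)
  rw [g.symm] at e2
  exact (congrArg₂ (· + ·) e1 e2).trans (two_mul _).symm

lemma inner_RR_contMDiff_and_mfderiv :
    ContMDiff (ITT n) 𝓘(ℝ, ℝ) ∞ (fun q : TT n M => g.inner q.proj q.2.2 q.2.2) ∧
    ∀ (q : TT n M) (w : TangentSpace (ITT n) q),
      mfderiv (ITT n) 𝓘(ℝ, ℝ) (fun q : TT n M => g.inner q.proj q.2.2 q.2.2) q w =
        2 * g.inner q.proj (connR g q w) q.2.2 := by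
  have h := pairing_contMDiff_and_mfderiv g (f := fun q : TT n M => g.inner q.proj q.2.2 q.2.2)
    (modelR n) (modelR n) (fun q p hp => by
      rw [extChartAt_TT hp]
      exact (chartMetric_chartDeriv g hp _ _).symm)
  refine ⟨h.1, fun q w => (h.2 q w).trans ?_⟩
  rw [extChartAt_TT_self]
  refine (fderiv_chartMetric_pairing g (mem_extChartAt_target q.proj) _ _ _).trans ?_
  have e1 := chartMetric_self g q.proj (connR g q w) q.2.2
  have e2 := chartMetric_self g q.proj q.2.2 (connR g q w)
  rw [g.symm] at e2
  exact (congrArg₂ (· + ·) e1 e2).trans (two_mul _).symm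

lemma inner_RV_contMDiff_and_mfderiv :
    ContMDiff (ITT n) 𝓘(ℝ, ℝ) ∞ (fun q : TT n M => g.inner q.proj q.2.2 q.2.1) ∧
    ∀ (q : TT n M) (w : TangentSpace (ITT n) q),
      mfderiv (ITT n) 𝓘(ℝ, ℝ) (fun q : TT n M => g.inner q.proj q.2.2 q.2.1) q w =
        g.inner q.proj (connR g q w) q.2.1 + g.inner q.proj (connV g q w) q.2.2 := by
  have h := pairing_contMDiff_and_mfderiv g (f := fun q : TT n M => g.inner q.proj q.2.2 q.2.1)
    (modelR n) (modelV n) (fun q p hp => by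
      rw [extChartAt_TT hp]
      exact (chartMetric_chartDeriv g hp _ _).symm)
  refine ⟨h.1, fun q w => (h.2 q w).trans ?_⟩
  rw [extChartAt_TT_self]
  refine (fderiv_chartMetric_pairing g (mem_extChartAt_target q.proj) _ _ _).trans ?_
  have e1 := chartMetric_self g q.proj (connR g q w) q.2.1
  have e2 := chartMetric_self g q.proj q.2.2 (connV g q w)
  rw [g.symm] at e2
  exact congrArg₂ (· + ·) e1 e2

/-- The map whose zero set, away from the zero section, is the manifold of curvature radii. -/
def levelMap (q : TT n M) : ℝ × ℝ :=
  (g.inner q.proj q.2.2 q.2.1, g.inner q.proj q.2.2 q.2.2 - g.inner q.proj q.2.1 q.2.1)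

lemma contMDiff_levelMap : ContMDiff (ITT n) 𝓘(ℝ, ℝ × ℝ) ∞ (levelMap g (M := M)) :=
  (inner_RV_contMDiff_and_mfderiv g).1.prodMk_space
    ((inner_RR_contMDiff_and_mfderiv g).1.sub (inner_VV_contMDiff_and_mfderiv g).1)

lemma mfderiv_levelMap (q : TT n M) (w : TangentSpace (ITT n) q) :
    mfderiv (ITT n) 𝓘(ℝ, ℝ × ℝ) (levelMap g) q w =
      ((g.inner q.proj (connR g q w) q.2.1 + g.inner q.proj (connV g q w) q.2.2,
      2 * g.inner q.proj (connR g q w) q.2.2 - 2 * g.inner q.proj (connV g q w) q.2.1) :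
        ℝ × ℝ) := by
  have h1 := ((inner_RV_contMDiff_and_mfderiv g).1.mdifferentiable (by simp) q).hasMFDerivAt
  have h2 := ((inner_RR_contMDiff_and_mfderiv g).1.mdifferentiable (by simp) q).hasMFDerivAt
  have h3 := ((inner_VV_contMDiff_and_mfderiv g).1.mdifferentiable (by simp) q).hasMFDerivAt
  have h23 := h2.sub h3
  have h123 : HasMFDerivAt (ITT n) 𝓘(ℝ, ℝ × ℝ) (levelMap g) q _ :=
    ⟨h1.1.prodMk h23.1, h1.2.prodMk h23.2⟩
  have h := h123.mfderiv
  have e1 := (inner_RV_contMDiff_and_mfderiv g).2 q w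
  have e2 := (inner_RR_contMDiff_and_mfderiv g).2 q w
  have e3 := (inner_VV_contMDiff_and_mfderiv g).2 q w
  have gen : ∀ (z : ℝ × ℝ) (a b c a' b' c' : ℝ), z = (a, b - c) → a = a' → b = b' → c = c' →
      z = (a', b' - c') := by
    rintro _ a b c _ _ _ rfl rfl rfl rfl; rfl
  exact gen _ _ _ _ _ _ _ (DFunLike.congr_fun h w) e1 e2 e3

/-- The complement of `{V = 0}`, where the equations of the manifold of curvature radii hold. -/
def regularSet : Set (TT n M) := {q | 0 < g.inner q.proj q.2.1 q.2.1}

lemma isOpen_regularSet : IsOpen (regularSet g (M := M)) :=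
  isOpen_lt continuous_const (inner_VV_contMDiff_and_mfderiv g).1.continuous

lemma inner_self_nonneg (x : M) (v : TangentSpace (IM n) x) : 0 ≤ g.inner x v v := by
  by_cases h : v = 0
  · rw [h, map_zero]
  · exact (g.pos x v h).le

lemma gnorm_sq {x : M} (v : TangentSpace (IM n) x) : gnorm g v ^ 2 = g.inner x v v :=
  Real.sq_sqrt (inner_self_nonneg g x v)

lemma gnorm_nonneg {x : M} (v : TangentSpace (IM n) x) : 0 ≤ gnorm g v := Real.sqrt_nonneg _

lemma gnorm_pos {x : M} {v : TangentSpace (IM n) x} : 0 < gnorm g v ↔ v ≠ 0 := by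
  rw [gnorm, Real.sqrt_pos]
  refine ⟨?_, g.pos x v⟩
  rintro h rfl
  rw [map_zero] at h
  exact lt_irrefl _ h

lemma mem_curvatureRadiiSet_iff (q : TT n M) :
    q ∈ curvatureRadiiSet g ↔ g.inner q.proj q.2.2 q.2.1 = 0 ∧
      g.inner q.proj q.2.2 q.2.2 = g.inner q.proj q.2.1 q.2.1 ∧
      0 < g.inner q.proj q.2.1 q.2.1 := by
  refine and_congr Iff.rfl (and_congr ?_ Real.sqrt_pos)
  exact Real.sqrt_inj (inner_self_nonneg g _ _) (inner_self_nonneg g _ _)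

lemma levelMap_eq_zero {q : TT n M} (hq : q ∈ curvatureRadiiSet g) : levelMap g q = 0 := by
  obtain ⟨h1, h2, -⟩ := (mem_curvatureRadiiSet_iff g q).1 hq
  rw [levelMap, h1, h2, sub_self]; rfl

lemma mem_regularSet {q : TT n M} (hq : q ∈ curvatureRadiiSet g) : q ∈ regularSet g :=
  ((mem_curvatureRadiiSet_iff g q).1 hq).2.2

lemma mem_curvatureRadiiSet_iff_levelMap {q p : TT n M} (hq : q ∈ curvatureRadiiSet g)
    (hp : p ∈ regularSet g) : p ∈ curvatureRadiiSet g ↔ levelMap g p = levelMap g q := by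
  rw [levelMap_eq_zero g hq, mem_curvatureRadiiSet_iff, levelMap, Prod.mk_eq_zero, sub_eq_zero]
  exact ⟨fun h => ⟨h.1, h.2.1⟩, fun h => ⟨h.1, h.2, hp⟩⟩

lemma mfderiv_levelMap_surjective {q : TT n M} (hq : q ∈ curvatureRadiiSet g) :
    Function.Surjective (mfderiv (ITT n) 𝓘(ℝ, ℝ × ℝ) (levelMap g) q) := by
  obtain ⟨h1, h2, h3⟩ := (mem_curvatureRadiiSet_iff g q).1 hq
  rintro ⟨a, b⟩
  have h1' := h1
  rw [g.symm] at h1'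
  refine ⟨liftVec g q 0 0 ((a / g.inner q.proj q.2.1 q.2.1) • q.2.1 +
    (b / 2 / g.inner q.proj q.2.1 q.2.1) • q.2.2), ?_⟩
  rw [mfderiv_levelMap, connR_liftVec, connV_liftVec]
  simp only [map_add, map_smul, add_apply, smul_apply, smul_eq_mul, h1, h1', h2, map_zero,
    zero_apply]
  refine Prod.ext ?_ ?_
  · change _ = a
    field_simp
    ring
  · change _ = b
    field_simp
    ring

/-- The equations of the tangent space of the manifold of curvature radii. -/
lemma mem_tangentSet_curvatureRadiiSet {q : TT n M} (hq : q ∈ curvatureRadiiSet g)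
    (w : TangentSpace (ITT n) q) : w ∈ tangentSet (ITT n) (curvatureRadiiSet g) q ↔
      g.inner q.proj (connR g q w) q.2.1 + g.inner q.proj (connV g q w) q.2.2 = 0 ∧
      g.inner q.proj (connR g q w) q.2.2 = g.inner q.proj (connV g q w) q.2.1 := by
  rw [mem_tangentSet_iff (isOpen_regularSet g) (contMDiff_levelMap g).contMDiffOn
    (mem_regularSet g hq) hq (mfderiv_levelMap_surjective g hq)
    (fun p hp => mem_curvatureRadiiSet_iff_levelMap g hq hp), mfderiv_levelMap]
  refine Prod.mk_eq_zero.trans (and_congr Iff.rfl ?_)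
  constructor
  · intro h; linarith
  · intro h; linarith

lemma isEmbeddedSubmanifold_curvatureRadiiSet (hn : 2 ≤ n) :
    IsEmbeddedSubmanifold (ITT n) (curvatureRadiiSet g (M := M)) (3 * n - 2) := by
  refine isEmbeddedSubmanifold_of_levelSet (K := ℝ × ℝ) ?_ fun q hq =>
    ⟨regularSet g, levelMap g, isOpen_regularSet g, mem_regularSet g hq,
      (contMDiff_levelMap g).contMDiffOn, mfderiv_levelMap_surjective g hq,
      fun p hp => mem_curvatureRadiiSet_iff_levelMap g hq hp⟩
  simp only [Module.finrank_prod, Module.finrank_self, finrank_euclideanSpace, Fintype.card_fin]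
  omega

end LevelMap

/-! ### Lie brackets of fields tangent to a level set -/

section BracketLevelSet

variable {F : Type*} [NormedAddCommGroup F] [NormedSpace ℝ F]
  {H : Type*} [TopologicalSpace H] {J : ModelWithCorners ℝ F H}
  {N : Type*} [TopologicalSpace N] [ChartedSpace H N] [IsManifold J ∞ N]

lemma IsSmoothFieldOn.mlieBracket {X Y : ∀ p : N, TangentSpace J p} {W : Set N}
    [FiniteDimensional ℝ F] (hX : IsSmoothFieldOn J X W) (hY : IsSmoothFieldOn J Y W) (hW : IsOpen W) :
    IsSmoothFieldOn J (VectorField.mlieBracket J X Y) W := by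
  have : CompleteSpace F := FiniteDimensional.complete ℝ F
  have : IsManifold J (((⊤ : ℕ∞) : WithTop ℕ∞) + 1) N := ‹IsManifold J ∞ N›
  have : IsManifold J (minSmoothness ℝ 2) N :=
    IsManifold.of_le (n := ∞) (by simpa using ENat.LEInfty.out)
  intro p hp
  exact (ContMDiffAt.mlieBracket_vectorField (m := ⊤) (n := ⊤) (hX.contMDiffAt (hW.mem_nhds hp))
    (hY.contMDiffAt (hW.mem_nhds hp)) (by simp)).contMDiffWithinAt

variable [J.Boundaryless]

lemma IsSmoothFieldOn.differentiableAt_coordField {X : ∀ p : N, TangentSpace J p} {W : Set N}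
    (hX : IsSmoothFieldOn J X W) (hW : IsOpen W) {q : N} (hq : q ∈ W) :
    DifferentiableAt ℝ (coordField J q X) (extChartAt J q q) :=
  ((contDiffOn_coordField q hW hX).contDiffAt ((isOpen_extChartAt_symm_preimage q hW).mem_nhds
    (extChartAt_mem_target_inter hq))).differentiableAt (by simp)

variable [FiniteDimensional ℝ F]

/-- The bracket of two fields tangent to the level sets of a submersion is tangent to them: this is
the symmetry of the second derivative. -/
lemma mfderiv_mlieBracket_eq_zero {K : Type*} [NormedAddCommGroup K] [NormedSpace ℝ K]
    [FiniteDimensional ℝ K] {Φ : N → K} {O : Set N} (hO : IsOpen O)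
    (hΦ : ContMDiffOn J 𝓘(ℝ, K) ∞ Φ O) {q : N} (hq : q ∈ O)
    (hsurj : Function.Surjective (mfderiv J 𝓘(ℝ, K) Φ q)) {X Y : ∀ p : N, TangentSpace J p}
    (hX : IsSmoothFieldOn J X O) (hY : IsSmoothFieldOn J Y O)
    (hXt : ∀ p ∈ O, Φ p = Φ q → mfderiv J 𝓘(ℝ, K) Φ p (X p) = 0)
    (hYt : ∀ p ∈ O, Φ p = Φ q → mfderiv J 𝓘(ℝ, K) Φ p (Y p) = 0) :
    mfderiv J 𝓘(ℝ, K) Φ q (VectorField.mlieBracket J X Y q) = 0 := by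
  set h : F → K := fun y => Φ ((extChartAt J q).symm y) with hh
  set y₀ := extChartAt J q q
  have hsm : ContDiffAt ℝ ∞ h y₀ := (contDiffOn_comp_extChartAt_symm hΦ q).contDiffAt
    ((isOpen_extChartAt_symm_preimage q hO).mem_nhds (extChartAt_mem_target_inter hq))
  have hd2 : DifferentiableAt ℝ (fderiv ℝ h) y₀ :=
    (hsm.fderiv_right (m := ∞) (by simp)).differentiableAt (by simp)
  have hself : ∀ Z : ∀ p : N, TangentSpace J p, coordField J q Z y₀ = Z q := fun Z => by
    rw [coordField_extChartAt (mem_chart_source H q), chartDeriv_self]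
  have main : ∀ Y : ∀ p : N, TangentSpace J p, IsSmoothFieldOn J Y O →
      (∀ p ∈ O, Φ p = Φ q → mfderiv J 𝓘(ℝ, K) Φ p (Y p) = 0) → ∀ w : TangentSpace J q,
      mfderiv J 𝓘(ℝ, K) Φ q w = 0 →
      fderiv ℝ h y₀ (fderiv ℝ (coordField J q Y) y₀ w) = - fderiv ℝ (fderiv ℝ h) y₀ w (Y q) := by
    intro Y hY hYt w hw
    have hdY := hY.differentiableAt_coordField hO hq
    have h1 := fderiv_eq_of_eqOn_level hO hΦ hq hsurj hw
      (a := fun y => fderiv ℝ h y (coordField J q Y y)) (b := fun _ => (0 : K))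
      (hd2.clm_apply hdY) (differentiableAt_const _) (fun p hp hps hpq => by
        rw [coordField_extChartAt hps]
        exact (fderiv_comp_extChartAt_symm hps ((hΦ.contMDiffAt
          (hO.mem_nhds hp)).mdifferentiableAt (by simp)) (Y p)).trans (hYt p hp hpq))
    have h2 : fderiv ℝ (fun y => fderiv ℝ h y (coordField J q Y y)) y₀ (w : F) =
        fderiv ℝ h y₀ (fderiv ℝ (coordField J q Y) y₀ w) +
          fderiv ℝ (fderiv ℝ h) y₀ w (coordField J q Y y₀) := by
      rw [(hd2.hasFDerivAt.clm_apply hdY.hasFDerivAt).fderiv]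
      rfl
    have h3 : fderiv ℝ (fun _ : F => (0 : K)) y₀ (w : F) = 0 := by
      rw [fderiv_const_apply]; rfl
    rw [hself] at h2
    exact eq_neg_of_add_eq_zero_left (h2.symm.trans (h1.trans h3))
  have e1 := main Y hY hYt (X q) (hXt q hq rfl)
  have e2 := main X hX hXt (Y q) (hYt q hq rfl)
  have hsymm : IsSymmSndFDerivAt ℝ h y₀ := hsm.isSymmSndFDerivAt
    (by simpa using ENat.LEInfty.out)
  rw [← fderiv_comp_extChartAt_symm_self hO hΦ hq]
  refine (congrArg (fderiv ℝ h y₀) (mlieBracket_eq_coordField X Y q)).trans ?_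
  rw [map_sub, e1, e2, hsymm.eq (X q : F) (Y q : F), sub_self]
  rfl

end BracketLevelSet

/-! ### Brackets on the manifold of curvature radii -/

section BracketAlgebra

variable {E : Type*} [NormedAddCommGroup E] [NormedSpace ℝ E]

/-- The computation behind `baseMap_br`: `a` and `b` are derivatives of the coordinates of one field
in the direction of the other, `x` and `y` the coordinates of the fields. -/
lemma bracket_base_algebra {a b x y : E × E × E} {V kX kY : E} {dX dY l m : ℝ}
    (Γ : E →L[ℝ] E →L[ℝ] E) (ha : a.1 = dY • V + m • x.2.1) (hb : b.1 = dX • V + l • y.2.1)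
    (hkX : kX = x.2.1 + Γ x.1 V) (hkY : kY = y.2.1 + Γ y.1 V) (hx : x.1 = l • V)
    (hy : y.1 = m • V) : (a - b).1 = (dY - dX) • V + m • kX - l • kY := by
  rw [Prod.fst_sub, ha, hb, hkX, hkY, hx, hy]
  simp only [map_smul, smul_apply]
  module

/-- The computation behind `connV_br`, with `D` the coordinates of the bracket; `d` is the derivative
of the Christoffel map, evaluated at `V` in both arguments. -/
lemma bracket_connector_algebra {D a b x y : E × E × E} {V R kX kY rX rY : E} {lX lY bX bY : ℝ}
    (Γ : E →L[ℝ] E →L[ℝ] E) (d : E → E)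
    (hd : ∀ c : ℝ, d (c • V) = c • d V) (hD : D = a - b)
    (ha : a.2.1 = lY • x.2.2 + bY • x.2.1 - lY • (d x.1 + Γ x.2.1 V + Γ V x.2.1))
    (hb : b.2.1 = lX • y.2.2 + bX • y.2.1 - lX • (d y.1 + Γ y.2.1 V + Γ V y.2.1))
    (hD1 : D.1 = lY • kX - lX • kY)
    (h1 : kX = x.2.1 + Γ x.1 V) (h2 : kY = y.2.1 + Γ y.1 V) (h3 : rX = x.2.2 + Γ x.1 R)
    (h4 : rY = y.2.2 + Γ y.1 R) (hx : x.1 = lX • V) (hy : y.1 = lY • V)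
    (hkX : kX = lX • R + bX • V) (hkY : kY = lY • R + bY • V) :
    D.2.1 + Γ D.1 V = lY • rX - lX • rY + (bY • kX - bX • kY) := by
  have h1' := eq_sub_of_add_eq h1.symm
  have h2' := eq_sub_of_add_eq h2.symm
  have h3' := eq_sub_of_add_eq h3.symm
  have h4' := eq_sub_of_add_eq h4.symm
  rw [hD1, hD, Prod.snd_sub, Prod.fst_sub, ha, hb, h3', h4', h1', h2', hx, hy, hkX, hkY, hd, hd]
  simp only [map_smul, map_add, map_sub, smul_apply, add_apply, sub_apply]
  module

end BracketAlgebra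

section Brackets

variable {n : ℕ} {M : Type*} [TopologicalSpace M] [ChartedSpace (En n) M]
  [IsManifold (IM n) ∞ M]
  (g : ContMDiffRiemannianMetric (IM n) ∞ (En n) (fun x : M => TangentSpace (IM n) x))

/-- The derivative of a scalar function on `TM ⊕ TM` in the direction `w`. -/
def scalarDeriv (l : TT n M → ℝ) (q : TT n M) (w : TangentSpace (ITT n) q) : ℝ :=
  mfderiv (ITT n) 𝓘(ℝ, ℝ) l q w

/-- A smooth field on the open set `W` that is tangent to the manifold of curvature radii. -/
structure IsTangentField (W : Set (TT n M)) (X : ∀ q : TT n M, TangentSpace (ITT n) q) : Prop where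
  isOpen : IsOpen W
  smooth : IsSmoothFieldOn (ITT n) X W
  tangent : ∀ p ∈ W ∩ curvatureRadiiSet g, X p ∈ tangentSet (ITT n) (curvatureRadiiSet g) p

variable {g}

lemma mem_tangentSet_iff_mfderiv {q : TT n M} (hq : q ∈ curvatureRadiiSet g)
    (w : TangentSpace (ITT n) q) : w ∈ tangentSet (ITT n) (curvatureRadiiSet g) q ↔
      mfderiv (ITT n) 𝓘(ℝ, ℝ × ℝ) (levelMap g) q w = 0 :=
  mem_tangentSet_iff (isOpen_regularSet g) (contMDiff_levelMap g).contMDiffOn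
    (mem_regularSet g hq) hq (mfderiv_levelMap_surjective g hq)
    (fun _ hp => mem_curvatureRadiiSet_iff_levelMap g hq hp) w

lemma IsTangentField.mfderiv_eq_zero {W : Set (TT n M)}
    {X : ∀ q : TT n M, TangentSpace (ITT n) q} (hX : IsTangentField g W X) {q p : TT n M}
    (hq : q ∈ curvatureRadiiSet g) (hp : p ∈ W ∩ regularSet g)
    (hpq : levelMap g p = levelMap g q) :
    mfderiv (ITT n) 𝓘(ℝ, ℝ × ℝ) (levelMap g) p (X p) = 0 := by
  have hpS := (mem_curvatureRadiiSet_iff_levelMap g hq hp.2).2 hpq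
  exact (mem_tangentSet_iff_mfderiv hpS _).1 (hX.tangent p ⟨hp.1, hpS⟩)

lemma IsTangentField.bracket {W : Set (TT n M)}
    {X Y : ∀ q : TT n M, TangentSpace (ITT n) q} (hX : IsTangentField g W X)
    (hY : IsTangentField g W Y) : IsTangentField g W (br X Y) where
  isOpen := hX.isOpen
  smooth := hX.smooth.mlieBracket hY.smooth hX.isOpen
  tangent _ hq := (mem_tangentSet_iff_mfderiv hq.2 _).2
    (mfderiv_mlieBracket_eq_zero (hX.isOpen.inter (isOpen_regularSet g))
      (contMDiff_levelMap g).contMDiffOn ⟨hq.1, mem_regularSet g hq.2⟩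
      (mfderiv_levelMap_surjective g hq.2) (hX.smooth.mono inter_subset_left)
      (hY.smooth.mono inter_subset_left) (fun _ hp h => hX.mfderiv_eq_zero hq.2 hp h)
      (fun _ hp h => hY.mfderiv_eq_zero hq.2 hp h))

/-- Derivatives in directions tangent to the manifold of curvature radii depend only on the values
along it. -/
lemma fderiv_eq_of_eqOn_curvatureRadiiSet {Q : Type*} [NormedAddCommGroup Q] [NormedSpace ℝ Q]
    {W : Set (TT n M)} (hW : IsOpen W) {q : TT n M} (hq : q ∈ W ∩ curvatureRadiiSet g)
    {w : TangentSpace (ITT n) q} (hw : w ∈ tangentSet (ITT n) (curvatureRadiiSet g) q)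
    {a b : En n × En n × En n → Q} (ha : DifferentiableAt ℝ a (extChartAt (ITT n) q q))
    (hb : DifferentiableAt ℝ b (extChartAt (ITT n) q q))
    (hab : ∀ p ∈ W ∩ curvatureRadiiSet g, p.proj ∈ (chartAt (En n) q.proj).source →
      a (extChartAt (ITT n) q p) = b (extChartAt (ITT n) q p)) :
    fderiv ℝ a (extChartAt (ITT n) q q) (w : En n × En n × En n) =
      fderiv ℝ b (extChartAt (ITT n) q q) (w : En n × En n × En n) :=
  fderiv_eq_of_eqOn_level (hW.inter (isOpen_regularSet g)) (contMDiff_levelMap g).contMDiffOn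
    ⟨hq.1, mem_regularSet g hq.2⟩ (mfderiv_levelMap_surjective g hq.2)
    ((mem_tangentSet_iff_mfderiv hq.2 w).1 hw) ha hb fun p hp hps hpq =>
      hab p ⟨hp.1, (mem_curvatureRadiiSet_iff_levelMap g hq.2 hp.2).2 hpq⟩
        (mem_chart_source_TT.1 hps)

lemma fderiv_fst_apply {a : En n × En n × En n → En n × En n × En n} {y : En n × En n × En n}
    (ha : DifferentiableAt ℝ a y) (w : En n × En n × En n) :
    (fderiv ℝ a y w).1 = fderiv ℝ (fun z => (a z).1) y w := by
  rw [ha.hasFDerivAt.fst.fderiv]; rfl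

lemma fderiv_snd_fst_apply {a : En n × En n × En n → En n × En n × En n} {y : En n × En n × En n}
    (ha : DifferentiableAt ℝ a y) (w : En n × En n × En n) :
    (fderiv ℝ a y w).2.1 = fderiv ℝ (fun z => (a z).2.1) y w := by
  rw [ha.hasFDerivAt.snd.fst.fderiv]; rfl

/-- The base component of the derivative of a field whose base component is a multiple of `V`. -/
lemma fderiv_coordField_base {W : Set (TT n M)} {X : ∀ q : TT n M, TangentSpace (ITT n) q}
    (hW : IsOpen W) (hX : IsSmoothFieldOn (ITT n) X W) {l : TT n M → ℝ}
    (hl : ContMDiffOn (ITT n) 𝓘(ℝ, ℝ) ∞ l W)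
    (hXl : ∀ p ∈ W ∩ curvatureRadiiSet g, baseMap n p (X p) = l p • p.2.1)
    {q : TT n M} (hq : q ∈ W ∩ curvatureRadiiSet g)
    {w : TangentSpace (ITT n) q} (hw : w ∈ tangentSet (ITT n) (curvatureRadiiSet g) q) :
    (fderiv ℝ (coordField (ITT n) q X) (extChartAt (ITT n) q q) (w : En n × En n × En n)).1 =
      scalarDeriv l q w • comps q.2.1 + l q • (w : En n × En n × En n).2.1 := by
  have hd := hX.differentiableAt_coordField hW hq.1
  have hl' : DifferentiableAt ℝ (fun y => l ((extChartAt (ITT n) q).symm y))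
      (extChartAt (ITT n) q q) :=
    ((contDiffOn_comp_extChartAt_symm hl q).contDiffAt
      ((isOpen_extChartAt_symm_preimage q hW).mem_nhds
        (extChartAt_mem_target_inter hq.1))).differentiableAt (by simp)
  have hb := hl'.hasFDerivAt.smul (modelV n).hasFDerivAt
  refine (fderiv_fst_apply hd _).trans ?_
  refine (fderiv_eq_of_eqOn_curvatureRadiiSet hW hq hw (hd.fst) hb.differentiableAt ?_).trans ?_
  · intro p hp hps
    have h1 : (extChartAt (ITT n) q).symm (extChartAt (ITT n) q p) = p :=
      (extChartAt (ITT n) q).left_inv (by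
        rw [extChartAt_source]; exact mem_chart_source_TT.2 hps)
    rw [coordField_extChartAt (mem_chart_source_TT.2 hps), chartDeriv_TT g hps]
    change chartDeriv (IM n) q.proj p.proj (baseMap n p (X p)) =
      l ((extChartAt (ITT n) q).symm (extChartAt (ITT n) q p)) • modelV n (extChartAt (ITT n) q p)
    rw [h1, hXl p hp, map_smul, extChartAt_TT hps]
    rfl
  · rw [hb.fderiv]
    have h1 : fderiv ℝ (fun y => l ((extChartAt (ITT n) q).symm y)) (extChartAt (ITT n) q q)
        (w : En n × En n × En n) = scalarDeriv l q w :=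
      fderiv_comp_extChartAt_symm_self hW hl hq.1 w
    have h2 : (extChartAt (ITT n) q).symm (extChartAt (ITT n) q q) = q := extChartAt_to_inv q
    have h3 : modelV n (extChartAt (ITT n) q q) = comps q.2.1 := by
      rw [extChartAt_TT_self]; rfl
    change l ((extChartAt (ITT n) q).symm (extChartAt (ITT n) q q)) • (w : En n × En n × En n).2.1 +
      fderiv ℝ (fun y => l ((extChartAt (ITT n) q).symm y)) (extChartAt (ITT n) q q)
        (w : En n × En n × En n) • modelV n (extChartAt (ITT n) q q) = _
    rw [h1, h2, h3, add_comm]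

/-- The second component of the derivative of a field whose base component is `l V` and whose first
connector component is `l R + β V`, with constants `l` and `β`. -/
lemma fderiv_coordField_connV {W : Set (TT n M)} {X : ∀ q : TT n M, TangentSpace (ITT n) q}
    (hW : IsOpen W) (hX : IsSmoothFieldOn (ITT n) X W) {l β : ℝ}
    (hXl : ∀ p ∈ W ∩ curvatureRadiiSet g, baseMap n p (X p) = l • p.2.1)
    (hXβ : ∀ p ∈ W ∩ curvatureRadiiSet g, connV g p (X p) = l • p.2.2 + β • p.2.1)
    {q : TT n M} (hq : q ∈ W ∩ curvatureRadiiSet g)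
    {w : TangentSpace (ITT n) q} (hw : w ∈ tangentSet (ITT n) (curvatureRadiiSet g) q)
    {Γ : En n → En n →L[ℝ] En n →L[ℝ] En n} (hΓ : Γ = christoffelMap (chartMetric g q.proj)) :
    (fderiv ℝ (coordField (ITT n) q X) (extChartAt (ITT n) q q) (w : En n × En n × En n)).2.1 =
      l • (w : En n × En n × En n).2.2 + β • (w : En n × En n × En n).2.1 -
      l • (fderiv ℝ Γ (extChartAt (IM n) q.proj q.proj) (w : En n × En n × En n).1
        (q.2.1 : En n) (q.2.1 : En n) +
      Γ (extChartAt (IM n) q.proj q.proj) (w : En n × En n × En n).2.1 (q.2.1 : En n) +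
      Γ (extChartAt (IM n) q.proj q.proj) (q.2.1 : En n) (w : En n × En n × En n).2.1) := by
  have hd := hX.differentiableAt_coordField hW hq.1
  have hΓd : DifferentiableAt ℝ Γ (extChartAt (IM n) q.proj q.proj) := by
    rw [hΓ]
    exact ((contDiffOn_christoffel_chartMetric g q.proj).contDiffAt
      (extChartAt_target_mem_nhds (I := IM n) q.proj)).differentiableAt (by simp)
  have gen : ∀ (x V R : En n), DifferentiableAt ℝ Γ x → ∃ L : En n × En n × En n →L[ℝ] En n,
      HasFDerivAt (fun y : En n × En n × En n =>
        l • y.2.2 + β • y.2.1 - l • Γ y.1 y.2.1 y.2.1) L (x, (V, R)) ∧ ∀ w, L w =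
        l • w.2.2 + β • w.2.1 - l • (fderiv ℝ Γ x w.1 V V + Γ x w.2.1 V + Γ x V w.2.1) := by
    intro x V R hx
    have e1 : HasFDerivAt (fun y : En n × En n × En n => Γ y.1) _ (x, (V, R)) :=
      HasFDerivAt.comp (x, (V, R)) (g := Γ) hx.hasFDerivAt
        (hasFDerivAt_fst (𝕜 := ℝ) (E := En n) (F := En n × En n) (p := (x, (V, R))))
    have e2 : HasFDerivAt (fun y : En n × En n × En n => y.2.1) (modelV n) (x, (V, R)) :=
      (modelV n).hasFDerivAt
    have e3 : HasFDerivAt (fun y : En n × En n × En n => y.2.2) (modelR n) (x, (V, R)) :=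
      (modelR n).hasFDerivAt
    refine ⟨_, ((e3.const_smul l).add (e2.const_smul β)).sub
      (((e1.clm_apply e2).clm_apply e2).const_smul l), fun w => ?_⟩
    simp only [sub_apply, add_apply, smul_apply, ContinuousLinearMap.comp_apply,
      ContinuousLinearMap.flip_apply, ContinuousLinearMap.coe_fst']
    change l • w.2.2 + β • w.2.1 - l • (Γ x V w.2.1 + (Γ x w.2.1 V + fderiv ℝ Γ x w.1 V V)) = _
    congr 2
    abel
  obtain ⟨L, hL, hLw⟩ := gen _ (q.2.1 : En n) (q.2.2 : En n) hΓd
  have hL' : HasFDerivAt (fun y : En n × En n × En n =>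
        l • y.2.2 + β • y.2.1 - l • Γ y.1 y.2.1 y.2.1) L (extChartAt (ITT n) q q) := by
    rw [extChartAt_TT_self]; exact hL
  refine (fderiv_snd_fst_apply hd _).trans ?_
  refine (fderiv_eq_of_eqOn_curvatureRadiiSet hW hq hw hd.snd.fst hL'.differentiableAt ?_).trans ?_
  · intro p hp hps
    rw [coordField_extChartAt (mem_chart_source_TT.2 hps), chartDeriv_TT g hps, ← hΓ]
    change chartDeriv (IM n) q.proj p.proj (connV g p (X p)) -
      Γ (extChartAt (IM n) q.proj p.proj) (chartDeriv (IM n) q.proj p.proj (baseMap n p (X p)))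
          (chartDeriv (IM n) q.proj p.proj p.2.1) = _
    rw [hXl p hp, hXβ p hp, extChartAt_TT hps]
    simp only [map_add, map_smul, smul_apply]
  · rw [hL'.fderiv]
    exact hLw _

variable {W : Set (TT n M)} {X Y : ∀ q : TT n M, TangentSpace (ITT n) q}

lemma br_eq_fderiv_sub (X Y : ∀ q : TT n M, TangentSpace (ITT n) q) (q : TT n M) :
    (br X Y q : En n × En n × En n) =
      fderiv ℝ (coordField (ITT n) q Y) (extChartAt (ITT n) q q) (X q) -
        fderiv ℝ (coordField (ITT n) q X) (extChartAt (ITT n) q q) (Y q) :=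
  mlieBracket_eq_coordField X Y q

/-- The base component of the bracket of two fields whose base components are multiples of `V`. -/
lemma baseMap_br (hX : IsTangentField g W X) (hY : IsTangentField g W Y) {lX lY : TT n M → ℝ}
    (hlX : ContMDiffOn (ITT n) 𝓘(ℝ, ℝ) ∞ lX W) (hlY : ContMDiffOn (ITT n) 𝓘(ℝ, ℝ) ∞ lY W)
    (hXl : ∀ p ∈ W ∩ curvatureRadiiSet g, baseMap n p (X p) = lX p • p.2.1)
    (hYl : ∀ p ∈ W ∩ curvatureRadiiSet g, baseMap n p (Y p) = lY p • p.2.1)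
    {q : TT n M} (hq : q ∈ W ∩ curvatureRadiiSet g) :
    baseMap n q (br X Y q) =
      (scalarDeriv lY q (X q) - scalarDeriv lX q (Y q)) •
        q.2.1 + lY q • connV g q (X q) - lX q • connV g q (Y q) := by
  have e1 := fderiv_coordField_base hY.isOpen hY.smooth hlY hYl hq (hX.tangent q hq)
  have e2 := fderiv_coordField_base hX.isOpen hX.smooth hlX hXl hq (hY.tangent q hq)
  have hXq := hXl q hq
  have hYq := hYl q hq
  refine (congrArg Prod.fst (br_eq_fderiv_sub X Y q)).trans ?_
  exact bracket_base_algebra (E := En n) (x := X q) (y := Y q)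
    (christoffelMap (chartMetric g q.proj) (extChartAt (IM n) q.proj q.proj)) e1 e2 rfl rfl hXq hYq

/-- The case of constant coefficients in `baseMap_br`. -/
lemma baseMap_br_const (hX : IsTangentField g W X) (hY : IsTangentField g W Y) {lX lY : ℝ}
    (hXl : ∀ p ∈ W ∩ curvatureRadiiSet g, baseMap n p (X p) = lX • p.2.1)
    (hYl : ∀ p ∈ W ∩ curvatureRadiiSet g, baseMap n p (Y p) = lY • p.2.1)
    {q : TT n M} (hq : q ∈ W ∩ curvatureRadiiSet g) :
    baseMap n q (br X Y q) = lY • connV g q (X q) - lX • connV g q (Y q) := by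
  have h := baseMap_br hX hY (lX := fun _ => lX) (lY := fun _ => lY) contMDiffOn_const
    contMDiffOn_const hXl hYl hq
  have h1 : ∀ (c : ℝ) (w : TangentSpace (ITT n) q),
      scalarDeriv (fun _ : TT n M => c) q w = 0 := by
    intro c w
    rw [scalarDeriv, mfderiv_const]; rfl
  rw [h1, h1, sub_zero, zero_smul, zero_add] at h
  exact h

/-- The first connector component of the bracket of two fields as in `fderiv_coordField_connV`. The
terms with Christoffel symbols cancel. -/
lemma connV_br (hX : IsTangentField g W X) (hY : IsTangentField g W Y) {lX lY bX bY : ℝ}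
    (hXl : ∀ p ∈ W ∩ curvatureRadiiSet g, baseMap n p (X p) = lX • p.2.1)
    (hYl : ∀ p ∈ W ∩ curvatureRadiiSet g, baseMap n p (Y p) = lY • p.2.1)
    (hXb : ∀ p ∈ W ∩ curvatureRadiiSet g, connV g p (X p) = lX • p.2.2 + bX • p.2.1)
    (hYb : ∀ p ∈ W ∩ curvatureRadiiSet g, connV g p (Y p) = lY • p.2.2 + bY • p.2.1)
    {q : TT n M} (hq : q ∈ W ∩ curvatureRadiiSet g) :
    connV g q (br X Y q) = lY • connR g q (X q) - lX • connR g q (Y q) +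
      (bY • connV g q (X q) - bX • connV g q (Y q)) := by
  obtain ⟨Γ, hΓ⟩ : ∃ Γ, Γ = christoffelMap (chartMetric g q.proj) := ⟨_, rfl⟩
  have e1 := fderiv_coordField_connV hY.isOpen hY.smooth hYl hYb hq (hX.tangent q hq) hΓ
  have e2 := fderiv_coordField_connV hX.isOpen hX.smooth hXl hXb hq (hY.tangent q hq) hΓ
  have hB := baseMap_br_const hX hY hXl hYl hq
  have hXq := hXl q hq
  have hYq := hYl q hq
  have hXk := hXb q hq
  have hYk := hYb q hq
  have hlin : ∀ (A : En n →L[ℝ] En n →L[ℝ] En n →L[ℝ] En n) (V : En n) (c : ℝ),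
      A (c • V) V V = c • A V V V := fun A V c =>
    congrArg (fun B : En n →L[ℝ] En n →L[ℝ] En n => B V V) (A.map_smul c V)
  have h1 := bracket_connector_algebra (E := En n) (D := br X Y q) (x := X q) (y := Y q)
    (V := q.2.1) (R := q.2.2) (kX := connV g q (X q)) (kY := connV g q (Y q))
    (rX := connR g q (X q)) (rY := connR g q (Y q))
    (Γ (extChartAt (IM n) q.proj q.proj))
    (fun w => fderiv ℝ Γ (extChartAt (IM n) q.proj q.proj) w (q.2.1 : En n) (q.2.1 : En n))
    (hlin _ _) (br_eq_fderiv_sub X Y q) e1 e2 hB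
    (by rw [hΓ]; rfl) (by rw [hΓ]; rfl) (by rw [hΓ]; rfl) (by rw [hΓ]; rfl) hXq hYq hXk hYk
  refine Eq.trans ?_ h1
  rw [hΓ]
  rfl

end Brackets

/-! ### The fields `f_1, …, f_n` -/

section Fields

variable {n : ℕ} {M : Type*} [TopologicalSpace M] [ChartedSpace (En n) M]
  [IsManifold (IM n) ∞ M]

lemma contMDiffAt_tangent_iff {u : ∀ p : TT n M, TangentSpace (IM n) p.proj} {q : TT n M} :
    ContMDiffAt (ITT n) (IM n).tangent ∞
      (fun p : TT n M => (⟨p.proj, u p⟩ : TangentBundle (IM n) M)) q ↔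
    ContMDiffAt (ITT n) 𝓘(ℝ, En n) ∞ (fun p => chartDeriv (IM n) q.proj p.proj (u p)) q := by
  have h0 : (fun p : TT n M => chartDeriv (IM n) q.proj p.proj (u p)) =ᶠ[𝓝 q] fun p =>
      (trivializationAt (En n) (TangentSpace (IM n) : M → Type _) q.proj ⟨p.proj, u p⟩).2 := by
    filter_upwards [chart_source_mem_nhds (ModelProd (En n) (En n × En n)) q] with p hp
    exact chartDeriv_eq_trivializationAt (mem_chart_source_TT.1 hp) _
  rw [h0.contMDiffAt_iff]
  refine (contMDiffAt_totalSpace (E := fun x : M => TangentSpace (IM n) x)).trans ?_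
  exact and_iff_right (Bundle.contMDiff_proj _ q)

lemma contMDiff_fibreV : ContMDiff (ITT n) (IM n).tangent ∞
    (fun p : TT n M => (⟨p.proj, p.2.1⟩ : TangentBundle (IM n) M)) := fun q => by
  rw [contMDiffAt_tangent_iff]
  have h := (modelV n).contDiff.contMDiff.contMDiffAt.comp q (contMDiffAt_extChartAt (I := ITT n)
    (n := ∞) (x := q))
  refine h.congr_of_eventuallyEq ?_
  filter_upwards [chart_source_mem_nhds (ModelProd (En n) (En n × En n)) q] with p hp
  rw [Function.comp_apply, extChartAt_TT (mem_chart_source_TT.1 hp)]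
  rfl

lemma contMDiff_fibreR : ContMDiff (ITT n) (IM n).tangent ∞
    (fun p : TT n M => (⟨p.proj, p.2.2⟩ : TangentBundle (IM n) M)) := fun q => by
  rw [contMDiffAt_tangent_iff]
  have h := (modelR n).contDiff.contMDiff.contMDiffAt.comp q (contMDiffAt_extChartAt (I := ITT n)
    (n := ∞) (x := q))
  refine h.congr_of_eventuallyEq ?_
  filter_upwards [chart_source_mem_nhds (ModelProd (En n) (En n × En n)) q] with p hp
  rw [Function.comp_apply, extChartAt_TT (mem_chart_source_TT.1 hp)]
  rfl

variable (g : ContMDiffRiemannianMetric (IM n) ∞ (En n) (fun x : M => TangentSpace (IM n) x))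

lemma isSmoothFieldOn_liftVec {W : Set (TT n M)} (hW : IsOpen W)
    {u v r : ∀ p : TT n M, TangentSpace (IM n) p.proj}
    (hu : ContMDiffOn (ITT n) (IM n).tangent ∞
      (fun p : TT n M => (⟨p.proj, u p⟩ : TangentBundle (IM n) M)) W)
    (hv : ContMDiffOn (ITT n) (IM n).tangent ∞
      (fun p : TT n M => (⟨p.proj, v p⟩ : TangentBundle (IM n) M)) W)
    (hr : ContMDiffOn (ITT n) (IM n).tangent ∞
      (fun p : TT n M => (⟨p.proj, r p⟩ : TangentBundle (IM n) M)) W) :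
    IsSmoothFieldOn (ITT n) (fun p => liftVec g p (u p) (v p) (r p)) W := by
  intro q hq
  refine (contMDiffAt_of_coordField ?_).contMDiffWithinAt
  have hy : (extChartAt (ITT n) q q).1 ∈ (extChartAt (IM n) q.proj).target := by
    rw [extChartAt_TT_self]; exact mem_extChartAt_target _
  have hsec : ∀ {u : ∀ p : TT n M, TangentSpace (IM n) p.proj}, ContMDiffOn (ITT n) (IM n).tangent ∞
      (fun p : TT n M => (⟨p.proj, u p⟩ : TangentBundle (IM n) M)) W →
      ContDiffAt ℝ ∞ (fun y => chartDeriv (IM n) q.proj ((extChartAt (ITT n) q).symm y).proj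
        (u ((extChartAt (ITT n) q).symm y))) (extChartAt (ITT n) q q) := by
    intro u hu
    have h1 := contMDiffAt_tangent_iff.1 (hu.contMDiffAt (hW.mem_nhds hq))
    have h2 : ContMDiffAt 𝓘(ℝ, En n × En n × En n) (ITT n) ∞ (extChartAt (ITT n) q).symm
        (extChartAt (ITT n) q q) := (contMDiffOn_extChartAt_symm q).contMDiffAt
      (extChartAt_target_mem_nhds (I := ITT n) q)
    exact (ContMDiffAt.comp_of_eq h1 h2 (extChartAt_to_inv q)).contDiffAt
  have hΓ : ContDiffAt ℝ ∞ (fun y : En n × En n × En n =>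
      christoffelMap (chartMetric g q.proj) y.1) (extChartAt (ITT n) q q) :=
    ContDiffAt.comp (extChartAt (ITT n) q q) (g := christoffelMap (chartMetric g q.proj))
      ((contDiffOn_christoffel_chartMetric g q.proj).contDiffAt
        ((isOpen_extChartAt_target q.proj).mem_nhds hy)) contDiffAt_fst
  have hmain := (hsec hu).prodMk (((hsec hv).sub ((hΓ.clm_apply (hsec hu)).clm_apply
    (modelV n).contDiff.contDiffAt)).prodMk ((hsec hr).sub ((hΓ.clm_apply (hsec hu)).clm_apply
    (modelR n).contDiff.contDiffAt)))
  refine hmain.congr_of_eventuallyEq ?_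
  filter_upwards [extChartAt_target_mem_nhds (I := ITT n) q] with y hy
  have hs : (extChartAt (ITT n) q).symm y ∈ (chartAt (ModelProd (En n) (En n × En n)) q).source := by
    rw [← extChartAt_source (ITT n)]; exact (extChartAt (ITT n) q).map_target hy
  have hs' := mem_chart_source_TT.1 hs
  have hr' : extChartAt (ITT n) q ((extChartAt (ITT n) q).symm y) = y :=
    (extChartAt (ITT n) q).right_inv hy
  rw [extChartAt_TT hs'] at hr'
  have h1 : extChartAt (IM n) q.proj ((extChartAt (ITT n) q).symm y).proj = y.1 :=
    congrArg Prod.fst hr'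
  have h2 : chartDeriv (IM n) q.proj ((extChartAt (ITT n) q).symm y).proj
      ((extChartAt (ITT n) q).symm y).2.1 = modelV n y := congrArg (modelV n) hr'
  have h3 : chartDeriv (IM n) q.proj ((extChartAt (ITT n) q).symm y).proj
      ((extChartAt (ITT n) q).symm y).2.2 = modelR n y := congrArg (modelR n) hr'
  refine (chartDeriv_TT g hs' _).trans ?_
  rw [baseMap_liftVec, connV_liftVec, connR_liftVec, h1, h2, h3]

variable (n M) in
lemma isMIntegralCurveOn_iff_velocity {X : ∀ q : TT n M, TangentSpace (ITT n) q} {σ : ℝ → TT n M}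
    {s : Set ℝ} (hs : UniqueDiffOn ℝ s) (hσ : IsSmoothCurve (ITT n) σ s) :
    IsMIntegralCurveOn σ X s ↔ ∀ t ∈ s, velocity (ITT n) σ s t = X (σ t) := by
  refine forall₂_congr fun t ht => ?_
  have hd : MDifferentiableWithinAt 𝓘(ℝ, ℝ) (ITT n) σ s t :=
    (hσ t ht).mdifferentiableWithinAt (by simp)
  constructor
  · intro h
    rw [velocity, h.mfderivWithin (hs t ht).uniqueMDiffWithinAt]
    exact one_smul ℝ _
  · intro h
    have h1 : mfderivWithin 𝓘(ℝ, ℝ) (ITT n) σ s t = (1 : ℝ →L[ℝ] ℝ).smulRight (X (σ t)) :=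
      ContinuousLinearMap.ext_ring (h.trans (one_smul ℝ _).symm)
    rw [← h1]
    exact hd.hasMFDerivWithinAt

variable {g} {W : Set (TT n M)} {b : ℕ → ∀ q : TT n M, TangentSpace (IM n) q.proj}

variable (g b) in
/-- The fields `f_1, …, f_n` that belong to the frame `b`. -/
def frameField (k : ℕ) (q : TT n M) : TangentSpace (ITT n) q :=
  if k = 1 then liftVec g q q.2.1 q.2.2 (-q.2.1)
  else if k = 2 then liftVec g q 0 q.2.1 q.2.2
  else liftVec g q 0 0 (b k q)

lemma frameField_one (q : TT n M) : frameField g b 1 q = liftVec g q q.2.1 q.2.2 (-q.2.1) := rfl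

lemma frameField_two (q : TT n M) : frameField g b 2 q = liftVec g q 0 q.2.1 q.2.2 := rfl

lemma frameField_of_three_le {k : ℕ} (hk : 3 ≤ k) (q : TT n M) :
    frameField g b k q = liftVec g q 0 0 (b k q) := by
  rw [frameField, if_neg (by omega), if_neg (by omega)]

lemma contMDiff_neg_fibreV : ContMDiff (ITT n) (IM n).tangent ∞
    (fun p : TT n M => (⟨p.proj, -p.2.1⟩ : TangentBundle (IM n) M)) := fun q => by
  have h := contMDiffAt_tangent_iff.1 (contMDiff_fibreV (M := M) q)
  rw [contMDiffAt_tangent_iff]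
  exact h.neg.congr_of_eventuallyEq (Filter.Eventually.of_forall fun p => map_neg _ _)

lemma contMDiff_fibre_zero : ContMDiff (ITT n) (IM n).tangent ∞
    (fun p : TT n M => (⟨p.proj, 0⟩ : TangentBundle (IM n) M)) := fun q => by
  rw [contMDiffAt_tangent_iff]
  exact (contMDiffAt_const (c := (0 : En n))).congr_of_eventuallyEq
    (Filter.Eventually.of_forall fun p => map_zero _)

lemma isSmoothFieldOn_frameField_one : IsSmoothFieldOn (ITT n) (frameField g b 1) univ :=
  isSmoothFieldOn_liftVec g isOpen_univ contMDiff_fibreV.contMDiffOn contMDiff_fibreR.contMDiffOn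
    contMDiff_neg_fibreV.contMDiffOn

lemma isSmoothFieldOn_frameField_two : IsSmoothFieldOn (ITT n) (frameField g b 2) univ :=
  isSmoothFieldOn_liftVec g isOpen_univ contMDiff_fibre_zero.contMDiffOn
    contMDiff_fibreV.contMDiffOn contMDiff_fibreR.contMDiffOn

lemma isSmoothFieldOn_frameField (hb : IsOrthFrame g W b) {k : ℕ} (hk : k ∈ Icc 1 n) :
    IsSmoothFieldOn (ITT n) (frameField g b k) W := by
  obtain rfl | rfl | h3 : k = 1 ∨ k = 2 ∨ 3 ≤ k := by have := hk.1; omega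
  · exact isSmoothFieldOn_frameField_one.mono (subset_univ _)
  · exact isSmoothFieldOn_frameField_two.mono (subset_univ _)
  · have h := isSmoothFieldOn_liftVec g hb.isOpen contMDiff_fibre_zero.contMDiffOn
      contMDiff_fibre_zero.contMDiffOn (hb.smooth k ⟨h3, hk.2⟩)
    refine ContMDiffOn.congr h fun p _ => ?_
    rw [frameField_of_three_le h3]

lemma frameField_mem_tangentSet (hb : IsOrthFrame g W b) {k : ℕ} (hk : k ∈ Icc 1 n) {q : TT n M}
    (hq : q ∈ W ∩ curvatureRadiiSet g) :
    frameField g b k q ∈ tangentSet (ITT n) (curvatureRadiiSet g) q := by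
  obtain ⟨h1, h2, -⟩ := (mem_curvatureRadiiSet_iff g q).1 hq.2
  have h1' := h1
  rw [g.symm] at h1'
  rw [mem_tangentSet_curvatureRadiiSet g hq.2]
  obtain rfl | rfl | h3 : k = 1 ∨ k = 2 ∨ 3 ≤ k := by have := hk.1; omega
  · rw [frameField_one, connR_liftVec, connV_liftVec, map_neg, neg_apply, neg_apply, h2, h1, h1']
    simp
  · rw [frameField_two, connR_liftVec, connV_liftVec, h2, h1, h1']
    simp
  · rw [frameField_of_three_le h3, connR_liftVec, connV_liftVec, hb.orth_R k ⟨h3, hk.2⟩ q hq,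
      hb.orth_V k ⟨h3, hk.2⟩ q hq]
    simp

lemma isTangentField_frameField (hb : IsOrthFrame g W b) {k : ℕ} (hk : k ∈ Icc 1 n) :
    IsTangentField g W (frameField g b k) :=
  ⟨hb.isOpen, isSmoothFieldOn_frameField hb hk, fun _ hp => frameField_mem_tangentSet hb hk hp⟩

/-- A field with a given ODE, where the ODE prescribes the components of the velocity. -/
lemma hasODE_of_velocity_iff {X : ∀ q : TT n M, TangentSpace (ITT n) q}
    {ode : (ℝ → TT n M) → Set ℝ → ℝ → Prop} {S W : Set (TT n M)}
    (h : ∀ (σ : ℝ → TT n M) (s : Set ℝ) (t : ℝ), UniqueDiffWithinAt ℝ s t →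
      MDifferentiableWithinAt 𝓘(ℝ, ℝ) (ITT n) σ s t →
      (velocity (ITT n) σ s t = X (σ t) ↔ ode σ s t)) : HasODE S W X ode := by
  intro a c σ hσ _
  rw [isMIntegralCurveOn_iff_velocity n M (uniqueDiffOn_Ioo a c) hσ]
  exact forall₂_congr fun t ht => h σ _ t (uniqueDiffOn_Ioo a c t ht)
    ((hσ t ht).mdifferentiableWithinAt (by simp))

/-- The components of the velocity of a curve determine it. -/
lemma velocity_eq_liftVec_iff {σ : ℝ → TT n M} {s : Set ℝ} {t : ℝ}
    (hs : UniqueDiffWithinAt ℝ s t) (hσ : MDifferentiableWithinAt 𝓘(ℝ, ℝ) (ITT n) σ s t)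
    (u v r : TangentSpace (IM n) (σ t).proj) :
    velocity (ITT n) σ s t = liftVec g (σ t) u v r ↔
      velocity (IM n) (fun τ => (σ τ).proj) s t = u ∧
      covDeriv g (fun τ => (σ τ).proj) (fun τ => (σ τ).2.2) s t = r ∧
      covDeriv g (fun τ => (σ τ).proj) (fun τ => (σ τ).2.1) s t = v := by
  rw [← baseMap_velocity hs hσ, ← connV_velocity g hs hσ, ← connR_velocity g hs hσ]
  constructor
  · intro h
    rw [h, baseMap_liftVec, connV_liftVec, connR_liftVec]
    exact ⟨rfl, rfl, rfl⟩
  · rintro ⟨h1, h2, h3⟩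
    rw [← h1, ← h2, ← h3, liftVec_eq]

lemma velocity_eq_liftVec_zero_iff {σ : ℝ → TT n M} {s : Set ℝ} {t : ℝ}
    (hs : UniqueDiffWithinAt ℝ s t) (hσ : MDifferentiableWithinAt 𝓘(ℝ, ℝ) (ITT n) σ s t)
    (v r : TangentSpace (IM n) (σ t).proj) :
    velocity (ITT n) σ s t = liftVec g (σ t) 0 v r ↔
      velocity (IM n) (fun τ => (σ τ).proj) s t = 0 ∧
      coordDeriv (fun τ => (σ τ).proj) (fun τ => (σ τ).2.2) s t = r ∧
      coordDeriv (fun τ => (σ τ).proj) (fun τ => (σ τ).2.1) s t = v := by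
  rw [velocity_eq_liftVec_iff hs hσ]
  refine and_congr_right fun h => ?_
  rw [covDeriv_eq_coordDeriv g h, covDeriv_eq_coordDeriv g h]

lemma isAdaptedFrame_frameField (hb : IsOrthFrame g W b) :
    IsAdaptedFrame g W b (frameField g b) where
  smooth _ hk := isSmoothFieldOn_frameField hb hk
  ode_one := hasODE_of_velocity_iff fun _ _ _ hs hσ => velocity_eq_liftVec_iff hs hσ _ _ _
  ode_two := hasODE_of_velocity_iff fun _ _ _ hs hσ => velocity_eq_liftVec_zero_iff hs hσ _ _
  ode_ge_three j hj := hasODE_of_velocity_iff fun σ s t hs hσ => by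
    rw [frameField_of_three_le hj.1]
    exact velocity_eq_liftVec_zero_iff hs hσ _ _

/-- Through each point of the manifold of curvature radii passes an integral curve of a given
tangent field that stays inside the manifold. -/
lemma IsTangentField.exists_integralCurve {X : ∀ q : TT n M, TangentSpace (ITT n) q}
    (hX : IsTangentField g W X) {q : TT n M} (hq : q ∈ W ∩ curvatureRadiiSet g) :
    ∃ ε > (0 : ℝ), ∃ c : ℝ → TT n M, c 0 = q ∧ IsSmoothCurve (ITT n) c (Ioo (-ε) ε) ∧
      (∀ t ∈ Ioo (-ε) ε, c t ∈ W ∩ curvatureRadiiSet g) ∧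
      ∀ t ∈ Ioo (-ε) ε, velocity (ITT n) c (Ioo (-ε) ε) t = X (c t) := by
  obtain ⟨ε, hε, c, hc0, hcs, hcO, hcv⟩ := exists_curve_in_levelSet
    (hX.isOpen.inter (isOpen_regularSet g)) (contMDiff_levelMap g).contMDiffOn
    ⟨hq.1, mem_regularSet g hq.2⟩ (mfderiv_levelMap_surjective g hq.2)
    (hX.smooth.mono inter_subset_left)
    ((mem_tangentSet_iff_mfderiv hq.2 _).1 (hX.tangent q hq))
  refine ⟨ε, hε, c, hc0, hcs, fun t ht => ⟨(hcO t ht).1.1,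
    (mem_curvatureRadiiSet_iff_levelMap g hq.2 (hcO t ht).1.2).2 (hcO t ht).2⟩, fun t ht => ?_⟩
  exact hcv t ht (hX.mfderiv_eq_zero hq.2 (hcO t ht).1 (hcO t ht).2)

/-- An ODE determines a field along the manifold of curvature radii. -/
lemma HasODE.eq_of_isTangentField {X Y : ∀ q : TT n M, TangentSpace (ITT n) q}
    {ode : (ℝ → TT n M) → Set ℝ → ℝ → Prop} (hX : IsTangentField g W X)
    (hXo : HasODE (curvatureRadiiSet g) W X ode) (hYo : HasODE (curvatureRadiiSet g) W Y ode)
    {q : TT n M} (hq : q ∈ W ∩ curvatureRadiiSet g) : Y q = X q := by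
  obtain ⟨ε, hε, c, rfl, hcs, hcS, hcv⟩ := hX.exists_integralCurve hq
  have h0 : (0 : ℝ) ∈ Ioo (-ε) ε := ⟨by linarith, hε⟩
  have hI := isMIntegralCurveOn_iff_velocity n M (X := X) (uniqueDiffOn_Ioo (-ε) ε) hcs
  have h1 := (hYo _ _ c hcs hcS).2 ((hXo _ _ c hcs hcS).1 (hI.2 hcv))
  rw [isMIntegralCurveOn_iff_velocity n M (uniqueDiffOn_Ioo (-ε) ε) hcs] at h1
  rw [← h1 0 h0, hcv 0 h0]

/-- All families of fields with the given ODEs agree along the manifold of curvature radii. -/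
lemma IsAdaptedFrame.eq_frameField {f : ℕ → ∀ q : TT n M, TangentSpace (ITT n) q}
    (hb : IsOrthFrame g W b) (hf : IsAdaptedFrame g W b f) {k : ℕ} (hk : k ∈ Icc 1 n)
    {q : TT n M} (hq : q ∈ W ∩ curvatureRadiiSet g) : f k q = frameField g b k q := by
  have hX := isTangentField_frameField hb hk
  obtain rfl | rfl | h3 : k = 1 ∨ k = 2 ∨ 3 ≤ k := by have := hk.1; omega
  · exact HasODE.eq_of_isTangentField hX (isAdaptedFrame_frameField hb).ode_one hf.ode_one hq
  · exact HasODE.eq_of_isTangentField hX (isAdaptedFrame_frameField hb).ode_two hf.ode_two hq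
  · exact HasODE.eq_of_isTangentField hX
      ((isAdaptedFrame_frameField hb).ode_ge_three k ⟨h3, hk.2⟩)
      (hf.ode_ge_three k ⟨h3, hk.2⟩) hq

lemma IsAdaptedFrame.isTangentField {f : ℕ → ∀ q : TT n M, TangentSpace (ITT n) q}
    (hb : IsOrthFrame g W b) (hf : IsAdaptedFrame g W b f) {k : ℕ} (hk : k ∈ Icc 1 n) :
    IsTangentField g W (f k) :=
  ⟨hb.isOpen, hf.smooth k hk, fun p hp => by
    rw [hf.eq_frameField hb hk hp]; exact frameField_mem_tangentSet hb hk hp⟩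

end Fields

/-! ### The distribution and its flag at a point -/

section BaseFrame

variable {n : ℕ} {M : Type*} [TopologicalSpace M] [ChartedSpace (En n) M]
  {b : ℕ → ∀ q : TT n M, TangentSpace (IM n) q.proj} {q : TT n M}

variable (b) in
/-- The orthogonal basis `V, R, b_3, …, b_n`. -/
def baseFrame (q : TT n M) (k : ℕ) : TangentSpace (IM n) q.proj :=
  if k = 1 then q.2.1 else if k = 2 then q.2.2 else b k q

lemma baseFrame_one : baseFrame b q 1 = q.2.1 := rfl

lemma baseFrame_two : baseFrame b q 2 = q.2.2 := rfl

lemma baseFrame_of_three_le {k : ℕ} (hk : 3 ≤ k) : baseFrame b q k = b k q := by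
  rw [baseFrame, if_neg (by omega), if_neg (by omega)]

end BaseFrame

section PointwiseFlag

variable {n : ℕ} {M : Type*} [TopologicalSpace M] [ChartedSpace (En n) M]
  [IsManifold (IM n) ∞ M]
  (g : ContMDiffRiemannianMetric (IM n) ∞ (En n) (fun x : M => TangentSpace (IM n) x))

/-- The tangent spaces of the manifold of curvature radii, as subspaces given by equations. -/
def tangentSubmodule (q : TT n M) : Submodule ℝ (TangentSpace (ITT n) q) where
  carrier := {w | g.inner q.proj (connR g q w) q.2.1 + g.inner q.proj (connV g q w) q.2.2 = 0 ∧
      g.inner q.proj (connR g q w) q.2.2 = g.inner q.proj (connV g q w) q.2.1}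
  add_mem' := by
    rintro a b ⟨ha1, ha2⟩ ⟨hb1, hb2⟩
    simp only [mem_ofPred_eq, map_add, add_apply]
    exact ⟨by linear_combination ha1 + hb1, by rw [ha2, hb2]⟩
  zero_mem' := by simp
  smul_mem' := by
    rintro c a ⟨ha1, ha2⟩
    simp only [mem_ofPred_eq, map_smul, smul_apply, smul_eq_mul]
    exact ⟨by linear_combination c * ha1, by rw [ha2]⟩

lemma coe_tangentSubmodule {q : TT n M} (hq : q ∈ curvatureRadiiSet g) :
    (tangentSubmodule g q : Set (TangentSpace (ITT n) q)) =
      tangentSet (ITT n) (curvatureRadiiSet g) q := by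
  ext w
  rw [mem_tangentSet_curvatureRadiiSet g hq]
  rfl

/-- The second step of the flag: tangent vectors whose base component is a multiple of `V`. -/
def secondFlag (q : TT n M) : Submodule ℝ (TangentSpace (ITT n) q) :=
  tangentSubmodule g q ⊓ (Submodule.span ℝ {q.2.1}).comap (baseMap n q).toLinearMap

/-- The distribution in terms of the connectors: tangent vectors with base component `l V` and first
connector component `l R + m V`. -/
def firstFlag (q : TT n M) : Submodule ℝ (TangentSpace (ITT n) q) where
  carrier := {w | w ∈ tangentSubmodule g q ∧ ∃ l m : ℝ, baseMap n q w = l • q.2.1 ∧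
    connV g q w = l • q.2.2 + m • q.2.1}
  add_mem' := by
    rintro a b ⟨ha, l, m, h1, h2⟩ ⟨hb, l', m', h1', h2'⟩
    refine ⟨add_mem ha hb, l + l', m + m', ?_, ?_⟩
    · rw [map_add, h1, h1', add_smul]
    · rw [map_add, h2, h2']; module
  zero_mem' := ⟨zero_mem _, 0, 0, by simp, by simp⟩
  smul_mem' := by
    rintro c a ⟨ha, l, m, h1, h2⟩
    refine ⟨Submodule.smul_mem _ c ha, c * l, c * m, ?_, ?_⟩
    · rw [map_smul, h1, smul_smul]
    · rw [map_smul, h2]; module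

variable {g}

lemma mem_firstFlag {q : TT n M} {w : TangentSpace (ITT n) q} : w ∈ firstFlag g q ↔
    w ∈ tangentSubmodule g q ∧ ∃ l m : ℝ, baseMap n q w = l • q.2.1 ∧
      connV g q w = l • q.2.2 + m • q.2.1 := Iff.rfl

lemma mem_secondFlag {q : TT n M} {w : TangentSpace (ITT n) q} : w ∈ secondFlag g q ↔
    w ∈ tangentSubmodule g q ∧ ∃ l : ℝ, baseMap n q w = l • q.2.1 := by
  rw [secondFlag, Submodule.mem_inf, Submodule.mem_comap, Submodule.mem_span_singleton]
  exact and_congr Iff.rfl (exists_congr fun l => eq_comm)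

lemma firstFlag_le_secondFlag (q : TT n M) : firstFlag g q ≤ secondFlag g q := fun _ hw =>
  mem_secondFlag.2 ⟨hw.1, hw.2.choose, hw.2.choose_spec.choose_spec.1⟩

instance finiteDimensional_tangentSpace_TT (q : TT n M) :
    FiniteDimensional ℝ (TangentSpace (ITT n) q) :=
  inferInstanceAs (FiniteDimensional ℝ (En n × En n × En n))

variable {W : Set (TT n M)} {b : ℕ → ∀ q : TT n M, TangentSpace (IM n) q.proj} {q : TT n M}

lemma baseFrame_ne_zero (hb : IsOrthFrame g W b) (hq : q ∈ W ∩ curvatureRadiiSet g) {k : ℕ}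
    (hk : k ∈ Icc 1 n) : baseFrame b q k ≠ 0 := by
  obtain ⟨h1, h2, h3⟩ := (mem_curvatureRadiiSet_iff g q).1 hq.2
  have hne : ∀ v : TangentSpace (IM n) q.proj, 0 < g.inner q.proj v v → v ≠ 0 := by
    rintro v hv rfl
    rw [map_zero] at hv
    exact lt_irrefl _ hv
  obtain rfl | rfl | h : k = 1 ∨ k = 2 ∨ 3 ≤ k := by have := hk.1; omega
  · exact hne _ h3
  · exact hne _ (by rw [baseFrame_two, h2]; exact h3)
  · rw [baseFrame_of_three_le h]
    refine hne _ ?_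
    rw [← gnorm_sq, hb.norm_eq k ⟨h, hk.2⟩ q hq, gnorm_sq, h2]
    exact h3

lemma baseFrame_orth (hb : IsOrthFrame g W b) (hq : q ∈ W ∩ curvatureRadiiSet g) {i j : ℕ}
    (hi : i ∈ Icc 1 n) (hj : j ∈ Icc 1 n) (hij : i ≠ j) :
    g.inner q.proj (baseFrame b q i) (baseFrame b q j) = 0 := by
  wlog h : i < j generalizing i j
  · rw [g.symm]
    exact this hj hi hij.symm (by omega)
  have h1 := ((mem_curvatureRadiiSet_iff g q).1 hq.2).1
  obtain rfl | h2j : j = 2 ∨ 3 ≤ j := by have := hi.1; omega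
  · obtain rfl : i = 1 := by have := hi.1; omega
    rw [baseFrame_one, baseFrame_two, g.symm]
    exact h1
  rw [baseFrame_of_three_le h2j]
  obtain rfl | rfl | h : i = 1 ∨ i = 2 ∨ 3 ≤ i := by have := hi.1; omega
  · rw [g.symm]
    exact hb.orth_V j ⟨h2j, hj.2⟩ q hq
  · rw [g.symm]
    exact hb.orth_R j ⟨h2j, hj.2⟩ q hq
  · rw [baseFrame_of_three_le h]
    exact hb.orth i ⟨h, hi.2⟩ j ⟨h2j, hj.2⟩ hij q hq

lemma linearIndepOn_baseFrame (hb : IsOrthFrame g W b) (hq : q ∈ W ∩ curvatureRadiiSet g) :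
    LinearIndepOn ℝ (baseFrame b q) (Icc 1 n) :=
  IsInnerForm.linearIndepOn (isInnerForm_inner g q.proj) (fun _ hi => baseFrame_ne_zero hb hq hi)
    fun _ hi _ hj hij => baseFrame_orth hb hq hi hj hij

lemma span_baseFrame (hb : IsOrthFrame g W b) (hq : q ∈ W ∩ curvatureRadiiSet g) :
    Submodule.span ℝ (baseFrame b q '' Icc 1 n) = ⊤ :=
  span_image_Icc_eq_top (E := En n) (by simp) (linearIndepOn_baseFrame hb hq)

lemma baseFrame_expansion (hb : IsOrthFrame g W b) (hq : q ∈ W ∩ curvatureRadiiSet g)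
    (v : TangentSpace (IM n) q.proj) : v = ∑ i ∈ Finset.Icc 1 n,
      (g.inner q.proj v (baseFrame b q i) / g.inner q.proj (baseFrame b q i) (baseFrame b q i)) •
        baseFrame b q i :=
  IsInnerForm.eq_sum (isInnerForm_inner g q.proj) (by simp)
    (fun _ hi => baseFrame_ne_zero hb hq hi) (fun _ hi _ hj hij => baseFrame_orth hb hq hi hj hij) v

/-- The images of the fields `f_k` under `w ↦ 2 w.1 + D_t R` are the orthogonal vectors
`V, R, b_3, …, b_n`. -/
lemma linearIndepOn_frameField (hb : IsOrthFrame g W b) (hq : q ∈ W ∩ curvatureRadiiSet g) :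
    LinearIndepOn ℝ (fun k => frameField g b k q) (Icc 1 n) := by
  let ψ : TangentSpace (ITT n) q →ₗ[ℝ] TangentSpace (IM n) q.proj :=
    (2 : ℝ) • (baseMap n q).toLinearMap + (connR g q).toLinearMap
  have hψ : ∀ k ∈ Icc 1 n, ψ (frameField g b k q) = baseFrame b q k := by
    intro k hk
    change (2 : ℝ) • baseMap n q (frameField g b k q) + connR g q (frameField g b k q) = _
    obtain rfl | rfl | h : k = 1 ∨ k = 2 ∨ 3 ≤ k := by have := hk.1; omega
    · rw [frameField_one, baseMap_liftVec, connR_liftVec, baseFrame_one]; module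
    · rw [frameField_two, baseMap_liftVec, connR_liftVec, baseFrame_two]; module
    · rw [frameField_of_three_le h, baseMap_liftVec, connR_liftVec, baseFrame_of_three_le h]
      module
  have h := linearIndepOn_baseFrame hb hq
  have h2 : LinearIndepOn ℝ (ψ ∘ fun k => frameField g b k q) (Icc 1 n) :=
    h.congr fun k hk => (hψ k hk).symm
  exact LinearIndepOn.of_comp ψ h2

lemma frameField_mem_firstFlag (hb : IsOrthFrame g W b) (hq : q ∈ W ∩ curvatureRadiiSet g) {k : ℕ}
    (hk : k ∈ Icc 1 n) : frameField g b k q ∈ firstFlag g q := by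
  have ht : frameField g b k q ∈ tangentSubmodule g q := by
    rw [← SetLike.mem_coe, coe_tangentSubmodule g hq.2]
    exact frameField_mem_tangentSet hb hk hq
  refine ⟨ht, ?_⟩
  obtain rfl | rfl | h : k = 1 ∨ k = 2 ∨ 3 ≤ k := by have := hk.1; omega
  · exact ⟨1, 0, by rw [frameField_one, baseMap_liftVec, one_smul],
      by rw [frameField_one, connV_liftVec, one_smul, zero_smul, add_zero]⟩
  · exact ⟨0, 1, by rw [frameField_two, baseMap_liftVec, zero_smul],
      by rw [frameField_two, connV_liftVec, one_smul, zero_smul, zero_add]⟩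
  · exact ⟨0, 0, by rw [frameField_of_three_le h, baseMap_liftVec, zero_smul],
      by rw [frameField_of_three_le h, connV_liftVec, zero_smul, zero_smul, zero_add]⟩

lemma firstFlag_eq_span (hn : 2 ≤ n) (hb : IsOrthFrame g W b)
    (hq : q ∈ W ∩ curvatureRadiiSet g) :
    firstFlag g q = Submodule.span ℝ ((fun k => frameField g b k q) '' Icc 1 n) := by
  refine le_antisymm ?_ (Submodule.span_le.2 ?_)
  swap
  · rintro _ ⟨k, hk, rfl⟩
    exact frameField_mem_firstFlag hb hq hk
  rintro w ⟨⟨ht1, ht2⟩, l, m, h1, h2⟩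
  obtain ⟨hs1, hs2, hs3⟩ := (mem_curvatureRadiiSet_iff g q).1 hq.2
  have hs1' := hs1
  rw [g.symm] at hs1'
  have hf : ∀ k ∈ Icc 1 n, frameField g b k q ∈
      Submodule.span ℝ ((fun k => frameField g b k q) '' Icc 1 n) := fun k hk =>
    Submodule.subset_span ⟨k, hk, rfl⟩
  -- what is left after subtracting `l f_1 + m f_2` is vertical, orthogonal to `V` and `R`
  set r := connR g q w + l • q.2.1 - m • q.2.2
  have hrV : g.inner q.proj r q.2.1 = 0 := by
    rw [h2] at ht1
    simp only [r, map_add, map_sub, map_smul, add_apply, sub_apply, smul_apply, smul_eq_mul, hs1,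
      hs1', hs2] at ht1 ⊢
    linarith
  have hrR : g.inner q.proj r q.2.2 = 0 := by
    rw [h2] at ht2
    simp only [r, map_add, map_sub, map_smul, add_apply, sub_apply, smul_apply, smul_eq_mul, hs1,
      hs1', hs2] at ht2 ⊢
    linarith
  have hw : w = l • frameField g b 1 q + m • frameField g b 2 q + liftVec g q 0 0 r := by
    refine tangent_ext g ?_ ?_ ?_
    · rw [map_add, map_add, map_smul, map_smul, frameField_one, frameField_two, baseMap_liftVec,
        baseMap_liftVec, baseMap_liftVec, h1]
      module
    · rw [map_add, map_add, map_smul, map_smul, frameField_one, frameField_two, connV_liftVec,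
        connV_liftVec, connV_liftVec, h2]
      module
    · rw [map_add, map_add, map_smul, map_smul, frameField_one, frameField_two, connR_liftVec,
        connR_liftVec, connR_liftVec]
      module
  have hr : liftVec g q 0 0 r = ∑ i ∈ Finset.Icc 1 n, (g.inner q.proj r (baseFrame b q i) /
      g.inner q.proj (baseFrame b q i) (baseFrame b q i)) • liftVec g q 0 0 (baseFrame b q i) := by
    refine tangent_ext g ?_ ?_ ?_
    · simp only [map_sum, map_smul, baseMap_liftVec, smul_zero, Finset.sum_const_zero]
    · simp only [map_sum, map_smul, connV_liftVec, smul_zero, Finset.sum_const_zero]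
    · simp only [map_sum, map_smul, connR_liftVec]
      exact baseFrame_expansion hb hq r
  rw [hw, hr]
  refine add_mem (add_mem (Submodule.smul_mem _ _ (hf 1 ⟨le_rfl, by omega⟩))
    (Submodule.smul_mem _ _ (hf 2 ⟨by omega, hn⟩))) (Submodule.sum_mem _ fun i hi => ?_)
  rw [Finset.mem_Icc] at hi
  obtain rfl | rfl | h : i = 1 ∨ i = 2 ∨ 3 ≤ i := by omega
  · rw [baseFrame_one, hrV, zero_div, zero_smul]; exact zero_mem _
  · rw [baseFrame_two, hrR, zero_div, zero_smul]; exact zero_mem _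
  · refine Submodule.smul_mem _ _ ?_
    rw [baseFrame_of_three_le h, ← frameField_of_three_le h]
    exact hf i ⟨by omega, hi.2⟩

lemma finrank_firstFlag (hn : 2 ≤ n) (hb : IsOrthFrame g W b)
    (hq : q ∈ W ∩ curvatureRadiiSet g) : Module.finrank ℝ (firstFlag g q) = n := by
  rw [firstFlag_eq_span hn hb hq, finrank_span_image_Icc (linearIndepOn_frameField hb hq)]
  omega

variable (g) in
/-- The symbol of the first bracket step: it vanishes on the multiples of `R` in `D_t V` that are
forced by the base component. -/
def firstSymbol (q : TT n M) : TangentSpace (ITT n) q →ₗ[ℝ] TangentSpace (IM n) q.proj where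
  toFun w := connV g q w -
    (g.inner q.proj (baseMap n q w) q.2.1 / g.inner q.proj q.2.1 q.2.1) • q.2.2
  map_add' v w := by
    rw [map_add, map_add, map_add, add_apply, add_div]; module
  map_smul' c w := by
    rw [map_smul, map_smul, map_smul, smul_apply, smul_eq_mul, mul_div_assoc, RingHom.id_apply]
    module

lemma firstSymbol_of_baseMap {w : TangentSpace (ITT n) q} (hq : q ∈ curvatureRadiiSet g) {l : ℝ}
    (h : baseMap n q w = l • q.2.1) : firstSymbol g q w = connV g q w - l • q.2.2 := by
  have h3 := ((mem_curvatureRadiiSet_iff g q).1 hq).2.2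
  change connV g q w - (g.inner q.proj (baseMap n q w) q.2.1 / g.inner q.proj q.2.1 q.2.1) • q.2.2 =
    _
  rw [h, map_smul, smul_apply, smul_eq_mul, mul_div_assoc, div_self h3.ne', mul_one]

lemma mem_firstFlag_iff_firstSymbol (hq : q ∈ curvatureRadiiSet g)
    (w : TangentSpace (ITT n) q) :
    w ∈ firstFlag g q ↔ w ∈ secondFlag g q ∧ ∃ a : ℝ, firstSymbol g q w = a • q.2.1 := by
  rw [mem_firstFlag, mem_secondFlag]
  constructor
  · rintro ⟨ht, l, m, h1, h2⟩
    refine ⟨⟨ht, l, h1⟩, m, ?_⟩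
    rw [firstSymbol_of_baseMap hq h1, h2, add_sub_cancel_left]
  · rintro ⟨⟨ht, l, h1⟩, m, h2⟩
    refine ⟨ht, l, m, h1, ?_⟩
    rw [firstSymbol_of_baseMap hq h1] at h2
    rw [← h2, add_sub_cancel]

end PointwiseFlag

/-! ### Brackets of the fields `f_1, …, f_n` -/

section FrameBrackets

variable {n : ℕ} {M : Type*} [TopologicalSpace M] [ChartedSpace (En n) M]
  [IsManifold (IM n) ∞ M]
  {g : ContMDiffRiemannianMetric (IM n) ∞ (En n) (fun x : M => TangentSpace (IM n) x)}
  {W : Set (TT n M)} {b : ℕ → ∀ q : TT n M, TangentSpace (IM n) q.proj}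
  {f : ℕ → ∀ q : TT n M, TangentSpace (ITT n) q} {q : TT n M}

lemma mem_tangentSubmodule_iff (hq : q ∈ curvatureRadiiSet g) {w : TangentSpace (ITT n) q} :
    w ∈ tangentSubmodule g q ↔ w ∈ tangentSet (ITT n) (curvatureRadiiSet g) q := by
  rw [← coe_tangentSubmodule g hq]; rfl

lemma IsAdaptedFrame.baseMap_one (hb : IsOrthFrame g W b) (hf : IsAdaptedFrame g W b f)
    (hn : 2 ≤ n) : ∀ p ∈ W ∩ curvatureRadiiSet g, baseMap n p (f 1 p) = (1 : ℝ) • p.2.1 := by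
  intro p hp
  rw [hf.eq_frameField hb ⟨le_rfl, by omega⟩ hp, frameField_one, baseMap_liftVec, one_smul]

lemma IsAdaptedFrame.connV_one (hb : IsOrthFrame g W b) (hf : IsAdaptedFrame g W b f)
    (hn : 2 ≤ n) : ∀ p ∈ W ∩ curvatureRadiiSet g,
      connV g p (f 1 p) = (1 : ℝ) • p.2.2 + (0 : ℝ) • p.2.1 := by
  intro p hp
  rw [hf.eq_frameField hb ⟨le_rfl, by omega⟩ hp, frameField_one, connV_liftVec, one_smul,
    zero_smul, add_zero]

lemma IsAdaptedFrame.baseMap_of_two_le (hb : IsOrthFrame g W b) (hf : IsAdaptedFrame g W b f)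
    {k : ℕ} (hk : k ∈ Icc 2 n) :
    ∀ p ∈ W ∩ curvatureRadiiSet g, baseMap n p (f k p) = (0 : ℝ) • p.2.1 := by
  intro p hp
  rw [hf.eq_frameField hb ⟨by have := hk.1; omega, hk.2⟩ hp, zero_smul]
  obtain rfl | h : k = 2 ∨ 3 ≤ k := by have := hk.1; omega
  · rw [frameField_two, baseMap_liftVec]
  · rw [frameField_of_three_le h, baseMap_liftVec]

lemma IsAdaptedFrame.connV_of_two_le (hb : IsOrthFrame g W b) (hf : IsAdaptedFrame g W b f)
    {k : ℕ} (hk : k ∈ Icc 2 n) : ∀ p ∈ W ∩ curvatureRadiiSet g,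
      connV g p (f k p) = (0 : ℝ) • p.2.2 + (if k = 2 then (1 : ℝ) else 0) • p.2.1 := by
  intro p hp
  rw [hf.eq_frameField hb ⟨by have := hk.1; omega, hk.2⟩ hp, zero_smul, zero_add]
  obtain rfl | h : k = 2 ∨ 3 ≤ k := by have := hk.1; omega
  · rw [frameField_two, connV_liftVec, if_pos rfl, one_smul]
  · rw [frameField_of_three_le h, connV_liftVec, if_neg (by omega), zero_smul]

lemma IsAdaptedFrame.connR_of_two_le (hb : IsOrthFrame g W b) (hf : IsAdaptedFrame g W b f)
    {k : ℕ} (hk : k ∈ Icc 2 n) : ∀ p ∈ W ∩ curvatureRadiiSet g,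
      connR g p (f k p) = baseFrame b p k := by
  intro p hp
  rw [hf.eq_frameField hb ⟨by have := hk.1; omega, hk.2⟩ hp]
  obtain rfl | h : k = 2 ∨ 3 ≤ k := by have := hk.1; omega
  · rw [frameField_two, connR_liftVec, baseFrame_two]
  · rw [frameField_of_three_le h, connR_liftVec, baseFrame_of_three_le h]

lemma isTangentField_one (hn : 2 ≤ n) (hb : IsOrthFrame g W b) (hf : IsAdaptedFrame g W b f) :
    IsTangentField g W (f 1) := hf.isTangentField hb ⟨le_rfl, by omega⟩

lemma isTangentField_of_two_le (hb : IsOrthFrame g W b) (hf : IsAdaptedFrame g W b f) {k : ℕ}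
    (hk : k ∈ Icc 2 n) : IsTangentField g W (f k) :=
  hf.isTangentField hb ⟨by have := hk.1; omega, hk.2⟩

/-- `[f_1, f_2]` has base component `-V`, and `[f_1, f_k]` is vertical for `k ≥ 3`. -/
lemma baseMap_br_one (hn : 2 ≤ n) (hb : IsOrthFrame g W b) (hf : IsAdaptedFrame g W b f) {k : ℕ}
    (hk : k ∈ Icc 2 n) : ∀ p ∈ W ∩ curvatureRadiiSet g,
      baseMap n p (br (f 1) (f k) p) = (if k = 2 then (-1 : ℝ) else 0) • p.2.1 := by
  intro p hp
  rw [baseMap_br_const (isTangentField_one hn hb hf) (isTangentField_of_two_le hb hf hk)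
    (hf.baseMap_one hb hn) (hf.baseMap_of_two_le hb hk) hp, hf.connV_of_two_le hb hk p hp]
  split_ifs <;> module

/-- The connector component of `[f_1, f_k]` is, up to a multiple of `R` for `k = 2`, the opposite of
the `k`-th vector of the orthogonal basis `V, R, b_3, …, b_n`. -/
lemma connV_br_one (hn : 2 ≤ n) (hb : IsOrthFrame g W b) (hf : IsAdaptedFrame g W b f) {k : ℕ}
    (hk : k ∈ Icc 2 n) : ∀ p ∈ W ∩ curvatureRadiiSet g,
      connV g p (br (f 1) (f k) p) =
        (if k = 2 then (1 : ℝ) else 0) • p.2.2 - baseFrame b p k := by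
  intro p hp
  rw [connV_br (isTangentField_one hn hb hf) (isTangentField_of_two_le hb hf hk)
    (hf.baseMap_one hb hn) (hf.baseMap_of_two_le hb hk) (hf.connV_one hb hn)
    (hf.connV_of_two_le hb hk) hp, hf.connR_of_two_le hb hk p hp, hf.connV_one hb hn p hp]
  module

lemma br_swap (X Y : ∀ q : TT n M, TangentSpace (ITT n) q) (p : TT n M) :
    br X Y p = -br Y X p := VectorField.mlieBracket_swap_apply

/-- The base component of `[f_1, [f_2, f_1]]` is `R`, that of `[f_1, [f_k, f_1]]` is `-b_k`. -/
lemma baseMap_br_one_br (hn : 2 ≤ n) (hb : IsOrthFrame g W b) (hf : IsAdaptedFrame g W b f) {k : ℕ}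
    (hk : k ∈ Icc 2 n) : ∀ p ∈ W ∩ curvatureRadiiSet g,
      baseMap n p (br (f 1) (br (f k) (f 1)) p) =
        (if k = 2 then (1 : ℝ) else -1) • baseFrame b p k := by
  intro p hp
  have h1 : ∀ p ∈ W ∩ curvatureRadiiSet g, baseMap n p (br (f k) (f 1) p) =
      (if k = 2 then (1 : ℝ) else 0) • p.2.1 := by
    intro p hp
    rw [br_swap, map_neg, baseMap_br_one hn hb hf hk p hp]
    split_ifs <;> module
  rw [baseMap_br_const (isTangentField_one hn hb hf)
    ((isTangentField_of_two_le hb hf hk).bracket (isTangentField_one hn hb hf))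
    (hf.baseMap_one hb hn) h1 hp, hf.connV_one hb hn p hp, br_swap, map_neg,
    connV_br_one hn hb hf hk p hp]
  split_ifs with h
  · subst h
    rw [baseFrame_two]
    module
  · module

lemma br_one_mem_secondFlag (hn : 2 ≤ n) (hb : IsOrthFrame g W b) (hf : IsAdaptedFrame g W b f)
    {k : ℕ} (hk : k ∈ Icc 2 n) (hq : q ∈ W ∩ curvatureRadiiSet g) :
    br (f 1) (f k) q ∈ secondFlag g q :=
  mem_secondFlag.2 ⟨(mem_tangentSubmodule_iff hq.2).2
    (((isTangentField_one hn hb hf).bracket (isTangentField_of_two_le hb hf hk)).tangent q hq),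
    _, baseMap_br_one hn hb hf hk q hq⟩

/-- The fields `f_2, …, f_n` are vertical and the connector component of each is a constant multiple
of `V`, and both properties pass to brackets. -/
lemma br_mem_firstFlag (hb : IsOrthFrame g W b) (hf : IsAdaptedFrame g W b f)
    {j k : ℕ} (hj : j ∈ Icc 2 n) (hk : k ∈ Icc 2 n) (hq : q ∈ W ∩ curvatureRadiiSet g) :
    br (f j) (f k) q ∈ firstFlag g q := by
  have hX := isTangentField_of_two_le hb hf hj
  have hY := isTangentField_of_two_le hb hf hk
  refine mem_firstFlag.2 ⟨(mem_tangentSubmodule_iff hq.2).2 ((hX.bracket hY).tangent q hq), 0, 0,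
    ?_, ?_⟩
  · rw [baseMap_br_const hX hY (hf.baseMap_of_two_le hb hj) (hf.baseMap_of_two_le hb hk) hq]
    module
  · rw [connV_br hX hY (hf.baseMap_of_two_le hb hj) (hf.baseMap_of_two_le hb hk)
      (hf.connV_of_two_le hb hj) (hf.connV_of_two_le hb hk) hq, hf.connV_of_two_le hb hj q hq,
      hf.connV_of_two_le hb hk q hq]
    module

/-- The base component of `[f_j, [f_1, f_k]]` is a multiple of the connector component of `f_j`,
hence of `V`. -/
lemma br_br_one_mem_secondFlag (hn : 2 ≤ n) (hb : IsOrthFrame g W b)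
    (hf : IsAdaptedFrame g W b f) {j k : ℕ} (hj : j ∈ Icc 2 n) (hk : k ∈ Icc 2 n)
    (hq : q ∈ W ∩ curvatureRadiiSet g) : br (f j) (br (f 1) (f k)) q ∈ secondFlag g q := by
  have hX := isTangentField_of_two_le hb hf hj
  have hY := (isTangentField_one hn hb hf).bracket (isTangentField_of_two_le hb hf hk)
  refine mem_secondFlag.2 ⟨(mem_tangentSubmodule_iff hq.2).2 ((hX.bracket hY).tangent q hq),
    (if k = 2 then (-1 : ℝ) else 0) * (if j = 2 then (1 : ℝ) else 0), ?_⟩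
  rw [baseMap_br_const hX hY (hf.baseMap_of_two_le hb hj) (baseMap_br_one hn hb hf hk) hq,
    hf.connV_of_two_le hb hj q hq]
  module

/-- The brackets `[f_1, f_k]` complement the first flag in the second: their symbols are, up to sign,
the vectors `R, b_3, …, b_n`. -/
lemma secondFlag_complement (hn : 2 ≤ n) (hb : IsOrthFrame g W b) (hf : IsAdaptedFrame g W b f)
    (hq : q ∈ W ∩ curvatureRadiiSet g) :
    secondFlag g q = firstFlag g q ⊔
      Submodule.span ℝ ((fun k => br (f 1) (f k) q) '' Icc 2 n) ∧
    Disjoint (firstFlag g q) (Submodule.span ℝ ((fun k => br (f 1) (f k) q) '' Icc 2 n)) ∧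
    Module.finrank ℝ (secondFlag g q) = Module.finrank ℝ (firstFlag g q) + (n - 1) := by
  refine complement_of_symbol (by omega) (firstSymbol g q) (e := baseFrame b q)
    (s := fun k => if k = 2 then (1 : ℝ) else -1) (linearIndepOn_baseFrame hb hq)
    (span_baseFrame hb hq) (mem_firstFlag_iff_firstSymbol hq.2)
    (fun k hk => br_one_mem_secondFlag hn hb hf hk hq)
    (fun k _ => by split_ifs <;> norm_num) (fun k hk => ?_)
  rw [firstSymbol_of_baseMap hq.2 (baseMap_br_one hn hb hf hk q hq), connV_br_one hn hb hf hk q hq]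
  split_ifs with h
  · subst h
    rw [baseFrame_two]
    module
  · module

/-- The brackets `[f_1, [f_k, f_1]]` complement the second flag in the tangent space: their base
components are, up to sign, the vectors `R, b_3, …, b_n`. -/
lemma tangentSubmodule_complement (hn : 2 ≤ n) (hb : IsOrthFrame g W b)
    (hf : IsAdaptedFrame g W b f) (hq : q ∈ W ∩ curvatureRadiiSet g) :
    tangentSubmodule g q = secondFlag g q ⊔
      Submodule.span ℝ ((fun k => br (f 1) (br (f k) (f 1)) q) '' Icc 2 n) ∧
    Disjoint (secondFlag g q)
      (Submodule.span ℝ ((fun k => br (f 1) (br (f k) (f 1)) q) '' Icc 2 n)) ∧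
    Module.finrank ℝ (tangentSubmodule g q) = Module.finrank ℝ (secondFlag g q) + (n - 1) := by
  refine complement_of_symbol (by omega) (baseMap n q).toLinearMap (e := baseFrame b q)
    (s := fun k => if k = 2 then (1 : ℝ) else -1) (linearIndepOn_baseFrame hb hq)
    (span_baseFrame hb hq) (fun w => mem_secondFlag)
    (fun k hk => (mem_tangentSubmodule_iff hq.2).2 (((isTangentField_one hn hb hf).bracket
      ((isTangentField_of_two_le hb hf hk).bracket (isTangentField_one hn hb hf))).tangent q hq))
    (fun k _ => by split_ifs <;> norm_num) (fun k hk => baseMap_br_one_br hn hb hf hk q hq)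

end FrameBrackets

/-! ### The flag of the distribution -/

section Flag

variable {n : ℕ} {M : Type*} [TopologicalSpace M] [ChartedSpace (En n) M]
  [IsManifold (IM n) ∞ M]
  (g : ContMDiffRiemannianMetric (IM n) ∞ (En n) (fun x : M => TangentSpace (IM n) x))

lemma contMDiffOn_inner {W : Set (TT n M)} (hW : IsOpen W)
    {u v : ∀ p : TT n M, TangentSpace (IM n) p.proj}
    (hu : ContMDiffOn (ITT n) (IM n).tangent ∞
      (fun p : TT n M => (⟨p.proj, u p⟩ : TangentBundle (IM n) M)) W)
    (hv : ContMDiffOn (ITT n) (IM n).tangent ∞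
      (fun p : TT n M => (⟨p.proj, v p⟩ : TangentBundle (IM n) M)) W) :
    ContMDiffOn (ITT n) 𝓘(ℝ, ℝ) ∞ (fun p => g.inner p.proj (u p) (v p)) W := by
  intro q hq
  have hu' := contMDiffAt_tangent_iff.1 (hu.contMDiffAt (hW.mem_nhds hq))
  have hv' := contMDiffAt_tangent_iff.1 (hv.contMDiffAt (hW.mem_nhds hq))
  have hG : ContMDiffAt (ITT n) 𝓘(ℝ, En n →L[ℝ] En n →L[ℝ] ℝ) ∞
      (fun p : TT n M => chartMetric g q.proj (extChartAt (IM n) q.proj p.proj)) q := by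
    have h1 : ContMDiffAt 𝓘(ℝ, En n) 𝓘(ℝ, En n →L[ℝ] En n →L[ℝ] ℝ) ∞ (chartMetric g q.proj)
        (extChartAt (IM n) q.proj q.proj) := ((contDiffOn_chartMetric g q.proj).contDiffAt
          (extChartAt_target_mem_nhds (I := IM n) q.proj)).contMDiffAt
    have h2 : ContMDiffAt (IM n) 𝓘(ℝ, En n) ∞ (extChartAt (IM n) q.proj) q.proj :=
      contMDiffAt_extChartAt
    exact (h1.comp q.proj h2).comp q (Bundle.contMDiff_proj _ q)
  refine (((hG.clm_apply hu').clm_apply hv').congr_of_eventuallyEq ?_).contMDiffWithinAt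
  filter_upwards [chart_source_mem_nhds (ModelProd (En n) (En n × En n)) q] with p hp
  exact (chartMetric_chartDeriv g (mem_chart_source_TT.1 hp) _ _).symm

variable {g} {W : Set (TT n M)} {X Y : ∀ q : TT n M, TangentSpace (ITT n) q}

lemma contMDiffOn_baseMap
    (g : ContMDiffRiemannianMetric (IM n) ∞ (En n) (fun x : M => TangentSpace (IM n) x)) (hW : IsOpen W) (hX : IsSmoothFieldOn (ITT n) X W) :
    ContMDiffOn (ITT n) (IM n).tangent ∞
      (fun p : TT n M => (⟨p.proj, baseMap n p (X p)⟩ : TangentBundle (IM n) M)) W := by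
  intro q hq
  refine (contMDiffAt_tangent_iff.2 ?_).contMDiffWithinAt
  have h1 : ContMDiffAt 𝓘(ℝ, En n × En n × En n) 𝓘(ℝ, En n × En n × En n) ∞
      (coordField (ITT n) q X) (extChartAt (ITT n) q q) :=
    ((contDiffOn_coordField q hW hX).contDiffAt ((isOpen_extChartAt_symm_preimage q hW).mem_nhds
      (extChartAt_mem_target_inter hq))).contMDiffAt
  have h2 : ContMDiffAt (ITT n) 𝓘(ℝ, En n × En n × En n) ∞
      (fun p => coordField (ITT n) q X (extChartAt (ITT n) q p)) q :=
    h1.comp q contMDiffAt_extChartAt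
  have h3 := (ContinuousLinearMap.fst ℝ (En n) (En n × En n)).contDiff.contMDiff.contMDiffAt.comp q
    h2
  refine h3.congr_of_eventuallyEq ?_
  filter_upwards [chart_source_mem_nhds (ModelProd (En n) (En n × En n)) q] with p hp
  rw [Function.comp_apply, coordField_extChartAt hp]
  exact (congrArg Prod.fst (chartDeriv_TT g (mem_chart_source_TT.1 hp) (X p))).symm

/-- The smooth coefficient `l` of a tangent field with base component `l V`. -/
lemma exists_contMDiffOn_coeff (hX : IsSmoothFieldOn (ITT n) X W) (hW : IsOpen W)
    (h : ∀ p ∈ W ∩ curvatureRadiiSet g, ∃ l : ℝ, baseMap n p (X p) = l • p.2.1) :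
    ∃ l : TT n M → ℝ, ContMDiffOn (ITT n) 𝓘(ℝ, ℝ) ∞ l (W ∩ regularSet g) ∧
      ∀ p ∈ (W ∩ regularSet g) ∩ curvatureRadiiSet g, baseMap n p (X p) = l p • p.2.1 := by
  have hW' := hW.inter (isOpen_regularSet g)
  refine ⟨fun p => g.inner p.proj (baseMap n p (X p)) p.2.1 / g.inner p.proj p.2.1 p.2.1,
    ContMDiffOn.div₀ (contMDiffOn_inner g hW' (contMDiffOn_baseMap g hW'
      (hX.mono inter_subset_left)) contMDiff_fibreV.contMDiffOn)
      ((inner_VV_contMDiff_and_mfderiv g).1.contMDiffOn) fun p hp => (ne_of_gt hp.2),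
    fun p hp => ?_⟩
  obtain ⟨l, hl⟩ := h p ⟨hp.1.1, hp.2⟩
  have hV : 0 < g.inner p.proj p.2.1 p.2.1 := hp.1.2
  beta_reduce
  rw [hl, map_smul, smul_apply, smul_eq_mul, mul_div_assoc, div_self hV.ne', mul_one]

/-- Brackets of sections of the distribution have base component in the span of `V`: the term
`D_t V` of a section is a combination of `R` and `V` whose `R`-coefficient is that of the base
component, so that the contributions along `R` cancel. -/
lemma br_mem_secondFlag {V₁ V₂ : Set (TT n M)} (hV₁ : IsOpen V₁) (hV₂ : IsOpen V₂)
    (hXs : IsSmoothFieldOn (ITT n) X V₁) (hYs : IsSmoothFieldOn (ITT n) Y V₂)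
    (hX : ∀ p ∈ V₁ ∩ curvatureRadiiSet g, X p ∈ firstFlag g p)
    (hY : ∀ p ∈ V₂ ∩ curvatureRadiiSet g, Y p ∈ firstFlag g p) {q : TT n M}
    (hq₁ : q ∈ V₁) (hq₂ : q ∈ V₂) (hq : q ∈ curvatureRadiiSet g) : br X Y q ∈ secondFlag g q := by
  obtain ⟨lX, hlX, hXl⟩ := exists_contMDiffOn_coeff hXs hV₁ fun p hp =>
    (mem_secondFlag.1 (firstFlag_le_secondFlag p (hX p hp))).2
  obtain ⟨lY, hlY, hYl⟩ := exists_contMDiffOn_coeff hYs hV₂ fun p hp =>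
    (mem_secondFlag.1 (firstFlag_le_secondFlag p (hY p hp))).2
  have hO : IsOpen ((V₁ ∩ regularSet g) ∩ (V₂ ∩ regularSet g)) :=
    (hV₁.inter (isOpen_regularSet g)).inter (hV₂.inter (isOpen_regularSet g))
  have hqO : q ∈ ((V₁ ∩ regularSet g) ∩ (V₂ ∩ regularSet g)) ∩ curvatureRadiiSet g :=
    ⟨⟨⟨hq₁, mem_regularSet g hq⟩, ⟨hq₂, mem_regularSet g hq⟩⟩, hq⟩
  have htX : IsTangentField g ((V₁ ∩ regularSet g) ∩ (V₂ ∩ regularSet g)) X :=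
    ⟨hO, hXs.mono fun p hp => hp.1.1,
      fun p hp => (mem_tangentSubmodule_iff hp.2).1 (hX p ⟨hp.1.1.1, hp.2⟩).1⟩
  have htY : IsTangentField g ((V₁ ∩ regularSet g) ∩ (V₂ ∩ regularSet g)) Y :=
    ⟨hO, hYs.mono fun p hp => hp.2.1,
      fun p hp => (mem_tangentSubmodule_iff hp.2).1 (hY p ⟨hp.1.2.1, hp.2⟩).1⟩
  have hbase := baseMap_br htX htY (hlX.mono inter_subset_left) (hlY.mono inter_subset_right)
    (fun p hp => hXl p ⟨hp.1.1, hp.2⟩) (fun p hp => hYl p ⟨hp.1.2, hp.2⟩) hqO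
  have hVne : (q.2.1 : TangentSpace (IM n) q.proj) ≠ 0 :=
    (gnorm_pos g).1 hq.2.2
  obtain ⟨-, l, m, h1, h2⟩ := hX q ⟨hq₁, hq⟩
  obtain ⟨-, l', m', h1', h2'⟩ := hY q ⟨hq₂, hq⟩
  have e1 : lX q = l := smul_left_injective ℝ hVne ((hXl q ⟨hqO.1.1, hq⟩).symm.trans h1)
  have e2 : lY q = l' := smul_left_injective ℝ hVne ((hYl q ⟨hqO.1.2, hq⟩).symm.trans h1')
  refine mem_secondFlag.2 ⟨(mem_tangentSubmodule_iff hq).2 ((htX.bracket htY).tangent q hqO),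
    scalarDeriv lY q (X q) - scalarDeriv lX q (Y q) + l' * m - l * m', ?_⟩
  rw [hbase, h2, h2', e1, e2]
  module

lemma br_mem_tangentSubmodule {V₁ V₂ : Set (TT n M)} (hV₁ : IsOpen V₁) (hV₂ : IsOpen V₂)
    (hXs : IsSmoothFieldOn (ITT n) X V₁) (hYs : IsSmoothFieldOn (ITT n) Y V₂)
    (hX : ∀ p ∈ V₁ ∩ curvatureRadiiSet g, X p ∈ tangentSubmodule g p)
    (hY : ∀ p ∈ V₂ ∩ curvatureRadiiSet g, Y p ∈ tangentSubmodule g p) {q : TT n M}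
    (hq₁ : q ∈ V₁) (hq₂ : q ∈ V₂) (hq : q ∈ curvatureRadiiSet g) :
    br X Y q ∈ tangentSubmodule g q := by
  have htX : IsTangentField g (V₁ ∩ V₂) X := ⟨hV₁.inter hV₂, hXs.mono inter_subset_left,
    fun p hp => (mem_tangentSubmodule_iff hp.2).1 (hX p ⟨hp.1.1, hp.2⟩)⟩
  have htY : IsTangentField g (V₁ ∩ V₂) Y := ⟨hV₁.inter hV₂, hYs.mono inter_subset_right,
    fun p hp => (mem_tangentSubmodule_iff hp.2).1 (hY p ⟨hp.1.2, hp.2⟩)⟩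
  exact (mem_tangentSubmodule_iff hq).2 ((htX.bracket htY).tangent q ⟨⟨hq₁, hq₂⟩, hq⟩)

variable {Δ : ∀ q : TT n M, Submodule ℝ (TangentSpace (ITT n) q)}
  {b : ℕ → ∀ q : TT n M, TangentSpace (IM n) q.proj}

lemma isLocalSectionAt_frameField (hΔ : ∀ p ∈ curvatureRadiiSet g, Δ p = firstFlag g p)
    (hb : IsOrthFrame g W b) {q : TT n M} (hq : q ∈ W) {k : ℕ} (hk : k ∈ Icc 1 n) :
    IsLocalSectionAt (ITT n) (curvatureRadiiSet g) Δ q (frameField g b k) :=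
  ⟨W, hb.isOpen, hq, isSmoothFieldOn_frameField hb hk, fun p hp => by
    rw [hΔ p hp.2]; exact frameField_mem_firstFlag hb hp hk⟩

lemma bracketFlag_two (hn : 2 ≤ n) (hΔ : ∀ p ∈ curvatureRadiiSet g, Δ p = firstFlag g p)
    (hb : IsOrthFrame g W b) {q : TT n M} (hq : q ∈ W ∩ curvatureRadiiSet g) :
    bracketFlag (ITT n) (curvatureRadiiSet g) Δ 2 q = secondFlag g q := by
  change Δ q ⊔ Submodule.span ℝ _ = _
  rw [hΔ q hq.2]
  refine le_antisymm (sup_le (firstFlag_le_secondFlag q) (Submodule.span_le.2 ?_)) ?_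
  · rintro _ ⟨X, Y, ⟨V₁, hV₁, hq₁, hXs, hX⟩, ⟨V₂, hV₂, hq₂, hYs, hY⟩, rfl⟩
    exact br_mem_secondFlag hV₁ hV₂ hXs hYs (fun p hp => hΔ p hp.2 ▸ hX p hp)
      (fun p hp => hΔ p hp.2 ▸ hY p hp) hq₁ hq₂ hq.2
  · rw [(secondFlag_complement hn hb (isAdaptedFrame_frameField hb) hq).1]
    refine sup_le_sup_left (Submodule.span_mono ?_) _
    rintro _ ⟨k, hk, rfl⟩
    exact ⟨_, _, isLocalSectionAt_frameField hΔ hb hq.1 ⟨le_rfl, by omega⟩,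
      isLocalSectionAt_frameField hΔ hb hq.1 ⟨by have := hk.1; omega, hk.2⟩, rfl⟩

lemma bracketFlag_three (hn : 2 ≤ n) (hΔ : ∀ p ∈ curvatureRadiiSet g, Δ p = firstFlag g p)
    (hfr : ∀ p ∈ curvatureRadiiSet g, ∃ (W : Set (TT n M))
      (b : ℕ → ∀ q : TT n M, TangentSpace (IM n) q.proj), p ∈ W ∧ IsOrthFrame g W b)
    {q : TT n M} (hq : q ∈ curvatureRadiiSet g) :
    bracketFlag (ITT n) (curvatureRadiiSet g) Δ 3 q = tangentSubmodule g q := by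
  have h2 : ∀ p ∈ curvatureRadiiSet g,
      bracketFlag (ITT n) (curvatureRadiiSet g) Δ 2 p = secondFlag g p := fun p hp => by
    obtain ⟨W, b, hpW, hb⟩ := hfr p hp
    exact bracketFlag_two hn hΔ hb ⟨hpW, hp⟩
  obtain ⟨W, b, hqW, hb⟩ := hfr q hq
  have hf := isAdaptedFrame_frameField hb
  change bracketFlag (ITT n) (curvatureRadiiSet g) Δ 2 q ⊔ Submodule.span ℝ _ = _
  rw [h2 q hq]
  refine le_antisymm (sup_le inf_le_left (Submodule.span_le.2 ?_)) ?_
  · rintro _ ⟨X, Y, ⟨V₁, hV₁, hq₁, hXs, hX⟩, ⟨V₂, hV₂, hq₂, hYs, hY⟩, rfl⟩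
    exact br_mem_tangentSubmodule hV₁ hV₂ hXs hYs
      (fun p hp => (mem_firstFlag.1 (hΔ p hp.2 ▸ hX p hp)).1)
      (fun p hp => (mem_secondFlag.1 (h2 p hp.2 ▸ hY p hp)).1) hq₁ hq₂ hq
  · rw [(tangentSubmodule_complement hn hb hf ⟨hqW, hq⟩).1]
    refine sup_le_sup_left (Submodule.span_mono ?_) _
    rintro _ ⟨k, hk, rfl⟩
    have hk' : k ∈ Icc 1 n := ⟨by have := hk.1; omega, hk.2⟩
    have hX := isTangentField_of_two_le hb hf hk
    have hY := isTangentField_one hn hb hf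
    refine ⟨_, _, isLocalSectionAt_frameField hΔ hb hqW ⟨le_rfl, by omega⟩,
      ⟨W, hb.isOpen, hqW, (hX.bracket hY).smooth, fun p hp => ?_⟩, rfl⟩
    rw [h2 p hp.2]
    exact br_mem_secondFlag hb.isOpen hb.isOpen hX.smooth hY.smooth
      (fun p hp => frameField_mem_firstFlag hb hp hk')
      (fun p hp => frameField_mem_firstFlag hb hp ⟨le_rfl, by omega⟩) hp.1 hp.1 hp.2

end Flag

/-! ### Smooth vector fields along curves -/

section AlongCurve

variable {n : ℕ} {M : Type*} [TopologicalSpace M] [ChartedSpace (En n) M]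

/-- Instance shortcuts that keep typeclass search short. -/
local instance : NormedAddCommGroup (En n →L[ℝ] En n →L[ℝ] ℝ) :=
  ContinuousLinearMap.toNormedAddCommGroup

local instance : NormedAddCommGroup (En n →L[ℝ] En n →L[ℝ] En n) :=
  ContinuousLinearMap.toNormedAddCommGroup

/-- The vector field `X` along the curve `c` is smooth: its components in the chart at any `c t₀` are
smooth near `t₀`. -/
def SmoothAlong (c : ℝ → M) (X : ∀ t, TangentSpace (IM n) (c t)) (s : Set ℝ) : Prop :=
  ∀ t₀ ∈ s, ContDiffWithinAt ℝ ∞ (fun t => chartDeriv (IM n) (c t₀) (c t) (X t)) s t₀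

variable {c : ℝ → M} {X Y : ∀ t, TangentSpace (IM n) (c t)} {s : Set ℝ}

lemma eventually_mem_chart_source (hc : IsSmoothCurve (IM n) c s) {t₀ : ℝ} (ht₀ : t₀ ∈ s) :
    ∀ᶠ t in 𝓝[s] t₀, c t ∈ (chartAt (En n) (c t₀)).source :=
  (hc t₀ ht₀).continuousWithinAt.eventually (chart_source_mem_nhds _ _)

lemma SmoothAlong.smul {a : ℝ → ℝ} (ha : ContDiffOn ℝ ∞ a s) (hX : SmoothAlong c X s) :
    SmoothAlong c (fun t => a t • X t) s := fun t₀ ht₀ =>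
  ((ha t₀ ht₀).smul (hX t₀ ht₀)).congr (fun _ _ => map_smul _ _ _) (map_smul _ _ _)

lemma SmoothAlong.sub (hX : SmoothAlong c X s) (hY : SmoothAlong c Y s) :
    SmoothAlong c (fun t => X t - Y t) s := fun t₀ ht₀ =>
  ((hX t₀ ht₀).sub (hY t₀ ht₀)).congr (fun _ _ => map_sub _ _ _) (map_sub _ _ _)

lemma contDiffWithinAt_extChartAt_curve (hc : IsSmoothCurve (IM n) c s) {t₀ : ℝ} (ht₀ : t₀ ∈ s) :
    ContDiffWithinAt ℝ ∞ (fun t => extChartAt (IM n) (c t₀) (c t)) s t₀ := by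
  have h : ContMDiffAt (IM n) 𝓘(ℝ, En n) ∞ (extChartAt (IM n) (c t₀)) (c t₀) :=
    contMDiffAt_extChartAt
  exact (h.comp_contMDiffWithinAt t₀ (hc t₀ ht₀)).contDiffWithinAt

variable [IsManifold (IM n) ∞ M]

lemma smoothAlong_velocity (hs : UniqueDiffOn ℝ s) (hc : IsSmoothCurve (IM n) c s) :
    SmoothAlong c (velocity (IM n) c s) s := by
  intro t₀ ht₀
  have h1 := ((contDiffWithinAt_extChartAt_curve hc ht₀).fderivWithin_right (m := ∞) hs (by simp)
    ht₀).clm_apply (contDiffWithinAt_const (c := (1 : ℝ)))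
  refine h1.congr_of_eventuallyEq_of_mem ?_ ht₀
  filter_upwards [eventually_mem_chart_source hc ht₀, self_mem_nhdsWithin] with t ht hts
  have h2 := hasDerivWithinAt_extChartAt_comp ((hc t hts).mdifferentiableWithinAt (by simp)) ht
  exact (h2.derivWithin (hs t hts)).symm

lemma isSmoothCurve_TT_iff {σ : ℝ → TT n M} : IsSmoothCurve (ITT n) σ s ↔
    IsSmoothCurve (IM n) (fun t => (σ t).proj) s ∧
      SmoothAlong (fun t => (σ t).proj) (fun t => (σ t).2.1) s ∧
      SmoothAlong (fun t => (σ t).proj) (fun t => (σ t).2.2) s := by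
  have key : IsSmoothCurve (IM n) (fun t => (σ t).proj) s → ∀ t₀ ∈ s,
      (ContMDiffWithinAt 𝓘(ℝ, ℝ) 𝓘(ℝ, En n × En n) ∞ (fun t => (trivializationAt (En n × En n)
        (fun x : M => TangentSpace (IM n) x × TangentSpace (IM n) x) (σ t₀).proj (σ t)).2) s t₀ ↔
      ContDiffWithinAt ℝ ∞ (fun t => (chartDeriv (IM n) (σ t₀).proj (σ t).proj (σ t).2.1,
        chartDeriv (IM n) (σ t₀).proj (σ t).proj (σ t).2.2)) s t₀) := by
    intro hc t₀ ht₀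
    rw [contMDiffWithinAt_iff_contDiffWithinAt]
    have heq : (fun t => (trivializationAt (En n × En n)
        (fun x : M => TangentSpace (IM n) x × TangentSpace (IM n) x) (σ t₀).proj (σ t)).2)
        =ᶠ[𝓝[s] t₀] fun t => (chartDeriv (IM n) (σ t₀).proj (σ t).proj (σ t).2.1,
          chartDeriv (IM n) (σ t₀).proj (σ t).proj (σ t).2.2) := by
      filter_upwards [eventually_mem_chart_source hc ht₀] with t ht
      rw [chartDeriv_eq_trivializationAt ht, chartDeriv_eq_trivializationAt ht]
      rfl
    exact ⟨fun h => h.congr_of_eventuallyEq_of_mem heq.symm ht₀,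
      fun h => h.congr_of_eventuallyEq_of_mem heq ht₀⟩
  constructor
  · intro h
    have hc := h.proj
    have h2 := fun t₀ ht₀ => (key hc t₀ ht₀).1 (contMDiffWithinAt_totalSpace.1 (h t₀ ht₀)).2
    exact ⟨hc, fun t₀ ht₀ => (h2 t₀ ht₀).fst, fun t₀ ht₀ => (h2 t₀ ht₀).snd⟩
  · rintro ⟨hc, hV, hR⟩ t₀ ht₀
    exact contMDiffWithinAt_totalSpace.2 ⟨hc t₀ ht₀,
      (key hc t₀ ht₀).2 ((hV t₀ ht₀).prodMk (hR t₀ ht₀))⟩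

variable (g : ContMDiffRiemannianMetric (IM n) ∞ (En n) (fun x : M => TangentSpace (IM n) x))

lemma SmoothAlong.contDiffOn_inner (hc : IsSmoothCurve (IM n) c s) (hX : SmoothAlong c X s)
    (hY : SmoothAlong c Y s) : ContDiffOn ℝ ∞ (fun t => g.inner (c t) (X t) (Y t)) s := by
  intro t₀ ht₀
  have h1 : ContDiffWithinAt ℝ ∞ (chartMetric g (c t₀) ∘ fun t => extChartAt (IM n) (c t₀) (c t))
      s t₀ := ((contDiffOn_chartMetric g (c t₀)).contDiffAt
    (extChartAt_target_mem_nhds (I := IM n) (c t₀))).comp_contDiffWithinAt t₀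
      (contDiffWithinAt_extChartAt_curve hc ht₀)
  refine ((h1.clm_apply (hX t₀ ht₀)).clm_apply (hY t₀ ht₀)).congr_of_eventuallyEq_of_mem ?_ ht₀
  filter_upwards [eventually_mem_chart_source hc ht₀] with t ht
  exact (chartMetric_chartDeriv g ht _ _).symm

lemma SmoothAlong.contDiffOn_gnorm (hc : IsSmoothCurve (IM n) c s) (hX : SmoothAlong c X s)
    (h0 : ∀ t ∈ s, X t ≠ 0) : ContDiffOn ℝ ∞ (fun t => gnorm g (X t)) s :=
  (hX.contDiffOn_inner g hc hX).sqrt fun t ht => (g.pos _ _ (h0 t ht)).ne'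

/-- The covariant derivative in the chart at `x₀`. -/
lemma hasDerivWithinAt_chartDeriv_curve (hs : UniqueDiffOn ℝ s) (hc : IsSmoothCurve (IM n) c s)
    (hX : SmoothAlong c X s) {t : ℝ} (ht : t ∈ s) {x₀ : M}
    (hx₀ : c t ∈ (chartAt (En n) x₀).source) :
    HasDerivWithinAt (fun τ => chartDeriv (IM n) x₀ (c τ) (X τ))
      (chartDeriv (IM n) x₀ (c t) (covDeriv g c X s t) -
        christoffelMap (chartMetric g x₀) (extChartAt (IM n) x₀ (c t))
          (chartDeriv (IM n) x₀ (c t) (velocity (IM n) c s t))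
          (chartDeriv (IM n) x₀ (c t) (X t))) s t := by
  let σ : ℝ → TT n M := fun τ => ⟨c τ, (X τ, X τ)⟩
  let q₀ : TT n M := ⟨x₀, (0, 0)⟩
  have hσ : IsSmoothCurve (ITT n) σ s := isSmoothCurve_TT_iff.2 ⟨hc, hX, hX⟩
  have hd := (hσ t ht).mdifferentiableWithinAt (by simp)
  have h1 := hasDerivWithinAt_extChartAt_comp (q := q₀) hd (mem_chart_source_TT.2 hx₀)
  have e1 := baseMap_velocity (hs t ht) hd
  have e2 := connV_velocity g (hs t ht) hd
  have e3 := chartDeriv_TT (q₀ := q₀) g (p := σ t) hx₀ (velocity (ITT n) σ s t)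
  rw [e1, e2] at e3
  rw [e3] at h1
  have h2 := h1.hasFDerivWithinAt.snd.fst.hasDerivWithinAt
  simp only [ContinuousLinearMap.comp_apply, ContinuousLinearMap.toSpanSingleton_apply_one,
      ContinuousLinearMap.coe_fst', ContinuousLinearMap.coe_snd'] at h2
  have hnear : ∀ᶠ τ in 𝓝[s] t, c τ ∈ (chartAt (En n) x₀).source :=
    (hc t ht).continuousWithinAt.eventually ((chartAt (En n) x₀).open_source.mem_nhds hx₀)
  refine h2.congr_of_eventuallyEq_of_mem ?_ ht
  filter_upwards [hnear] with τ hτ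
  rw [extChartAt_TT (q₀ := q₀) (p := σ τ) hτ]

lemma SmoothAlong.covDeriv (hs : UniqueDiffOn ℝ s) (hc : IsSmoothCurve (IM n) c s)
    (hX : SmoothAlong c X s) : SmoothAlong c (covDeriv g c X s) s := by
  intro t₀ ht₀
  have h1 := ((hX t₀ ht₀).fderivWithin_right (m := ∞) hs (by simp) ht₀).clm_apply
    (contDiffWithinAt_const (c := (1 : ℝ)))
  have h2 : ContDiffWithinAt ℝ ∞ (christoffelMap (chartMetric g (c t₀)) ∘
      fun t => extChartAt (IM n) (c t₀) (c t)) s t₀ := ((contDiffOn_christoffel_chartMetric g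
        (c t₀)).contDiffAt (extChartAt_target_mem_nhds (I := IM n) (c t₀))).comp_contDiffWithinAt t₀
      (contDiffWithinAt_extChartAt_curve hc ht₀)
  have h3 := h1.add ((h2.clm_apply (smoothAlong_velocity hs hc t₀ ht₀)).clm_apply (hX t₀ ht₀))
  refine h3.congr_of_eventuallyEq_of_mem ?_ ht₀
  filter_upwards [eventually_mem_chart_source hc ht₀, self_mem_nhdsWithin] with t ht hts
  have h4 := (hasDerivWithinAt_chartDeriv_curve g hs hc hX hts ht).derivWithin (hs t hts)
  exact (eq_sub_iff_add_eq.1 h4).symm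

lemma covDeriv_congr {t : ℝ} (ht : t ∈ s) (h : ∀ τ ∈ s, Y τ = X τ) :
    covDeriv g c Y s t = covDeriv g c X s t := by
  have h1 : coordDeriv c Y s t = coordDeriv c X s t := by
    have h2 : ∀ τ ∈ s, (trivializationAt (En n) (fun x : M => TangentSpace (IM n) x) (c t)
        ⟨c τ, Y τ⟩).2 = (trivializationAt (En n) (fun x : M => TangentSpace (IM n) x) (c t)
        ⟨c τ, X τ⟩).2 := fun τ hτ => by rw [h τ hτ]
    exact derivWithin_congr h2 (h2 t ht)
  rw [CurvatureRadii.covDeriv, CurvatureRadii.covDeriv, h1, h t ht]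

/-- The Leibniz rule for the covariant derivative. -/
lemma covDeriv_smul (hs : UniqueDiffOn ℝ s) (hc : IsSmoothCurve (IM n) c s)
    (hX : SmoothAlong c X s) {a : ℝ → ℝ} (ha : ContDiffOn ℝ ∞ a s) {t : ℝ} (ht : t ∈ s) :
    covDeriv g c (fun τ => a τ • X τ) s t =
      derivWithin a s t • X t + a t • covDeriv g c X s t := by
  have h1 := hasDerivWithinAt_chartDeriv_curve g hs hc hX ht (mem_chart_source (En n) (c t))
  have h2 := hasDerivWithinAt_chartDeriv_curve g hs hc (hX.smul ha) ht
    (mem_chart_source (En n) (c t))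
  have h3 := (((ha t ht).differentiableWithinAt (by simp)).hasDerivWithinAt).smul h1
  have h4 := (hs t ht).eq_deriv _ h2 (h3.congr (fun τ _ => map_smul _ _ _) (map_smul _ _ _))
  simp only [chartDeriv_self] at h4
  have gen : ∀ (Γ : En n →L[ℝ] En n →L[ℝ] En n) (A B T Z : En n) (r r' : ℝ),
      A - Γ T (r • Z) = r • (B - Γ T Z) + r' • Z → A = r' • Z + r • B := by
    intro Γ A B T Z r r' h
    rw [map_smul, smul_sub, sub_eq_iff_eq_add] at h
    rw [h]; abel
  exact gen _ _ _ _ _ _ _ h4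

end AlongCurve

/-! ### The lifts are the regular integral curves of the first flag -/

section Lifts

variable {n : ℕ} {M : Type*} [TopologicalSpace M] [ChartedSpace (En n) M]
  [IsManifold (IM n) ∞ M]
  (g : ContMDiffRiemannianMetric (IM n) ∞ (En n) (fun x : M => TangentSpace (IM n) x))

lemma gnorm_smul {x : M} (a : ℝ) (v : TangentSpace (IM n) x) :
    gnorm g (a • v) = |a| * gnorm g v := by
  rw [gnorm, gnorm, map_smul, map_smul, smul_apply, smul_eq_mul, smul_eq_mul, ← mul_assoc,
    Real.sqrt_mul' _ (inner_self_nonneg g x v), Real.sqrt_mul_self_eq_abs]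

/-- Curves that agree on `s` have the same velocities there; since these live in tangent spaces that
are only propositionally equal, this is stated as a principle for transferring predicates. -/
lemma velocity_congr_pred (P : ∀ q : TT n M, TangentSpace (ITT n) q → Prop) {σ τ : ℝ → TT n M}
    {s : Set ℝ} (h : ∀ t ∈ s, σ t = τ t) {t : ℝ} (ht : t ∈ s)
    (hP : P (τ t) (velocity (ITT n) τ s t)) : P (σ t) (velocity (ITT n) σ s t) := by
  have gen : ∀ (x y : TT n M) (v w : En n × En n × En n), x = y → v = w → P y w → P x v := by
    rintro x _ v _ rfl rfl h; exact h
  have h1 : mfderivWithin 𝓘(ℝ, ℝ) (ITT n) σ s t = mfderivWithin 𝓘(ℝ, ℝ) (ITT n) τ s t :=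
    mfderivWithin_congr h (h t ht)
  exact gen _ _ _ _ (h t ht) (DFunLike.congr_fun h1 (1 : ℝ)) hP

lemma normal_part_smul {E : Type*} [AddCommGroup E] [Module ℝ E] {A T V D : E}
    {l l' x y vv dv : ℝ} (hl : l ≠ 0) (hv : vv ≠ 0) (hT : T = l • V) (hA : A = l' • V + l • D)
    (hx : x = l * (l' * vv + l * dv)) (hy : y = l * (l * vv)) :
    A - (x / y) • T = l • (D - (dv / vv) • V) := by
  have h : x / y * l = l' + l * (dv / vv) := by rw [hx, hy]; field_simp
  rw [hT, hA, smul_smul, h]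
  module

section

variable {c : ℝ → M} {V : ∀ t, TangentSpace (IM n) (c t)} {s : Set ℝ} {l : ℝ → ℝ}

/-- If the velocity of `c` is a multiple of `V`, the normal acceleration is the corresponding
multiple of the normal part of `D_t V`. -/
lemma normalAcc_eq_of_velocity_eq_smul (hs : UniqueDiffOn ℝ s) (hc : IsSmoothCurve (IM n) c s)
    (hV : SmoothAlong c V s) (hl : ContDiffOn ℝ ∞ l s)
    (hT : ∀ t ∈ s, velocity (IM n) c s t = l t • V t) {t : ℝ} (ht : t ∈ s) (hl0 : l t ≠ 0)
    (hV0 : V t ≠ 0) :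
    normalAcc g c s t = l t • (covDeriv g c V s t -
      (g.inner (c t) (covDeriv g c V s t) (V t) / g.inner (c t) (V t) (V t)) • V t) := by
  have hA : covDeriv g c (velocity (IM n) c s) s t =
      derivWithin l s t • V t + l t • covDeriv g c V s t := by
    rw [covDeriv_congr g ht hT, covDeriv_smul g hs hc hV hl ht]
  have hT' := hT t ht
  refine normal_part_smul hl0 (g.pos _ _ hV0).ne' hT' hA ?_ ?_
  · rw [hA, hT']
    simp only [map_add, map_smul, add_apply, smul_apply, smul_eq_mul]
  · rw [hT']
    simp only [map_smul, smul_apply, smul_eq_mul]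

lemma inner_normalAcc_velocity (hreg : velocity (IM n) c s t ≠ 0) :
    g.inner (c t) (normalAcc g c s t) (velocity (IM n) c s t) = 0 := by
  rw [normalAcc, map_sub, map_smul, sub_apply, smul_apply, smul_eq_mul,
    div_mul_cancel₀ _ (g.pos _ _ hreg).ne', sub_self]

end

/-- The lifts are smooth, take values in the manifold of curvature radii, and are tangent to the
first flag: `D_t V` is a combination of `R` and `V` because `R` is a multiple of the normal part of
the acceleration. -/
lemma curvatureLift_spec {c : ℝ → M} {ε : ℝ} {s : Set ℝ} (hs : UniqueDiffOn ℝ s)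
    (hc : IsSmoothCurve (IM n) c s)
    (hreg : IsRegularCurve n c s) (hκ : ∀ t ∈ s, geodCurvature g c s t ≠ 0) (hε : |ε| = 1) :
    IsSmoothCurve (ITT n) (curvatureLift g ε c s) s ∧ ∀ t ∈ s,
      curvatureLift g ε c s t ∈ curvatureRadiiSet g ∧
      velocity (ITT n) (curvatureLift g ε c s) s t ∈ firstFlag g (curvatureLift g ε c s t) := by
  have hε0 : ε ≠ 0 := by rintro rfl; simp at hε
  have hN : ∀ t ∈ s, normalAcc g c s t ≠ 0 := fun t ht h0 => hκ t ht (by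
    rw [geodCurvature, h0, gnorm, map_zero, Real.sqrt_zero, zero_div])
  have hNpos : ∀ t ∈ s, 0 < gnorm g (normalAcc g c s t) := fun t ht => (gnorm_pos g).2 (hN t ht)
  have hTpos : ∀ t ∈ s, 0 < gnorm g (velocity (IM n) c s t) := fun t ht =>
    (gnorm_pos g).2 (hreg t ht)
  have hκpos : ∀ t ∈ s, 0 < geodCurvature g c s t := fun t ht =>
    div_pos (hNpos t ht) (pow_pos (hTpos t ht) 2)
  have hρ : ∀ t ∈ s, gnorm g (curvatureRadius g c s t) = 1 / geodCurvature g c s t := by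
    intro t ht
    rw [curvatureRadius, gnorm_smul, gnorm_smul, abs_of_pos (one_div_pos.2 (hκpos t ht)),
      abs_of_pos (one_div_pos.2 (hNpos t ht)), one_div_mul_cancel (hNpos t ht).ne', mul_one]
  have sT := smoothAlong_velocity hs hc
  have sA := sT.covDeriv g hs hc
  have sN : SmoothAlong c (normalAcc g c s) s :=
    sA.sub (sT.smul ((sA.contDiffOn_inner g hc sT).div (sT.contDiffOn_inner g hc sT)
      fun t ht => (g.pos _ _ (hreg t ht)).ne'))
  have sgN := sN.contDiffOn_gnorm g hc hN
  have sgT := sT.contDiffOn_gnorm g hc hreg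
  have sκ : ContDiffOn ℝ ∞ (geodCurvature g c s) s :=
    sgN.div (sgT.pow 2) fun t ht => (pow_pos (hTpos t ht) 2).ne'
  have sρ : SmoothAlong c (curvatureRadius g c s) s :=
    (sN.smul (contDiffOn_const.div sgN fun t ht => (hNpos t ht).ne')).smul
      (contDiffOn_const.div sκ hκ)
  have hρ0 : ∀ t ∈ s, 0 < gnorm g (curvatureRadius g c s t) := fun t ht => by
    rw [hρ t ht]; exact one_div_pos.2 (hκpos t ht)
  have sgρ := sρ.contDiffOn_gnorm g hc fun t ht => (gnorm_pos g).1 (hρ0 t ht)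
  have sa : ContDiffOn ℝ ∞ (fun t => ε * gnorm g (curvatureRadius g c s t) /
      gnorm g (velocity (IM n) c s t)) s :=
    (contDiffOn_const.mul sgρ).div sgT fun t ht => (hTpos t ht).ne'
  have ha0 : ∀ t ∈ s, ε * gnorm g (curvatureRadius g c s t) /
      gnorm g (velocity (IM n) c s t) ≠ 0 := fun t ht =>
    div_ne_zero (mul_ne_zero hε0 (hρ0 t ht).ne') (hTpos t ht).ne'
  have sV := sT.smul sa
  have hsm : IsSmoothCurve (ITT n) (curvatureLift g ε c s) s :=
    isSmoothCurve_TT_iff.2 ⟨hc, sV, sρ⟩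
  have hmem : ∀ t ∈ s, curvatureLift g ε c s t ∈ curvatureRadiiSet g := by
    intro t ht
    have hnorm : gnorm g ((ε * gnorm g (curvatureRadius g c s t) /
        gnorm g (velocity (IM n) c s t)) • velocity (IM n) c s t) =
        gnorm g (curvatureRadius g c s t) := by
      rw [gnorm_smul, abs_div, abs_mul, hε, one_mul, abs_of_pos (hρ0 t ht),
        abs_of_pos (hTpos t ht), div_mul_cancel₀ _ (hTpos t ht).ne']
    refine ⟨?_, hnorm.symm, by rw [curvatureLift, hnorm]; exact hρ0 t ht⟩
    change g.inner (c t) (curvatureRadius g c s t) (_ • velocity (IM n) c s t) = 0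
    rw [curvatureRadius]
    simp only [map_smul, smul_apply, smul_eq_mul,
      inner_normalAcc_velocity g (hreg t ht), mul_zero]
  refine ⟨hsm, fun t ht => ⟨hmem t ht, ?_⟩⟩
  have hd : MDifferentiableWithinAt 𝓘(ℝ, ℝ) (ITT n) (curvatureLift g ε c s) s t :=
    (hsm t ht).mdifferentiableWithinAt (by simp)
  have hker := velocity_mem_ker (Φ := levelMap g) (hs t ht) hd
    ((contMDiff_levelMap g _).mdifferentiableAt (by simp))
    (fun τ hτ => by rw [levelMap_eq_zero g (hmem τ hτ), levelMap_eq_zero g (hmem t ht)])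
  refine mem_firstFlag.2 ⟨(mem_tangentSubmodule_iff (hmem t ht)).2
    ((mem_tangentSet_iff_mfderiv (hmem t ht) _).2 hker), ?_⟩
  suffices h : ∃ l m : ℝ, velocity (IM n) c s t = l • (ε * gnorm g (curvatureRadius g c s t) /
      gnorm g (velocity (IM n) c s t)) • velocity (IM n) c s t ∧
      covDeriv g c (fun t => (ε * gnorm g (curvatureRadius g c s t) /
        gnorm g (velocity (IM n) c s t)) • velocity (IM n) c s t) s t =
        l • curvatureRadius g c s t + m • ((ε * gnorm g (curvatureRadius g c s t) /
        gnorm g (velocity (IM n) c s t)) • velocity (IM n) c s t) by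
    rw [baseMap_velocity (hs t ht) hd, connV_velocity g (hs t ht) hd]
    exact h
  have hNeq := normalAcc_eq_of_velocity_eq_smul g hs hc sV (sa.inv ha0)
    (fun τ hτ => by rw [smul_smul, Pi.inv_apply, inv_mul_cancel₀ (ha0 τ hτ), one_smul]) ht
    (inv_ne_zero (ha0 t ht)) (smul_ne_zero (ha0 t ht) (hreg t ht))
  -- the normal acceleration is a multiple of the curvature radius
  have hNR : normalAcc g c s t = (geodCurvature g c s t * gnorm g (normalAcc g c s t)) •
      curvatureRadius g c s t := by
    rw [curvatureRadius, smul_smul, smul_smul]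
    have h1 := hκ t ht
    have h2 := (hNpos t ht).ne'
    rw [show geodCurvature g c s t * gnorm g (normalAcc g c s t) * (1 / geodCurvature g c s t) *
      (1 / gnorm g (normalAcc g c s t)) = 1 by field_simp, one_smul]
  have gen : ∀ {E : Type} [AddCommGroup E] [Module ℝ E] (N D V ρ : E) (a b l m : ℝ), a ≠ 0 →
      N = a⁻¹ • (D - m • V) → N = b • ρ → a * b = l → D = l • ρ + m • V := by
    intro E _ _ N D V ρ a b l m ha h1 h2 h3
    rw [← h3, mul_smul, ← h2, h1, smul_smul, mul_inv_cancel₀ ha, one_smul, sub_add_cancel]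
  refine ⟨(ε * gnorm g (curvatureRadius g c s t) / gnorm g (velocity (IM n) c s t))⁻¹, _,
    by rw [smul_smul, inv_mul_cancel₀ (ha0 t ht), one_smul],
    gen _ _ _ _ _ _ _ _ (ha0 t ht) hNeq hNR ?_⟩
  rw [hρ t ht, geodCurvature]
  have h1 := (hNpos t ht).ne'
  have h2 := (hTpos t ht).ne'
  have h3 : ε * ε = 1 := by rw [← abs_mul_abs_self, hε, one_mul]
  have h4 : ε ^ 2 = 1 := by rw [sq, h3]
  field_simp
  rw [h4]

variable {g}

lemma IsLift.spec {σ : ℝ → TT n M} (h : IsLift g σ) :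
    IsSmoothCurve (ITT n) σ (Icc 0 1) ∧ (∀ t ∈ Icc (0 : ℝ) 1, σ t ∈ curvatureRadiiSet g) ∧
      (∀ t ∈ Icc (0 : ℝ) 1, velocity (ITT n) σ (Icc 0 1) t ∈ firstFlag g (σ t)) ∧
      IsRegularCurve n (fun t => (σ t).proj) (Icc 0 1) := by
  obtain ⟨c, ε, hc, hreg, hκ, hε, hσ⟩ := h
  have hs : UniqueDiffOn ℝ (Icc (0 : ℝ) 1) := uniqueDiffOn_Icc zero_lt_one
  have hε' : |ε| = 1 := by rcases hε with rfl | rfl <;> simp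
  obtain ⟨h1, h2⟩ := curvatureLift_spec g hs hc hreg hκ hε'
  have h3 : IsSmoothCurve (ITT n) σ (Icc 0 1) := h1.congr hσ
  refine ⟨h3, fun t ht => by rw [hσ t ht]; exact (h2 t ht).1, fun t ht => ?_, fun t ht => ?_⟩
  · exact velocity_congr_pred (fun q w => w ∈ firstFlag g q) hσ ht (h2 t ht).2
  · rw [← baseMap_velocity (hs t ht) ((h3 t ht).mdifferentiableWithinAt (by simp))]
    refine velocity_congr_pred (fun q w => baseMap n q w ≠ 0) hσ ht ?_
    rw [baseMap_velocity (hs t ht) ((h1 t ht).mdifferentiableWithinAt (by simp))]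
    exact hreg t ht

/-- On an interval, a continuous function without zeros has constant sign. -/
lemma exists_sign_of_continuousOn {l : ℝ → ℝ} (hl : ContinuousOn l (Icc 0 1))
    (h0 : ∀ t ∈ Icc (0 : ℝ) 1, l t ≠ 0) :
    ∃ ε : ℝ, (ε = 1 ∨ ε = -1) ∧ ∀ t ∈ Icc (0 : ℝ) 1, ε * l t = |l t| := by
  have h : (∀ t ∈ Icc (0 : ℝ) 1, 0 < l t) ∨ ∀ t ∈ Icc (0 : ℝ) 1, l t < 0 := by
    by_contra! hcon
    obtain ⟨⟨a, ha, hla⟩, b, hb, hlb⟩ := hcon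
    obtain ⟨t, ht, h⟩ := isPreconnected_Icc.intermediate_value ha hb hl ⟨hla, hlb⟩
    exact h0 t ht h
  rcases h with h | h
  · exact ⟨1, Or.inl rfl, fun t ht => by rw [abs_of_pos (h t ht), one_mul]⟩
  · exact ⟨-1, Or.inr rfl, fun t ht => by rw [abs_of_neg (h t ht), neg_one_mul]⟩

/-- A regular curve that is tangent to the first flag is one of the two lifts of its projection. -/
lemma isLift_of_velocity_mem {σ : ℝ → TT n M} (hσ : IsSmoothCurve (ITT n) σ (Icc 0 1))
    (hS : ∀ t ∈ Icc (0 : ℝ) 1, σ t ∈ curvatureRadiiSet g)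
    (hv : ∀ t ∈ Icc (0 : ℝ) 1, velocity (ITT n) σ (Icc 0 1) t ∈ firstFlag g (σ t))
    (hreg : IsRegularCurve n (fun t => (σ t).proj) (Icc 0 1)) : IsLift g σ := by
  have hs : UniqueDiffOn ℝ (Icc (0 : ℝ) 1) := uniqueDiffOn_Icc zero_lt_one
  obtain ⟨hc, sV, sR⟩ := isSmoothCurve_TT_iff.1 hσ
  have sT := smoothAlong_velocity hs hc
  let l : ℝ → ℝ := fun t => g.inner (σ t).proj (velocity (IM n) (fun t => (σ t).proj) (Icc 0 1) t)
    (σ t).2.1 / g.inner (σ t).proj (σ t).2.1 (σ t).2.1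
  have hV0 : ∀ t ∈ Icc (0 : ℝ) 1, (σ t).2.1 ≠ 0 := fun t ht => (gnorm_pos g).1 (hS t ht).2.2
  have hl : ContDiffOn ℝ ∞ l (Icc 0 1) := (sT.contDiffOn_inner g hc sV).div
    (sV.contDiffOn_inner g hc sV) fun t ht => (g.pos _ _ (hV0 t ht)).ne'
  have key : ∀ t ∈ Icc (0 : ℝ) 1,
      velocity (IM n) (fun t => (σ t).proj) (Icc 0 1) t = l t • (σ t).2.1 ∧
      ∃ m : ℝ, covDeriv g (fun t => (σ t).proj) (fun t => (σ t).2.1) (Icc 0 1) t =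
        l t • (σ t).2.2 + m • (σ t).2.1 := by
    intro t ht
    have hd := (hσ t ht).mdifferentiableWithinAt (by simp)
    obtain ⟨-, k, m, h1, h2⟩ := mem_firstFlag.1 (hv t ht)
    rw [baseMap_velocity (hs t ht) hd] at h1
    rw [connV_velocity g (hs t ht) hd] at h2
    have hk : l t = k := by
      change g.inner (σ t).proj _ _ / _ = k
      rw [h1, map_smul, smul_apply, smul_eq_mul, mul_div_cancel_right₀ _ (g.pos _ _ (hV0 t ht)).ne']
    rw [hk]
    exact ⟨h1, m, h2⟩
  have hl0 : ∀ t ∈ Icc (0 : ℝ) 1, l t ≠ 0 := fun t ht h0 => hreg t ht (by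
    rw [(key t ht).1, h0, zero_smul])
  obtain ⟨ε, hε, hεl⟩ := exists_sign_of_continuousOn hl.continuousOn hl0
  have hN : ∀ t ∈ Icc (0 : ℝ) 1,
      normalAcc g (fun t => (σ t).proj) (Icc 0 1) t = (l t * l t) • (σ t).2.2 := by
    intro t ht
    obtain ⟨m, hm⟩ := (key t ht).2
    have h := normalAcc_eq_of_velocity_eq_smul g hs hc sV hl (fun τ hτ => (key τ hτ).1) ht
      (hl0 t ht) (hV0 t ht)
    rw [h, hm, map_add, map_smul, map_smul, add_apply, smul_apply, smul_apply, (hS t ht).1,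
      smul_zero, zero_add, smul_eq_mul, mul_div_cancel_right₀ _ (g.pos _ _ (hV0 t ht)).ne',
      add_sub_cancel_right, smul_smul]
  have hκ : ∀ t ∈ Icc (0 : ℝ) 1, geodCurvature g (fun t => (σ t).proj) (Icc 0 1) t =
      1 / gnorm g (σ t).2.2 := by
    intro t ht
    have h1 := hl0 t ht
    have h2 : gnorm g (σ t).2.2 ≠ 0 := by rw [(hS t ht).2.1]; exact (hS t ht).2.2.ne'
    rw [geodCurvature, hN t ht, (key t ht).1, gnorm_smul, gnorm_smul, ← (hS t ht).2.1, mul_pow,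
      sq_abs, abs_mul_self]
    field_simp
  have hρ : ∀ t ∈ Icc (0 : ℝ) 1, curvatureRadius g (fun t => (σ t).proj) (Icc 0 1) t =
      (σ t).2.2 := by
    intro t ht
    have h1 := hl0 t ht
    have h2 : gnorm g (σ t).2.2 ≠ 0 := by rw [(hS t ht).2.1]; exact (hS t ht).2.2.ne'
    rw [curvatureRadius, hκ t ht, hN t ht, gnorm_smul, abs_mul_self, smul_smul, smul_smul]
    rw [show 1 / (1 / gnorm g (σ t).2.2) * (1 / (l t * l t * gnorm g (σ t).2.2)) * (l t * l t) = 1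
      by field_simp, one_smul]
  refine ⟨fun t => (σ t).proj, ε, hc, hreg, fun t ht => ?_, hε, fun t ht => ?_⟩
  · rw [hκ t ht, (hS t ht).2.1]
    exact one_div_ne_zero (hS t ht).2.2.ne'
  · have h2 : gnorm g (σ t).2.1 ≠ 0 := (hS t ht).2.2.ne'
    have h3 : |l t| ≠ 0 := abs_ne_zero.2 (hl0 t ht)
    rw [curvatureLift, hρ t ht, (key t ht).1, gnorm_smul, (hS t ht).2.1, smul_smul,
      show ε * gnorm g (σ t).2.1 / (|l t| * gnorm g (σ t).2.1) * l t = 1 by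
        rw [← hεl t ht] at h3 ⊢
        rw [mul_div_mul_right _ _ h2, div_mul_eq_mul_div, div_self h3], one_smul]

end Lifts

/-! ### The distribution spanned by the lifts is the first flag -/

section Distribution

variable {n : ℕ} {M : Type*} [TopologicalSpace M] [ChartedSpace (En n) M]
  [IsManifold (IM n) ∞ M]

lemma velocity_comp_mul {c : ℝ → TT n M} {a t : ℝ} {s s' : Set ℝ} (hs : UniqueDiffWithinAt ℝ s t)
    (hmaps : MapsTo (fun t => a * t) s s')
    (hc : MDifferentiableWithinAt 𝓘(ℝ, ℝ) (ITT n) c s' (a * t)) :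
    velocity (ITT n) (fun t => c (a * t)) s t = a • velocity (ITT n) c s' (a * t) := by
  have h1 : HasFDerivWithinAt (fun t : ℝ => a * t) (a • ContinuousLinearMap.id ℝ ℝ) s t :=
    ((hasFDerivAt_id t).const_mul a).hasFDerivWithinAt
  have h2 := (hc.hasMFDerivWithinAt.comp t h1.hasMFDerivWithinAt hmaps).mfderivWithin
    hs.uniqueMDiffWithinAt
  have h3 : velocity (ITT n) (fun t => c (a * t)) s t =
      mfderivWithin 𝓘(ℝ, ℝ) (ITT n) c s' (a * t) (a • (1 : ℝ)) := DFunLike.congr_fun h2 (1 : ℝ)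
  exact h3.trans (map_smul _ _ _)

variable {g : ContMDiffRiemannianMetric (IM n) ∞ (En n) (fun x : M => TangentSpace (IM n) x)}
  {W : Set (TT n M)} {b : ℕ → ∀ q : TT n M, TangentSpace (IM n) q.proj} {q : TT n M}

/-- If a field on the manifold of curvature radii takes values in the first flag and has nonvanishing
base component, its values belong to `D`: after rescaling time, its integral curves are lifts. -/
lemma mem_distr_of_isTangentField {X : ∀ q : TT n M, TangentSpace (ITT n) q}
    (hX : IsTangentField g W X) (h1 : ∀ p ∈ W ∩ curvatureRadiiSet g, X p ∈ firstFlag g p)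
    (h2 : ∀ p ∈ W ∩ curvatureRadiiSet g, baseMap n p (X p) ≠ 0)
    (hq : q ∈ W ∩ curvatureRadiiSet g) : X q ∈ distr g q := by
  obtain ⟨ε, hε, c, hc0, hcs, hcS, hcv⟩ := hX.exists_integralCurve hq
  let a : ℝ := ε / 2
  have ha : 0 < a := half_pos hε
  have hmaps : MapsTo (fun t => a * t) (Icc 0 1) (Ioo (-ε) ε) := fun t ht =>
    ⟨by nlinarith [mul_nonneg ha.le ht.1],
      by nlinarith [mul_le_mul_of_nonneg_left ht.2 ha.le, show a = ε / 2 from rfl]⟩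
  have hs : UniqueDiffOn ℝ (Icc (0 : ℝ) 1) := uniqueDiffOn_Icc zero_lt_one
  have hσ : IsSmoothCurve (ITT n) (fun t => c (a * t)) (Icc 0 1) :=
    ContMDiffOn.comp hcs ((contDiff_const.mul contDiff_id).contDiffOn.contMDiffOn) hmaps
  have hv : ∀ t ∈ Icc (0 : ℝ) 1,
      velocity (ITT n) (fun t => c (a * t)) (Icc 0 1) t = a • X (c (a * t)) := fun t ht => by
    rw [velocity_comp_mul (hs t ht) hmaps ((hcs _ (hmaps ht)).mdifferentiableWithinAt (by simp)),
      hcv _ (hmaps ht)]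
  have hlift : IsLift g (fun t => c (a * t)) := by
    refine isLift_of_velocity_mem hσ (fun t ht => (hcS _ (hmaps ht)).2) (fun t ht => ?_)
      fun t ht => ?_
    · rw [hv t ht]
      exact Submodule.smul_mem _ _ (h1 _ (hcS _ (hmaps ht)))
    · rw [← baseMap_velocity (hs t ht) ((hσ t ht).mdifferentiableWithinAt (by simp)), hv t ht]
      change baseMap n (c (a * t)) (a • X (c (a * t))) ≠ 0
      rw [map_smul]
      exact smul_ne_zero ha.ne' (h2 _ (hcS _ (hmaps ht)))
  have h0 : (0 : ℝ) ∈ Icc (0 : ℝ) 1 := ⟨le_rfl, zero_le_one⟩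
  have hc0' : c (a * 0) = q := by rw [mul_zero, hc0]
  have hmem : a • X q ∈ distr g q := by
    refine Submodule.subset_span ⟨_, hlift, ?_⟩
    rw [hv 0 h0]
    change (fun p => (⟨p, a • X p⟩ : TangentBundle (ITT n) (TT n M))) (c (a * 0)) = _
    rw [hc0']
  have h3 := Submodule.smul_mem _ a⁻¹ hmem
  rwa [smul_smul, inv_mul_cancel₀ ha.ne', one_smul] at h3

lemma IsTangentField.add {X Y : ∀ q : TT n M, TangentSpace (ITT n) q} (hX : IsTangentField g W X)
    (hY : IsTangentField g W Y) : IsTangentField g W (fun p => X p + Y p) where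
  isOpen := hX.isOpen
  smooth := ContMDiffOn.add_section hX.smooth hY.smooth
  tangent _ hp := (mem_tangentSubmodule_iff hp.2).1 (add_mem
    ((mem_tangentSubmodule_iff hp.2).2 (hX.tangent _ hp))
    ((mem_tangentSubmodule_iff hp.2).2 (hY.tangent _ hp)))

/-- The span of the initial velocities of the lifts is the first flag. -/
lemma distr_eq_firstFlag (hn : 2 ≤ n) (hb : IsOrthFrame g W b) (hq : q ∈ W ∩ curvatureRadiiSet g) :
    distr g q = firstFlag g q := by
  refine le_antisymm (Submodule.span_le.2 ?_) ?_
  · rintro v ⟨σ, hσ, h⟩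
    have key : ∀ (x y : TT n M) (u : TangentSpace (ITT n) x) (w : TangentSpace (ITT n) y),
        (⟨x, u⟩ : TangentBundle (ITT n) (TT n M)) = ⟨y, w⟩ → u ∈ firstFlag g x →
          w ∈ firstFlag g y := by
      intro x y u w h hu
      cases h
      exact hu
    exact key _ _ _ _ h (hσ.spec.2.2.1 0 ⟨le_rfl, zero_le_one⟩)
  · have hV0 : ∀ p ∈ W ∩ curvatureRadiiSet g, p.2.1 ≠ 0 := fun p hp => (gnorm_pos g).1 hp.2.2.2
    have h1 : (1 : ℕ) ∈ Icc 1 n := ⟨le_rfl, by omega⟩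
    have hbase1 : ∀ p : TT n M, baseMap n p (frameField g b 1 p) = p.2.1 := fun p => by
      rw [frameField_one, baseMap_liftVec]
    have hf1 : frameField g b 1 q ∈ distr g q :=
      mem_distr_of_isTangentField (isTangentField_frameField hb h1)
        (fun p hp => frameField_mem_firstFlag hb hp h1)
        (fun p hp => by rw [hbase1]; exact hV0 p hp) hq
    rw [firstFlag_eq_span hn hb hq, Submodule.span_le]
    rintro _ ⟨k, hk, rfl⟩
    obtain rfl | hk2 : k = 1 ∨ 2 ≤ k := by have := hk.1; omega
    · exact hf1
    -- the field `f_k` is vertical, so its integral curves are not lifts, but those of `f_1 + f_k` are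
    have hbasek : ∀ p : TT n M, baseMap n p (frameField g b k p) = 0 := by
      intro p
      obtain rfl | h3 : k = 2 ∨ 3 ≤ k := by omega
      · rw [frameField_two, baseMap_liftVec]
      · rw [frameField_of_three_le h3, baseMap_liftVec]
    have h : frameField g b 1 q + frameField g b k q ∈ distr g q :=
      mem_distr_of_isTangentField ((isTangentField_frameField hb h1).add
          (isTangentField_frameField hb hk))
        (fun p hp => add_mem (frameField_mem_firstFlag hb hp h1)
          (frameField_mem_firstFlag hb hp hk))
        (fun p hp => by rw [map_add, hbase1, hbasek, add_zero]; exact hV0 p hp) hq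
    exact (Submodule.add_mem_iff_right _ hf1).1 h

end Distribution

/-! ### Existence of orthogonal frames -/

section FrameExistence

variable {n : ℕ} {M : Type*} [TopologicalSpace M] [ChartedSpace (En n) M]
  [IsManifold (IM n) ∞ M]

/-- The section `u` of the pullback of `TM` to `TM ⊕ TM` is smooth on `W`. -/
abbrev IsSmoothSectionOn (u : ∀ p : TT n M, TangentSpace (IM n) p.proj) (W : Set (TT n M)) : Prop :=
  ContMDiffOn (ITT n) (IM n).tangent ∞
    (fun p : TT n M => (⟨p.proj, u p⟩ : TangentBundle (IM n) M)) W

variable {u v : ∀ p : TT n M, TangentSpace (IM n) p.proj} {W : Set (TT n M)}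

lemma isSmoothSectionOn_iff (hW : IsOpen W) : IsSmoothSectionOn u W ↔ ∀ q ∈ W,
    ContMDiffAt (ITT n) 𝓘(ℝ, En n) ∞ (fun p => chartDeriv (IM n) q.proj p.proj (u p)) q := by
  refine forall₂_congr fun q hq => ?_
  rw [← contMDiffAt_tangent_iff]
  exact ⟨fun h => h.contMDiffAt (hW.mem_nhds hq), fun h => h.contMDiffWithinAt⟩

lemma IsSmoothSectionOn.sub (hW : IsOpen W) (hu : IsSmoothSectionOn u W)
    (hv : IsSmoothSectionOn v W) : IsSmoothSectionOn (fun p => u p - v p) W := by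
  rw [isSmoothSectionOn_iff hW] at *
  exact fun q hq => ((hu q hq).sub (hv q hq)).congr_of_eventuallyEq
    (Filter.Eventually.of_forall fun p => map_sub _ _ _)

lemma IsSmoothSectionOn.smul (hW : IsOpen W) {a : TT n M → ℝ}
    (ha : ContMDiffOn (ITT n) 𝓘(ℝ, ℝ) ∞ a W) (hu : IsSmoothSectionOn u W) :
    IsSmoothSectionOn (fun p => a p • u p) W := by
  rw [isSmoothSectionOn_iff hW] at *
  exact fun q hq => ((ha.contMDiffAt (hW.mem_nhds hq)).smul (hu q hq)).congr_of_eventuallyEq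
    (Filter.Eventually.of_forall fun p => map_smul _ _ _)

lemma isSmoothSectionOn_sum {ι : Type*} {s : Finset ι}
    {w : ι → ∀ p : TT n M, TangentSpace (IM n) p.proj} (hW : IsOpen W)
    (hw : ∀ i ∈ s, IsSmoothSectionOn (w i) W) : IsSmoothSectionOn (fun p => ∑ i ∈ s, w i p) W := by
  rw [isSmoothSectionOn_iff hW]
  exact fun q hq => (contMDiffAt_finsetSum (t := s) fun i hi =>
    (isSmoothSectionOn_iff hW).1 (hw i hi) q hq).congr_of_eventuallyEq
    (Filter.Eventually.of_forall fun p => map_sum _ _ _)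

/-- Every tangent vector of `M` extends to a local smooth section. -/
lemma exists_isSmoothSectionOn_eq (q : TT n M) (e : TangentSpace (IM n) q.proj) :
    ∃ (W : Set (TT n M)) (u : ∀ p : TT n M, TangentSpace (IM n) p.proj), IsOpen W ∧ q ∈ W ∧
      IsSmoothSectionOn u W ∧ u q = e := by
  let τ := trivializationAt (En n) (TangentSpace (IM n) : M → Type _) q.proj
  have hproj : ContMDiff (ITT n) (IM n) ∞ (fun p : TT n M => p.proj) := Bundle.contMDiff_proj _
  have hq : q.proj ∈ τ.baseSet := mem_baseSet_trivializationAt _ _ _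
  refine ⟨(fun p => p.proj) ⁻¹' τ.baseSet, fun p => τ.symm p.proj (τ ⟨q.proj, e⟩).2,
    τ.open_baseSet.preimage hproj.continuous, hq, ?_, τ.symm_apply_apply_mk hq e⟩
  have h1 : ContMDiffOn (ITT n) ((IM n).prod 𝓘(ℝ, En n)) ∞
      (fun p : TT n M => ((p.proj, (τ ⟨q.proj, e⟩).2) : M × En n))
      ((fun p => p.proj) ⁻¹' τ.baseSet) := hproj.contMDiffOn.prodMk contMDiffOn_const
  have h2 := (Trivialization.contMDiffOn_symm (IB := IM n) (n := ∞) τ).comp h1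
    fun p hp => τ.mem_target.2 hp
  exact h2.congr fun p hp => (τ.mk_symm hp _)

lemma exists_isOpen_ne_zero
    (g : ContMDiffRiemannianMetric (IM n) ∞ (En n) (fun x : M => TangentSpace (IM n) x))
    (hW : IsOpen W) (hu : IsSmoothSectionOn u W) {q : TT n M} (hq : q ∈ W)
    (h0 : u q ≠ 0) : ∃ W' ⊆ W, IsOpen W' ∧ q ∈ W' ∧ ∀ p ∈ W', u p ≠ 0 := by
  refine ⟨W ∩ (fun p => g.inner p.proj (u p) (u p)) ⁻¹' {0}ᶜ, inter_subset_left,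
    (contMDiffOn_inner g hW hu hu).continuousOn.isOpen_inter_preimage hW isOpen_compl_singleton,
    ⟨hq, (g.pos _ _ h0).ne'⟩, fun p hp h => hp.2 ?_⟩
  change g.inner p.proj (u p) (u p) = 0
  rw [h]
  exact map_zero _

variable (g : ContMDiffRiemannianMetric (IM n) ∞ (En n) (fun x : M => TangentSpace (IM n) x))

lemma exists_ne_zero_orthogonal {m : ℕ} (hm : m < n) (x : M) (w : ℕ → TangentSpace (IM n) x) :
    ∃ e : TangentSpace (IM n) x, e ≠ 0 ∧ ∀ j ∈ Finset.Icc 1 m, g.inner x e (w j) = 0 := by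
  let L : TangentSpace (IM n) x →ₗ[ℝ] (Finset.Icc 1 m → ℝ) :=
    LinearMap.pi fun j => (g.inner x (w j)).toLinearMap
  have hfin : FiniteDimensional ℝ (TangentSpace (IM n) x) :=
    inferInstanceAs (FiniteDimensional ℝ (En n))
  have hdim : Module.finrank ℝ (TangentSpace (IM n) x) = n :=
    finrank_euclideanSpace_fin (𝕜 := ℝ)
  have hL : LinearMap.ker L ≠ ⊥ := LinearMap.ker_ne_bot_of_finrank_lt (by
    rw [hdim, Module.finrank_fintype_fun_eq_card, Fintype.card_coe, Nat.card_Icc]; omega)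
  obtain ⟨e, he, he0⟩ := (Submodule.ne_bot_iff _).1 hL
  refine ⟨e, he0, fun j hj => ?_⟩
  rw [g.symm]
  exact congrFun (LinearMap.mem_ker.1 he) ⟨j, hj⟩

/-- Gram–Schmidt over an open subset of `TM ⊕ TM`, starting from `V` and `R`: orthogonality holds
along the manifold of curvature radii. -/
lemma exists_orthogonal_sections {q : TT n M} (hq : q ∈ curvatureRadiiSet g) {m : ℕ} (hm : 2 ≤ m)
    (hmn : m ≤ n) : ∃ (W : Set (TT n M)) (w : ℕ → ∀ p : TT n M, TangentSpace (IM n) p.proj),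
      IsOpen W ∧ q ∈ W ∧ (w 1 = fun p => p.2.1) ∧ (w 2 = fun p => p.2.2) ∧
      (∀ j ∈ Finset.Icc 1 m, IsSmoothSectionOn (w j) W ∧ ∀ p ∈ W, w j p ≠ 0) ∧
      ∀ i ∈ Finset.Icc 1 m, ∀ j ∈ Finset.Icc 1 m, i ≠ j → ∀ p ∈ W ∩ curvatureRadiiSet g,
        g.inner p.proj (w i p) (w j p) = 0 := by
  induction m, hm using Nat.le_induction with
  | base =>
    have hR0 : q.2.2 ≠ 0 := (gnorm_pos g).1 (by rw [hq.2.1]; exact hq.2.2)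
    have hV0 : q.2.1 ≠ 0 := (gnorm_pos g).1 hq.2.2
    obtain ⟨W₁, -, hW₁, hq₁, h₁⟩ := exists_isOpen_ne_zero g isOpen_univ
      contMDiff_fibreV.contMDiffOn (mem_univ q) hV0
    obtain ⟨W₂, -, hW₂, hq₂, h₂⟩ := exists_isOpen_ne_zero g isOpen_univ
      contMDiff_fibreR.contMDiffOn (mem_univ q) hR0
    refine ⟨W₁ ∩ W₂, fun j p => if j = 1 then p.2.1 else p.2.2, hW₁.inter hW₂, ⟨hq₁, hq₂⟩, rfl, rfl,
      fun j hj => ?_, fun i hi j hj hij p hp => ?_⟩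
    · obtain rfl | rfl : j = 1 ∨ j = 2 := by have := Finset.mem_Icc.1 hj; omega
      · exact ⟨contMDiff_fibreV.contMDiffOn, fun p hp => h₁ p hp.1⟩
      · exact ⟨contMDiff_fibreR.contMDiffOn, fun p hp => h₂ p hp.2⟩
    · obtain ⟨rfl, rfl⟩ | ⟨rfl, rfl⟩ : (i = 1 ∧ j = 2) ∨ (i = 2 ∧ j = 1) := by
        have := Finset.mem_Icc.1 hi; have := Finset.mem_Icc.1 hj; omega
      · exact (g.symm _ _ _).trans hp.2.1
      · exact hp.2.1
  | succ m hm ih =>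
    obtain ⟨W, w, hW, hqW, hw1, hw2, hw, horth⟩ := ih (by omega)
    obtain ⟨e, he0, he⟩ := exists_ne_zero_orthogonal g (m := m) (by omega) q.proj fun j => w j q
    obtain ⟨W₁, E, hW₁, hq₁, hE, hEq⟩ := exists_isSmoothSectionOn_eq q e
    have hU := hW.inter hW₁
    let u : ∀ p : TT n M, TangentSpace (IM n) p.proj := fun p =>
      E p - ∑ j ∈ Finset.Icc 1 m, (g.inner p.proj (E p) (w j p) /
        g.inner p.proj (w j p) (w j p)) • w j p
    have hE' : IsSmoothSectionOn E (W ∩ W₁) := hE.mono inter_subset_right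
    have hw' : ∀ j ∈ Finset.Icc 1 m, IsSmoothSectionOn (w j) (W ∩ W₁) := fun j hj =>
      (hw j hj).1.mono inter_subset_left
    have hu : IsSmoothSectionOn u (W ∩ W₁) := hE'.sub hU <| isSmoothSectionOn_sum hU fun j hj =>
      (hw' j hj).smul hU ((contMDiffOn_inner g hU hE' (hw' j hj)).div₀
        (contMDiffOn_inner g hU (hw' j hj) (hw' j hj))
        fun p hp => (g.pos _ _ ((hw j hj).2 p hp.1)).ne')
    have huq : u q = e := by
      have h : ∀ j ∈ Finset.Icc 1 m, (g.inner q.proj (E q) (w j q) /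
          g.inner q.proj (w j q) (w j q)) • w j q = 0 := fun j hj => by
        rw [hEq, he j hj, zero_div, zero_smul]
      change E q - _ = e
      rw [Finset.sum_eq_zero h, sub_zero, hEq]
    have huw : ∀ i ∈ Finset.Icc 1 m, ∀ p ∈ W ∩ curvatureRadiiSet g,
        g.inner p.proj (w i p) (u p) = 0 := by
      intro i hi p hp
      change g.inner p.proj (w i p) (E p - _) = 0
      rw [map_sub, map_sum, Finset.sum_eq_single_of_mem i hi, map_smul, smul_eq_mul,
        div_mul_cancel₀ _ (g.pos _ _ ((hw i hi).2 p hp.1)).ne', g.symm, sub_self]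
      intro j hj hji
      rw [map_smul, horth i hi j hj hji.symm p hp, smul_zero]
    obtain ⟨W', hW'sub, hW', hqW', hu0⟩ := exists_isOpen_ne_zero g hU hu ⟨hqW, hq₁⟩
      (by rw [huq]; exact he0)
    refine ⟨W', Function.update w (m + 1) u, hW', hqW', ?_, ?_, fun j hj => ?_,
      fun i hi j hj hij p hp => ?_⟩
    · rw [Function.update_of_ne (by omega), hw1]
    · rw [Function.update_of_ne (by omega), hw2]
    · by_cases h : j = m + 1
      · subst h
        rw [Function.update_self]
        exact ⟨hu.mono hW'sub, hu0⟩
      · rw [Function.update_of_ne h]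
        have hj' : j ∈ Finset.Icc 1 m := by
          rw [Finset.mem_Icc] at hj ⊢; omega
        exact ⟨(hw' j hj').mono hW'sub, fun p hp => (hw j hj').2 p (hW'sub hp).1⟩
    · have hp' : p ∈ W ∩ curvatureRadiiSet g := ⟨(hW'sub hp.1).1, hp.2⟩
      rw [Finset.mem_Icc] at hi hj
      by_cases h : j = m + 1
      · subst h
        rw [Function.update_self, Function.update_of_ne hij]
        exact huw i (Finset.mem_Icc.2 (by omega)) p hp'
      · rw [Function.update_of_ne h]
        by_cases h' : i = m + 1
        · subst h'
          rw [Function.update_self, g.symm]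
          exact huw j (Finset.mem_Icc.2 (by omega)) p hp'
        · rw [Function.update_of_ne h']
          exact horth i (Finset.mem_Icc.2 (by omega)) j (Finset.mem_Icc.2 (by omega)) hij p hp'

/-- Around each point of the manifold of curvature radii there is an orthogonal frame of
`{R, V}^⊥` of vectors of norm `|R|`. -/
lemma exists_isOrthFrame (hn : 2 ≤ n) {q : TT n M} (hq : q ∈ curvatureRadiiSet g) :
    ∃ (W : Set (TT n M)) (b : ℕ → ∀ q : TT n M, TangentSpace (IM n) q.proj),
      q ∈ W ∧ IsOrthFrame g W b := by
  obtain ⟨W, w, hW, hqW, hw1, hw2, hw, horth⟩ := exists_orthogonal_sections g hq hn le_rfl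
  have hmem : ∀ j ∈ Icc 3 n, j ∈ Finset.Icc 1 n := fun j hj =>
    Finset.mem_Icc.2 ⟨le_trans (by norm_num) hj.1, hj.2⟩
  have h1 : 1 ∈ Finset.Icc 1 n := Finset.mem_Icc.2 (by omega)
  have h2 : 2 ∈ Finset.Icc 1 n := Finset.mem_Icc.2 (by omega)
  have hgn : ∀ j ∈ Finset.Icc 1 n,
      ContMDiffOn (ITT n) 𝓘(ℝ, ℝ) ∞ (fun p => gnorm g (w j p)) W := by
    intro j hj p hp
    have h := (Real.contDiffAt_sqrt (n := ∞) (g.pos _ _ ((hw j hj).2 p hp)).ne').contMDiffAt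
    exact ContMDiffAt.comp_contMDiffWithinAt p h (contMDiffOn_inner g hW (hw j hj).1 (hw j hj).1 p hp)
  refine ⟨W, fun j p => (gnorm g (w 2 p) / gnorm g (w j p)) • w j p, hqW, hW, fun j hj => ?_,
    fun j hj p hp => ?_, fun j hj p hp => ?_, fun i hi j hj hij p hp => ?_, fun j hj p hp => ?_⟩
  · exact (hw j (hmem j hj)).1.smul hW ((hgn 2 h2).div₀ (hgn j (hmem j hj))
      fun p hp => ((gnorm_pos g).2 ((hw j (hmem j hj)).2 p hp)).ne')
  · have h := horth j (hmem j hj) 2 h2 (by have := hj.1; omega) p hp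
    rw [hw2] at h
    rw [map_smul, smul_apply, h, smul_zero]
  · have h := horth j (hmem j hj) 1 h1 (by have := hj.1; omega) p hp
    rw [hw1] at h
    rw [map_smul, smul_apply, h, smul_zero]
  · rw [map_smul, map_smul, smul_apply, horth i (hmem i hi) j (hmem j hj) hij p hp, smul_zero,
      smul_zero]
  · have h := (gnorm_pos g).2 ((hw j (hmem j hj)).2 p hp.1)
    rw [gnorm_smul, abs_of_nonneg (div_nonneg (gnorm_nonneg g _) h.le),
      div_mul_cancel₀ _ h.ne', hw2]

end FrameExistence

end CurvatureRadii

end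

theorem mainTheorem1 (n : ℕ) (hn : 2 ≤ n) {M : Type*} [TopologicalSpace M] [T2Space M]
    [SecondCountableTopology M] [ChartedSpace (En n) M] [IsManifold (IM n) ∞ M]
    (g : ContMDiffRiemannianMetric (IM n) ∞ (En n) (fun x : M => TangentSpace (IM n) x)) :
    -- the manifold of curvature radii is an embedded submanifold of dimension `3n - 2`
    IsEmbeddedSubmanifold (ITT n) (curvatureRadiiSet g) (3 * n - 2) ∧
    -- the lifts take values in it
    (∀ σ : ℝ → TT n M, IsLift g σ → IsSmoothCurve (ITT n) σ (Icc 0 1) ∧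
      ∀ t ∈ Icc (0 : ℝ) 1, σ t ∈ curvatureRadiiSet g) ∧
    -- `D` is a smooth distribution of rank `n` on it
    IsSmoothDistribution (ITT n) (curvatureRadiiSet g) (distr g) n ∧
    -- characterisation of the lifts
    (∀ σ : ℝ → TT n M, IsSmoothCurve (ITT n) σ (Icc 0 1) →
      (∀ t ∈ Icc (0 : ℝ) 1, σ t ∈ curvatureRadiiSet g) →
      (IsLift g σ ↔
        (∀ t ∈ Icc (0 : ℝ) 1, velocity (ITT n) σ (Icc 0 1) t ∈ distr g (σ t)) ∧
        IsRegularCurve n (fun t => (σ t).proj) (Icc 0 1))) ∧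
    -- `D` is bracket generating of step 3 with growth `(n, 2n - 1, 3n - 2)`
    (∀ q ∈ curvatureRadiiSet g,
      Module.finrank ℝ (bracketFlag (ITT n) (curvatureRadiiSet g) (distr g) 1 q) = n ∧
      Module.finrank ℝ (bracketFlag (ITT n) (curvatureRadiiSet g) (distr g) 2 q) = 2 * n - 1 ∧
      Module.finrank ℝ (bracketFlag (ITT n) (curvatureRadiiSet g) (distr g) 3 q) = 3 * n - 2 ∧
      (bracketFlag (ITT n) (curvatureRadiiSet g) (distr g) 2 q : Set (TangentSpace (ITT n) q)) ≠
        tangentSet (ITT n) (curvatureRadiiSet g) q ∧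
      (bracketFlag (ITT n) (curvatureRadiiSet g) (distr g) 3 q : Set (TangentSpace (ITT n) q)) =
        tangentSet (ITT n) (curvatureRadiiSet g) q) ∧
    -- local frames `b` exist around each point, and each of them determines fields `f`
    (∀ q ∈ curvatureRadiiSet g, ∃ (W : Set (TT n M))
      (b : ℕ → ∀ q : TT n M, TangentSpace (IM n) q.proj), q ∈ W ∧ IsOrthFrame g W b) ∧
    (∀ (W : Set (TT n M)) (b : ℕ → ∀ q : TT n M, TangentSpace (IM n) q.proj),
      IsOrthFrame g W b →
      (∃ f : ℕ → ∀ q : TT n M, TangentSpace (ITT n) q, IsAdaptedFrame g W b f) ∧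
      -- every such `f` is a local basis of `D`, with the stated brackets
      ∀ f : ℕ → ∀ q : TT n M, TangentSpace (ITT n) q, IsAdaptedFrame g W b f →
        ∀ q ∈ W ∩ curvatureRadiiSet g,
          LinearIndepOn ℝ (fun k => f k q) (Icc 1 n) ∧
          distr g q = Submodule.span ℝ ((fun k => f k q) '' Icc 1 n) ∧
          bracketFlag (ITT n) (curvatureRadiiSet g) (distr g) 2 q =
            distr g q ⊔ Submodule.span ℝ ((fun k => br (f 1) (f k) q) '' Icc 2 n) ∧
          Disjoint (distr g q) (Submodule.span ℝ ((fun k => br (f 1) (f k) q) '' Icc 2 n)) ∧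
          bracketFlag (ITT n) (curvatureRadiiSet g) (distr g) 3 q =
            bracketFlag (ITT n) (curvatureRadiiSet g) (distr g) 2 q ⊔
              Submodule.span ℝ ((fun k => br (f 1) (br (f k) (f 1)) q) '' Icc 2 n) ∧
          Disjoint (bracketFlag (ITT n) (curvatureRadiiSet g) (distr g) 2 q)
            (Submodule.span ℝ ((fun k => br (f 1) (br (f k) (f 1)) q) '' Icc 2 n)) ∧
          (∀ j ∈ Icc 2 n, ∀ k ∈ Icc 2 n, br (f j) (f k) q ∈ distr g q) ∧
          (∀ j ∈ Icc 2 n, ∀ k ∈ Icc 2 n, br (f j) (br (f 1) (f k)) q ∈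
            bracketFlag (ITT n) (curvatureRadiiSet g) (distr g) 2 q)) := by
  have hfr : ∀ q ∈ curvatureRadiiSet g, ∃ (W : Set (TT n M))
      (b : ℕ → ∀ q : TT n M, TangentSpace (IM n) q.proj), q ∈ W ∧ IsOrthFrame g W b :=
    fun q hq => exists_isOrthFrame g hn hq
  have hΔ : ∀ q ∈ curvatureRadiiSet g, distr g q = firstFlag g q := fun q hq => by
    obtain ⟨W, b, hqW, hb⟩ := hfr q hq
    exact distr_eq_firstFlag hn hb ⟨hqW, hq⟩
  have hrank : ∀ q ∈ curvatureRadiiSet g, Module.finrank ℝ (firstFlag g q) = n ∧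
      Module.finrank ℝ (secondFlag g q) = 2 * n - 1 ∧
      Module.finrank ℝ (tangentSubmodule g q) = 3 * n - 2 := fun q hq => by
    obtain ⟨W, b, hqW, hb⟩ := hfr q hq
    have hf := isAdaptedFrame_frameField hb
    have h1 := finrank_firstFlag hn hb ⟨hqW, hq⟩
    have h2 := (secondFlag_complement hn hb hf ⟨hqW, hq⟩).2.2
    have h3 := (tangentSubmodule_complement hn hb hf ⟨hqW, hq⟩).2.2
    omega
  have hflag2 : ∀ q ∈ curvatureRadiiSet g,
      bracketFlag (ITT n) (curvatureRadiiSet g) (distr g) 2 q = secondFlag g q := fun q hq => by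
    obtain ⟨W, b, hqW, hb⟩ := hfr q hq
    exact bracketFlag_two hn hΔ hb ⟨hqW, hq⟩
  have hflag3 : ∀ q ∈ curvatureRadiiSet g,
      bracketFlag (ITT n) (curvatureRadiiSet g) (distr g) 3 q = tangentSubmodule g q :=
    fun q hq => bracketFlag_three hn hΔ hfr hq
  refine ⟨isEmbeddedSubmanifold_curvatureRadiiSet g hn, fun σ hσ => ⟨hσ.spec.1, hσ.spec.2.1⟩,
    fun q hq => ?_, fun σ hσ hS => ?_, fun q hq => ?_, hfr,
    fun W b hb => ⟨⟨_, isAdaptedFrame_frameField hb⟩, fun f hf q hq => ?_⟩⟩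
  · obtain ⟨W, b, hqW, hb⟩ := hfr q hq
    rw [hΔ q hq]
    refine ⟨fun w hw => (mem_tangentSubmodule_iff hq).1 (mem_firstFlag.1 hw).1, (hrank q hq).1, W,
      fun i => frameField g b (i + 1), hb.isOpen, hqW,
      fun i => isSmoothFieldOn_frameField hb ⟨by omega, i.2⟩, fun p hp => ?_⟩
    rw [hΔ p hp.2, firstFlag_eq_span hn hb hp]
    congr 1
    ext w
    constructor
    · rintro ⟨k, hk, rfl⟩
      exact ⟨⟨k - 1, by have := hk.1; have := hk.2; omega⟩, by
        simp only [Nat.sub_add_cancel hk.1]⟩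
    · rintro ⟨i, rfl⟩
      exact ⟨i + 1, ⟨by omega, i.2⟩, rfl⟩
  · constructor
    · intro h
      exact ⟨fun t ht => by rw [hΔ _ (hS t ht)]; exact h.spec.2.2.1 t ht, h.spec.2.2.2⟩
    · rintro ⟨h1, h2⟩
      exact isLift_of_velocity_mem hσ hS (fun t ht => by rw [← hΔ _ (hS t ht)]; exact h1 t ht) h2
  · obtain ⟨h1, h2, h3⟩ := hrank q hq
    have hflag1 : bracketFlag (ITT n) (curvatureRadiiSet g) (distr g) 1 q = firstFlag g q := hΔ q hq
    rw [hflag1, hflag2 q hq, hflag3 q hq, ← coe_tangentSubmodule g hq]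
    refine ⟨h1, h2, h3, fun h => ?_, rfl⟩
    rw [SetLike.coe_injective h] at h2
    omega
  · have hfq : ∀ k ∈ Icc 1 n, f k q = frameField g b k q := fun k hk => hf.eq_frameField hb hk hq
    obtain ⟨h1, h2, -⟩ := secondFlag_complement hn hb hf hq
    obtain ⟨h3, h4, -⟩ := tangentSubmodule_complement hn hb hf hq
    rw [hflag2 q hq.2, hflag3 q hq.2, hΔ q hq.2]
    refine ⟨(linearIndepOn_frameField hb hq).congr fun k hk => (hfq k hk).symm, ?_, h1, h2, h3, h4,
      fun j hj k hk => br_mem_firstFlag hb hf hj hk hq,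
      fun j hj k hk => br_br_one_mem_secondFlag hn hb hf hj hk hq⟩
    rw [firstFlag_eq_span hn hb hq]
    congr 1
    exact image_congr fun k hk => (hfq k hk).symm
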